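/- Let $K$ be a commutative ring. Let $\mathbf{Bim}$ be the bicategory whose $0$-cells are small $K$-linear categories, whose $1$-cells $\phi:\mathcal A\rightsquigarrow\mathcal B$ are the $\mathcal A$-$\mathcal B$-bimodules, i.e. the $K$-functors $\mathcal B^{op}\otimes\mathcal A\to\mathrm{Mod}_K$, and whose $2$-cells are the natural transformations. The composite of $\phi:\mathcal A\rightsquigarrow\mathcal B$ and $\psi:\mathcal B\rightsquigarrow\mathcal C$ is $\psi\otimes\phi:\mathcal A\rightsquigarrow\mathcal C$, $(\psi\otimes\phi)(c,a)=\psi(c,-)\otimes_{\mathcal B}\phi(-,a)$, where, for $F:\mathcal B\to\mathrm{Mod}_K$ and $G:\mathcal B^{op}\to\mathrm{Mod}_K$, $F\otimes_{\mathcal B}G$ is the quotient of $\bigoplus_b F(b)\otimes_K G(b)$ by the relations $F(u)(s)\otimes t=s\otimes G(u)(t)$; the identity of $\mathcal B$ is $1_{\mathcal B}(b,b')=\mathcal B(b,b')$. Associativity and unit isomorphisms are suppressed. Let $\eta_f,\varepsilon_f: f\dashv f^*$ be an adjunction in $\mathbf{Bim}$, with $f:\mathcal A\rightsquigarrow\mathcal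 B$, $f^*:\mathcal B\rightsquigarrow\mathcal A$, $\eta_f:1_{\mathcal A}\to f^*\otimes f$ and $\varepsilon_f:f\otimes f^*\to 1_{\mathcal B}$. Let $S_f$ be the monoid $f^*\otimes f$ in $\mathbf{Bim}(\mathcal A,\mathcal A)$ with unit $\eta_f$ and multiplication $f^*\otimes\varepsilon_f\otimes f$, and let $\mathfrak C_f$ be the comonoid $f\otimes f^*$ in $\mathbf{Bim}(\mathcal B,\mathcal B)$ with counit $\varepsilon_f$ and comultiplication $f\otimes\eta_f\otimes f^*$. Let $\mathrm{End}_{\mathcal B}(\mathfrak C_f)$ be the monoid, under composition $\alpha\cdot\beta=\alpha\circ\beta$, of the comonoid endomorphisms of $\mathfrak C_f$. The $\mathcal A$-subbimodules of $S_f$ form a monoid under $(I,J)\mapsto IJ$, the image of $I\otimes J\to S_f\otimes S_f\to S_f$, with the image of $\eta_f$ as unit. Let $\mathbf I^l_{\mathcal A}(S_f)$ (resp. $\mathbf I^r_{\mathcal A}(S_f)$) be the set of those $i:I\hookrightarrow S_f$ for which $S_f\otimes I\to S_f$, $s\otimes x\mapsto sx$ (resp. $I\otimes S_f\to S_f$,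 $x\otimes s\mapsto xs$) is an isomorphism. For $I\hookrightarrow S_f$ put $$\xi^l_I=(\varepsilon_f\otimes f)\circ(f\otimes i): f\otimes I\to f,\qquad \xi^r_I=(f^*\otimes\varepsilon_f)\circ(i\otimes f^*): I\otimes f^*\to f^*.$$ Consider the two statements: **(L)** $\mathbf I^l_{\mathcal A}(S_f)$ is a submonoid of the monoid of subbimodules; for each $I$ in it $\xi^l_I$ is an isomorphism; and $I\mapsto\Gamma_f(I)$, the composite $$f\otimes f^*\xrightarrow{(\xi^l_I)^{-1}\otimes f^*}f\otimes I\otimes f^*\xrightarrow{f\otimes i\otimes f^*}f\otimes f^*\otimes f\otimes f^*\xrightarrow{f\otimes f^*\otimes\varepsilon_f}f\otimes f^*,$$ is an isomorphism of monoids $\Gamma_f:\mathbf I^l_{\mathcal A}(S_f)\to\mathrm{End}_{\mathcal B}(\mathfrak C_f)$. **(R)** $\mathbf I^r_{\mathcal A}(S_f)$ is a submonoid of the monoid of subbimodules; for each $I$ in it $\xi^r_I$ is an isomorphism; and $I\mapsto\Gamma_{f^*}(I)$, the composite $$f\otimes f^*\xrightarrow{f\otimes(\xi^r_I)^{-1}}f\otimes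 I\otimes f^*\xrightarrow{f\otimes i\otimes f^*}f\otimes f^*\otimes f\otimes f^*\xrightarrow{\varepsilon_f\otimes f\otimes f^*}f\otimes f^*,$$ is an isomorphism of monoids $\Gamma_{f^*}:(\mathbf I^r_{\mathcal A}(S_f))^{op}\to\mathrm{End}_{\mathcal B}(\mathfrak C_f)$. **Theorem.** 1. If the functor $f\otimes-:[\mathcal A^{op},\mathrm{Mod}_K]\to[\mathcal B^{op},\mathrm{Mod}_K]$ (between categories of $K$-functors) is comonadic, then (L) holds. 2. If the functor $-\otimes f^*:[\mathcal A,\mathrm{Mod}_K]\to[\mathcal B,\mathrm{Mod}_K]$ is comonadic, then (R) holds. 3. If $f$ is right flat (for every $0$-cell $\mathcal C$ the functor $f\otimes-:\mathbf{Bim}(\mathcal C,\mathcal A)\to\mathbf{Bim}(\mathcal C,\mathcal B)$ preserves equalizers) and $\eta_f$ is right pure (for every $h:\mathcal C\rightsquigarrow\mathcal A$, $\eta_f\otimes h$ is a regular monomorphism), then (L) holds. 4. If $f^*$ is left flat (for every $0$-cell $\mathcal C$ the functor $-\otimes f^*:\mathbf{Bim}(\mathcal A,\mathcal C)\to\mathbf{Bim}(\mathcal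 B,\mathcal C)$ preserves equalizers) and $\eta_f$ is left pure (for every $h:\mathcal A\rightsquigarrow\mathcal C$, $h\otimes\eta_f$ is a regular monomorphism), then (R) holds. 5. If $f$ is separable (i.e. $\eta_f$ is a split monomorphism in $\mathbf{Bim}(\mathcal A,\mathcal A)$), then both (L) and (R) hold. -/

import Mathlib

open CategoryTheory Opposite
open scoped TensorProduct DirectSum

universe u
set_option linter.unusedVariables false

noncomputable section

namespace KBim

variable {K : Type u} [CommRing K]

section Tensor

variable {A : Type u} [SmallCategory A]

/-- The submodule `Q` of relations defining the tensor product of functors. -/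
def tensorRel (F : A ⥤ ModuleCat.{u} K) (G : Aᵒᵖ ⥤ ModuleCat.{u} K) :
    Submodule K (DirectSum A fun a => F.obj a ⊗[K] G.obj (op a)) :=
  open Classical in
  Submodule.span K {x | ∃ (a a' : A) (u : a ⟶ a') (s : F.obj a) (t : G.obj (op a')),
    x = DirectSum.lof K A (fun a => F.obj a ⊗[K] G.obj (op a)) a' ((F.map u).hom s ⊗ₜ[K] t) -
      DirectSum.lof K A (fun a => F.obj a ⊗[K] G.obj (op a)) a (s ⊗ₜ[K] (G.map u.op).hom t)}

/-- The tensor product `F ⊗ G = (⨁ a, F a ⊗ G a) / Q` of a covariant and a contravariant functor. -/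
def Tens (F : A ⥤ ModuleCat.{u} K) (G : Aᵒᵖ ⥤ ModuleCat.{u} K) : Type u :=
  (DirectSum A fun a => F.obj a ⊗[K] G.obj (op a)) ⧸ tensorRel F G

namespace Tens

variable (F F' F'' : A ⥤ ModuleCat.{u} K) (G G' G'' : Aᵒᵖ ⥤ ModuleCat.{u} K)

instance : AddCommGroup (Tens F G) :=
  inferInstanceAs (AddCommGroup ((DirectSum A fun a => F.obj a ⊗[K] G.obj (op a)) ⧸ tensorRel F G))

instance : Module K (Tens F G) :=
  inferInstanceAs (Module K ((DirectSum A fun a => F.obj a ⊗[K] G.obj (op a)) ⧸ tensorRel F G))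

/-- The class `s ⊗ t` in `F ⊗ G` of `s ∈ F a` and `t ∈ G a`. -/
def mk (a : A) : F.obj a →ₗ[K] G.obj (op a) →ₗ[K] Tens F G :=
  open Classical in
  (TensorProduct.mk K (F.obj a) (G.obj (op a))).compr₂
    ((tensorRel F G).mkQ ∘ₗ DirectSum.lof K A (fun a => F.obj a ⊗[K] G.obj (op a)) a)

variable {F F' F'' G G' G''}

lemma mk_map {a a' : A} (u : a ⟶ a') (s : F.obj a) (t : G.obj (op a')) :
    mk F G a' ((F.map u).hom s) t = mk F G a s ((G.map u.op).hom t) := by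
  classical
  refine (Submodule.Quotient.eq _).2 (Submodule.subset_span ⟨a, a', u, s, t, ?_⟩)
  congr!

variable {M : Type*} [AddCommGroup M] [Module K M]

/-- Linear maps out of `F ⊗ G` are balanced families of bilinear maps. -/
def lift (φ : ∀ a, F.obj a →ₗ[K] G.obj (op a) →ₗ[K] M)
    (h : ∀ (a a' : A) (u : a ⟶ a') (s : F.obj a) (t : G.obj (op a')),
      φ a' ((F.map u).hom s) t = φ a s ((G.map u.op).hom t)) : Tens F G →ₗ[K] M :=
  open Classical in
  (tensorRel F G).liftQ (DirectSum.toModule K A M fun a => TensorProduct.lift (φ a)) (by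
    rw [tensorRel, Submodule.span_le]
    rintro _ ⟨a, a', u, s, t, rfl⟩
    simp [h])

@[simp]
lemma lift_mk (φ : ∀ a, F.obj a →ₗ[K] G.obj (op a) →ₗ[K] M) (h) (a : A) (s : F.obj a)
    (t : G.obj (op a)) : lift φ h (mk F G a s t) = φ a s t := by
  classical
  change DirectSum.toModule K A M (fun a => TensorProduct.lift (φ a))
    (DirectSum.lof K A _ a (s ⊗ₜ[K] t)) = _
  simp

@[ext]
lemma hom_ext {φ ψ : Tens F G →ₗ[K] M}
    (h : ∀ (a : A) (s : F.obj a) (t : G.obj (op a)), φ (mk F G a s t) = ψ (mk F G a s t)) :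
    φ = ψ := by
  classical
  refine Submodule.linearMap_qext _ (DirectSum.linearMap_ext _ fun a => TensorProduct.ext' ?_)
  intro s t
  exact h a s t

/-- Functoriality of the tensor product of functors. -/
def map (σ : F ⟶ F') (τ : G ⟶ G') : Tens F G →ₗ[K] Tens F' G' :=
  lift (fun a => (mk F' G' a).compl₁₂ (σ.app a).hom (τ.app (op a)).hom) (by
    intro a a' u s t
    have h1 := congr($(σ.naturality u) s)
    have h2 := congr($(τ.naturality u.op) t)
    simp only [ModuleCat.comp_apply] at h1 h2
    simp [h1, h2, mk_map])

@[simp]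
lemma map_mk (σ : F ⟶ F') (τ : G ⟶ G') (a : A) (s : F.obj a) (t : G.obj (op a)) :
    map σ τ (mk F G a s t) = mk F' G' a ((σ.app a).hom s) ((τ.app (op a)).hom t) := by
  simp [map]

end Tens

/-- The tensor product of functors, as a functor of two variables. -/
def tensorFunctor : (A ⥤ ModuleCat.{u} K) ⥤ (Aᵒᵖ ⥤ ModuleCat.{u} K) ⥤ ModuleCat.{u} K where
  obj F :=
    { obj := fun G => ModuleCat.of K (Tens F G)
      map := fun τ => ModuleCat.ofHom (Tens.map (𝟙 F) τ)
      map_id := fun G => by ext : 1; apply Tens.hom_ext; simp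
      map_comp := fun σ τ => by ext : 1; apply Tens.hom_ext; simp }
  map σ :=
    { app := fun G => ModuleCat.ofHom (Tens.map σ (𝟙 G))
      naturality := fun G G' τ => by ext : 1; apply Tens.hom_ext; simp }
  map_id F := by ext G : 3; apply Tens.hom_ext; simp
  map_comp σ τ := by ext G : 3; apply Tens.hom_ext; simp

end Tensor


section Assoc

variable {B C : Type u} [SmallCategory B] [SmallCategory C]
variable (F : C ⥤ ModuleCat.{u} K) (G : B ⥤ Cᵒᵖ ⥤ ModuleCat.{u} K) (H : Bᵒᵖ ⥤ ModuleCat.{u} K)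

/-- The functor `b ↦ F ⊗ G(b, -)`. -/
abbrev tensL : B ⥤ ModuleCat.{u} K := G ⋙ tensorFunctor.obj F

/-- The functor `c ↦ G(-, c) ⊗ H`. -/
abbrev tensR : Cᵒᵖ ⥤ ModuleCat.{u} K := G.flip ⋙ tensorFunctor.flip.obj H


/-- `Tens.mk` for `(F ⊗ G) ⊗ H`. -/
def mkL₂ (b : B) : Tens F (G.obj b) →ₗ[K] H.obj (op b) →ₗ[K] Tens (tensL F G) H :=
  Tens.mk (tensL F G) H b

/-- `Tens.mk` for `F ⊗ (G ⊗ H)`. -/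
def mkR₂ (c : C) : F.obj c →ₗ[K] Tens (G.flip.obj (op c)) H →ₗ[K] Tens F (tensR G H) :=
  Tens.mk F (tensR G H) c

/-- `Tens.mk` for `G(-, c) ⊗ H`. -/
def mkG (b : B) (c : C) : (G.obj b).obj (op c) →ₗ[K] H.obj (op b) →ₗ[K]
    Tens (G.flip.obj (op c)) H :=
  Tens.mk (G.flip.obj (op c)) H b

/-- The elements `(s ⊗ g) ⊗ h` of `(F ⊗ G) ⊗ H`. -/
def mkL (b : B) (c : C) : F.obj c →ₗ[K] (G.obj b).obj (op c) →ₗ[K] H.obj (op b) →ₗ[K]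
    Tens (tensL F G) H :=
  (Tens.mk F (G.obj b) c).compr₂ (mkL₂ F G H b)

/-- The elements `s ⊗ (g ⊗ h)` of `F ⊗ (G ⊗ H)`. -/
def mkR (b : B) (c : C) : F.obj c →ₗ[K] (G.obj b).obj (op c) →ₗ[K] H.obj (op b) →ₗ[K]
    Tens F (tensR G H) :=
  (LinearMap.lcomp K _ (mkG G H b c)) ∘ₗ (LinearMap.llcomp K _ _ _) ∘ₗ mkR₂ F G H c

variable {F G H} {M : Type*} [AddCommGroup M] [Module K M]

lemma mkL_apply (b : B) (c : C) (s : F.obj c) (g : (G.obj b).obj (op c)) (h : H.obj (op b)) :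
    mkL F G H b c s g h = Tens.mk (tensL F G) H b (Tens.mk F (G.obj b) c s g) h := rfl

lemma mkR_apply (b : B) (c : C) (s : F.obj c) (g : (G.obj b).obj (op c)) (h : H.obj (op b)) :
    mkR F G H b c s g h = Tens.mk F (tensR G H) c s (Tens.mk (G.flip.obj (op c)) H b g h) := rfl

lemma mkL_map_left {c c' : C} (u : c ⟶ c') (b : B) (s : F.obj c) (g : (G.obj b).obj (op c'))
    (h : H.obj (op b)) :
    mkL F G H b c' ((F.map u).hom s) g h = mkL F G H b c s (((G.obj b).map u.op).hom g) h :=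
  congrArg (fun z => mkL₂ F G H b z h) (Tens.mk_map u s g)

lemma mkL_map_right {b b' : B} (u : b ⟶ b') (c : C) (s : F.obj c) (g : (G.obj b).obj (op c))
    (h : H.obj (op b')) :
    mkL F G H b' c s (((G.map u).app (op c)).hom g) h = mkL F G H b c s g ((H.map u.op).hom h) := by
  refine Eq.trans (congrArg (fun z => mkL₂ F G H b' z h) ?_)
    (Tens.mk_map (F := tensL F G) u (Tens.mk F (G.obj b) c s g) h)
  exact (Tens.map_mk (𝟙 F) (G.map u) c s g).symm

lemma mkR_map_right {b b' : B} (u : b ⟶ b') (c : C) (s : F.obj c) (g : (G.obj b).obj (op c))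
    (h : H.obj (op b')) :
    mkR F G H b' c s (((G.map u).app (op c)).hom g) h = mkR F G H b c s g ((H.map u.op).hom h) :=
  congrArg (fun z => mkR₂ F G H c s z) (Tens.mk_map (F := G.flip.obj (op c)) u g h)

lemma mkR_map_left {c c' : C} (u : c ⟶ c') (b : B) (s : F.obj c) (g : (G.obj b).obj (op c'))
    (h : H.obj (op b)) :
    mkR F G H b c' ((F.map u).hom s) g h = mkR F G H b c s (((G.obj b).map u.op).hom g) h := by
  refine Eq.trans (Tens.mk_map (F := F) (G := tensR G H) u s
    (Tens.mk (G.flip.obj (op c')) H b g h)) (congrArg (fun z => mkR₂ F G H c s z) ?_)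
  exact Tens.map_mk (G.flip.map u.op) (𝟙 H) b g h

lemma extL {φ ψ : Tens (tensL F G) H →ₗ[K] M}
    (w : ∀ b c s g h, φ (mkL F G H b c s g h) = ψ (mkL F G H b c s g h)) : φ = ψ := by
  apply Tens.hom_ext
  intro b x h
  exact LinearMap.congr_fun (Tens.hom_ext
    (φ := φ ∘ₗ ((mkL₂ F G H b).flip h))
    (ψ := ψ ∘ₗ ((mkL₂ F G H b).flip h))
    (fun c s g => w b c s g h)) x

lemma extR {φ ψ : Tens F (tensR G H) →ₗ[K] M}
    (w : ∀ b c s g h, φ (mkR F G H b c s g h) = ψ (mkR F G H b c s g h)) : φ = ψ := by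
  apply Tens.hom_ext
  intro c s x
  exact LinearMap.congr_fun (Tens.hom_ext
    (φ := φ ∘ₗ (mkR₂ F G H c s))
    (ψ := ψ ∘ₗ (mkR₂ F G H c s))
    (fun b g h => w b c s g h)) x

section lift

variable (φ : ∀ b c, F.obj c →ₗ[K] (G.obj b).obj (op c) →ₗ[K] H.obj (op b) →ₗ[K] M)
  (h₁ : ∀ {c c' : C} (u : c ⟶ c') (b : B) (s : F.obj c) (g : (G.obj b).obj (op c'))
    (h : H.obj (op b)), φ b c' ((F.map u).hom s) g h = φ b c s (((G.obj b).map u.op).hom g) h)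
  (h₂ : ∀ {b b' : B} (u : b ⟶ b') (c : C) (s : F.obj c) (g : (G.obj b).obj (op c))
    (h : H.obj (op b')),
    φ b' c s (((G.map u).app (op c)).hom g) h = φ b c s g ((H.map u.op).hom h))

/-- The partial lift of a trilinear map. -/
def liftLaux (b : B) : Tens F (G.obj b) →ₗ[K] H.obj (op b) →ₗ[K] M :=
  Tens.lift (φ b) (fun _ _ u s g => LinearMap.ext fun h => h₁ u b s g h)

/-- The partial lift of a trilinear map. -/
def liftRaux (c : C) : Tens (G.flip.obj (op c)) H →ₗ[K] F.obj c →ₗ[K] M :=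
  Tens.lift (fun b => (LinearMap.lflip (R₀ := K)).toLinearMap ∘ₗ (φ b c).flip)
    (fun _ _ u g h => LinearMap.ext fun s => h₂ u c s g h)

lemma liftLaux_mk (b : B) (c : C) (s : F.obj c) (g : (G.obj b).obj (op c)) (h : H.obj (op b)) :
    liftLaux φ h₁ b (Tens.mk F (G.obj b) c s g) h = φ b c s g h := by
  rw [liftLaux, Tens.lift_mk]

lemma liftRaux_mk (b : B) (c : C) (s : F.obj c) (g : (G.obj b).obj (op c)) (h : H.obj (op b)) :
    liftRaux φ h₂ c (Tens.mk (G.flip.obj (op c)) H b g h) s = φ b c s g h := by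
  rw [liftRaux, Tens.lift_mk]
  rfl

/-- Linear maps out of `(F ⊗ G) ⊗ H`. -/
def liftL : Tens (tensL F G) H →ₗ[K] M :=
  Tens.lift (F := tensL F G) (liftLaux φ h₁) (fun b b' u x h =>
    LinearMap.congr_fun (Tens.hom_ext (F := F) (G := G.obj b)
      (φ := ((liftLaux φ h₁ b').flip h) ∘ₗ (Tens.map (𝟙 F) (G.map u)))
      (ψ := (liftLaux φ h₁ b).flip ((H.map u.op).hom h))
      (fun c s g => by simpa [liftLaux_mk] using h₂ u c s g h)) x)

lemma liftL_mkL (b : B) (c : C) (s : F.obj c) (g : (G.obj b).obj (op c)) (h : H.obj (op b)) :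
    liftL φ h₁ h₂ (mkL F G H b c s g h) = φ b c s g h :=
  (Tens.lift_mk (F := tensL F G) (liftLaux φ h₁) _ b (Tens.mk F (G.obj b) c s g) h).trans
    (liftLaux_mk φ h₁ b c s g h)

/-- Linear maps out of `F ⊗ (G ⊗ H)`. -/
def liftR : Tens F (tensR G H) →ₗ[K] M :=
  Tens.lift (G := tensR G H) (fun c => (liftRaux φ h₂ c).flip) (fun c c' u s x =>
    LinearMap.congr_fun (Tens.hom_ext (F := G.flip.obj (op c')) (G := H)
      (φ := (liftRaux φ h₂ c').flip ((F.map u).hom s))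
      (ψ := ((liftRaux φ h₂ c).flip s) ∘ₗ (Tens.map (G.flip.map u.op) (𝟙 H)))
      (fun b g h => by
        rw [LinearMap.flip_apply, liftRaux_mk, LinearMap.comp_apply, Tens.map_mk,
          LinearMap.flip_apply]
        exact (h₁ u b s g h).trans (liftRaux_mk φ h₂ b c s _ h).symm)) x)

lemma liftR_mkR (b : B) (c : C) (s : F.obj c) (g : (G.obj b).obj (op c)) (h : H.obj (op b)) :
    liftR φ h₁ h₂ (mkR F G H b c s g h) = φ b c s g h :=
  (Tens.lift_mk (G := tensR G H) (fun c => (liftRaux φ h₂ c).flip) _ c s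
      (Tens.mk (G.flip.obj (op c)) H b g h)).trans (liftRaux_mk φ h₂ b c s g h)

end lift

variable (F G H)

/-- The associativity isomorphism `(F ⊗ G) ⊗ H ≃ F ⊗ (G ⊗ H)`. -/
def tensAssoc : Tens (tensL F G) H ≃ₗ[K] Tens F (tensR G H) :=
  LinearEquiv.ofLinearMap
    (liftL (fun b c => mkR F G H b c) mkR_map_left mkR_map_right)
    (liftR (fun b c => mkL F G H b c) mkL_map_left mkL_map_right)
    (extR fun b c s g h => by
      rw [LinearMap.comp_apply, liftR_mkR, liftL_mkL, LinearMap.id_apply])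
    (extL fun b c s g h => by
      rw [LinearMap.comp_apply, liftL_mkL, liftR_mkR, LinearMap.id_apply])

lemma tensAssoc_mkL (b : B) (c : C) (s : F.obj c) (g : (G.obj b).obj (op c)) (h : H.obj (op b)) :
    tensAssoc F G H (mkL F G H b c s g h) = mkR F G H b c s g h :=
  liftL_mkL _ mkR_map_left mkR_map_right ..

lemma tensAssoc_symm_mkR (b : B) (c : C) (s : F.obj c) (g : (G.obj b).obj (op c))
    (h : H.obj (op b)) :
    (tensAssoc F G H).symm (mkR F G H b c s g h) = mkL F G H b c s g h :=
  liftR_mkR _ mkL_map_left mkL_map_right ..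

end Assoc


section Linear

/-- The opposite of a `K`-category is a `K`-category. -/
instance linearOpposite {A : Type u} [SmallCategory A] [Preadditive A] [Linear K A] :
    Linear K Aᵒᵖ where
  homModule X Y :=
    { smul := fun r f => (r • f.unop).op
      one_smul := fun f => Quiver.Hom.unop_inj (one_smul K f.unop)
      mul_smul := fun r s f => Quiver.Hom.unop_inj (mul_smul r s f.unop)
      smul_zero := fun r => Quiver.Hom.unop_inj (smul_zero r)
      smul_add := fun r f g => Quiver.Hom.unop_inj (smul_add r f.unop g.unop)
      add_smul := fun r s f => Quiver.Hom.unop_inj (add_smul r s f.unop)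
      zero_smul := fun f => Quiver.Hom.unop_inj (zero_smul K f.unop) }
  smul_comp X Y Z r f g := Quiver.Hom.unop_inj (Linear.comp_smul _ _ _ g.unop r f.unop)
  comp_smul X Y Z f r g := Quiver.Hom.unop_inj (Linear.smul_comp _ _ _ r g.unop f.unop)

/-- A `K`-functor with values in `Mod_K`: a functor that is `K`-linear on morphisms. -/
def IsKLinear {A : Type u} [SmallCategory A] [Preadditive A] [Linear K A]
    (F : A ⥤ ModuleCat.{u} K) : Prop :=
  F.Additive ∧ F.Linear K

section

variable {A : Type u} [SmallCategory A] [Preadditive A] [Linear K A]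

lemma IsKLinear.map_add {F : A ⥤ ModuleCat.{u} K} (hF : IsKLinear F) {a b : A} (f g : a ⟶ b)
    (x : F.obj a) : (F.map (f + g)).hom x = (F.map f).hom x + (F.map g).hom x := by
  have := hF.1
  rw [F.map_add]; rfl

lemma IsKLinear.map_smul {F : A ⥤ ModuleCat.{u} K} (hF : IsKLinear F) {a b : A} (r : K)
    (f : a ⟶ b) (x : F.obj a) : (F.map (r • f)).hom x = r • (F.map f).hom x := by
  have := hF.2
  rw [Functor.Linear.map_smul]; rfl

lemma IsKLinear.mk' {F : A ⥤ ModuleCat.{u} K}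
    (h₁ : ∀ {a b : A} (f g : a ⟶ b) (x : F.obj a),
      (F.map (f + g)).hom x = (F.map f).hom x + (F.map g).hom x)
    (h₂ : ∀ {a b : A} (r : K) (f : a ⟶ b) (x : F.obj a),
      (F.map (r • f)).hom x = r • (F.map f).hom x) : IsKLinear F :=
  ⟨⟨fun {a b f g} => by ext x; exact h₁ f g x⟩, ⟨fun f r => by ext x; exact h₂ r f x⟩⟩

variable (K A) in
/-- The category `[A, Mod_K]` of `K`-functors. -/
abbrev KFun : Type (u + 1) :=
  ObjectProperty.FullSubcategory (fun F : A ⥤ ModuleCat.{u} K => IsKLinear F)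

lemma isKLinear_yoneda (a : A) : IsKLinear ((linearYoneda K A).obj a) :=
  IsKLinear.mk' (fun f g x => Preadditive.add_comp _ _ _ f.unop g.unop x)
    (fun r f x => Linear.smul_comp _ _ _ r f.unop x)

lemma isKLinear_coyoneda (a : Aᵒᵖ) : IsKLinear ((linearYoneda K A).flip.obj a) :=
  IsKLinear.mk' (fun f g x => Preadditive.comp_add _ _ _ x f g)
    (fun r f x => Linear.comp_smul _ _ _ x r f)

/-- The action `F b × A(b, a) → F a`. -/
def actR {F : A ⥤ ModuleCat.{u} K} (hF : IsKLinear F) (a b : A) :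
    F.obj b →ₗ[K] (b ⟶ a) →ₗ[K] F.obj a :=
  LinearMap.mk₂ K (fun (s : F.obj b) (u : b ⟶ a) => (F.map u).hom s)
    (fun s s' u => map_add _ s s') (fun r s u => map_smul _ r s)
    (fun s u v => hF.map_add u v s) (fun r s u => hF.map_smul r u s)

/-- The action `A(a, b) × G b → G a`. -/
def actL {G : Aᵒᵖ ⥤ ModuleCat.{u} K} (hG : IsKLinear G) (a b : A) :
    (a ⟶ b) →ₗ[K] G.obj (op b) →ₗ[K] G.obj (op a) :=
  LinearMap.mk₂ K (fun (u : a ⟶ b) (t : G.obj (op b)) => (G.map u.op).hom t)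
    (fun u v t => hG.map_add u.op v.op t) (fun r u t => hG.map_smul r u.op t)
    (fun u t t' => map_add _ t t') (fun r u t => map_smul _ r t)

/-- `F ⊗ A(-, a) → F a`. -/
def tensYonedaHom {F : A ⥤ ModuleCat.{u} K} (hF : IsKLinear F) (a : A) :
    Tens F ((linearYoneda K A).obj a) →ₗ[K] F.obj a :=
  Tens.lift (G := (linearYoneda K A).obj a) (actR hF a)
    (fun b b' v s u => congrArg (fun w => (ModuleCat.Hom.hom w) s) (F.map_comp v u).symm)

lemma tensYonedaHom_mk {F : A ⥤ ModuleCat.{u} K} (hF : IsKLinear F) (a b : A) (s : F.obj b)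
    (u : b ⟶ a) :
    tensYonedaHom hF a (Tens.mk F ((linearYoneda K A).obj a) b s u) = (F.map u).hom s :=
  Tens.lift_mk (G := (linearYoneda K A).obj a) (actR hF a) _ b s u

/-- `F a → F ⊗ A(-, a)`. -/
def tensYonedaInv (F : A ⥤ ModuleCat.{u} K) (a : A) :
    F.obj a →ₗ[K] Tens F ((linearYoneda K A).obj a) :=
  LinearMap.flip (Tens.mk F ((linearYoneda K A).obj a) a) (𝟙 a : a ⟶ a)

lemma tensYonedaInv_apply (F : A ⥤ ModuleCat.{u} K) (a : A) (s : F.obj a) :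
    tensYonedaInv F a s = Tens.mk F ((linearYoneda K A).obj a) a s (𝟙 a : a ⟶ a) := rfl

/-- `A(a, -) ⊗ G → G a`. -/
def coyonedaTensHom {G : Aᵒᵖ ⥤ ModuleCat.{u} K} (hG : IsKLinear G) (a : A) :
    Tens ((linearYoneda K A).flip.obj (op a)) G →ₗ[K] G.obj (op a) :=
  Tens.lift (F := (linearYoneda K A).flip.obj (op a)) (actL hG a)
    (fun b b' v (u : a ⟶ b) t => congrArg (fun w => (ModuleCat.Hom.hom w) t)
      (G.map_comp v.op u.op))

lemma coyonedaTensHom_mk {G : Aᵒᵖ ⥤ ModuleCat.{u} K} (hG : IsKLinear G) (a b : A) (u : a ⟶ b)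
    (t : G.obj (op b)) :
    coyonedaTensHom hG a (Tens.mk ((linearYoneda K A).flip.obj (op a)) G b u t) =
      (G.map u.op).hom t :=
  Tens.lift_mk (F := (linearYoneda K A).flip.obj (op a)) (actL hG a) _ b u t

/-- `G a → A(a, -) ⊗ G`. -/
def coyonedaTensInv (G : Aᵒᵖ ⥤ ModuleCat.{u} K) (a : A) :
    G.obj (op a) →ₗ[K] Tens ((linearYoneda K A).flip.obj (op a)) G :=
  Tens.mk ((linearYoneda K A).flip.obj (op a)) G a (𝟙 a : a ⟶ a)

/-- The isomorphism `F ⊗ A(-, a) ≃ F a`. -/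
def tensYoneda {F : A ⥤ ModuleCat.{u} K} (hF : IsKLinear F) (a : A) :
    Tens F ((linearYoneda K A).obj a) ≃ₗ[K] F.obj a :=
  LinearEquiv.ofLinearMap (tensYonedaHom hF a) (tensYonedaInv F a)
    (LinearMap.ext fun s => by
      rw [LinearMap.comp_apply, tensYonedaInv_apply, tensYonedaHom_mk, F.map_id]
      rfl)
    (Tens.hom_ext fun b s (u : b ⟶ a) => by
      rw [LinearMap.comp_apply, tensYonedaHom_mk, tensYonedaInv_apply]
      refine (Tens.mk_map (G := (linearYoneda K A).obj a) u s (𝟙 a : a ⟶ a)).trans ?_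
      exact congrArg (Tens.mk F ((linearYoneda K A).obj a) b s) (Category.comp_id u))

/-- The isomorphism `A(a, -) ⊗ G ≃ G a`. -/
def coyonedaTens {G : Aᵒᵖ ⥤ ModuleCat.{u} K} (hG : IsKLinear G) (a : A) :
    Tens ((linearYoneda K A).flip.obj (op a)) G ≃ₗ[K] G.obj (op a) :=
  LinearEquiv.ofLinearMap (coyonedaTensHom hG a) (coyonedaTensInv G a)
    (LinearMap.ext fun t => by
      rw [LinearMap.comp_apply, coyonedaTensInv, coyonedaTensHom_mk, op_id, G.map_id]
      rfl)
    (Tens.hom_ext fun b (u : a ⟶ b) t => by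
      rw [LinearMap.comp_apply, coyonedaTensHom_mk, coyonedaTensInv]
      refine (Tens.mk_map (F := (linearYoneda K A).flip.obj (op a)) u
        (𝟙 a : a ⟶ a) t).symm.trans ?_
      exact congrArg (fun w => Tens.mk ((linearYoneda K A).flip.obj (op a)) G b w t)
        (Category.id_comp u))

end

end Linear

section Bimodules

variable (K) in
/-- Small `K`-categories. -/
structure KCat where
  /-- the objects -/
  carrier : Type u
  [cat : SmallCategory carrier]
  [preadditive : Preadditive carrier]
  [linear : Linear K carrier]

instance : CoeSort (KCat K) (Type u) := ⟨KCat.carrier⟩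

attribute [instance] KCat.cat KCat.preadditive KCat.linear

/-- `A`-`B`-bimodules `φ`, i.e. `K`-functors `Bᵒᵖ ⊗ A ⥤ Mod_K`, written as functors
`a ↦ φ(-, a)` that are `K`-linear in each of the two variables; morphisms are natural
transformations. -/
abbrev Bimod (A B : KCat K) : Type (u + 1) :=
  ObjectProperty.FullSubcategory (fun F : A ⥤ Bᵒᵖ ⥤ ModuleCat.{u} K =>
    (∀ a, IsKLinear (F.obj a)) ∧ ∀ b, IsKLinear (F.flip.obj b))

namespace Bimod

variable {A B C D E : KCat K}

/-- The value `φ(b, a)`. -/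
abbrev val (φ : Bimod A B) (b : B) (a : A) : ModuleCat.{u} K := (φ.obj.obj a).obj (op b)

/-- The functor `φ(-, a)`. -/
abbrev col (φ : Bimod A B) (a : A) : Bᵒᵖ ⥤ ModuleCat.{u} K := φ.obj.obj a

/-- The functor `φ(b, -)`. -/
abbrev row (φ : Bimod A B) (b : B) : A ⥤ ModuleCat.{u} K := φ.obj.flip.obj (op b)

/-- The action `φ(b', a) → φ(b, a)` of `v : b ⟶ b'`. -/
def actCol (φ : Bimod A B) {b b' : B} (v : b ⟶ b') (a : A) : φ.val b' a →ₗ[K] φ.val b a :=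
  ((φ.obj.obj a).map v.op).hom

/-- The action `φ(b, a) → φ(b, a')` of `u : a ⟶ a'`. -/
def actRow (φ : Bimod A B) {a a' : A} (b : B) (u : a ⟶ a') : φ.val b a →ₗ[K] φ.val b a' :=
  ((φ.obj.map u).app (op b)).hom

/-- The components of a morphism of bimodules. -/
def ap {φ ψ : Bimod A B} (η : φ ⟶ ψ) (b : B) (a : A) : φ.val b a →ₗ[K] ψ.val b a :=
  ((η.hom.app a).app (op b)).hom

lemma hom_ext' {φ ψ : Bimod A B} {η θ : φ ⟶ ψ} (h : ∀ b a, ap η b a = ap θ b a) : η = θ := by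
  apply ObjectProperty.hom_ext
  ext a b : 4
  exact ModuleCat.hom_ext (h b.unop a)

@[simp] lemma ap_id (φ : Bimod A B) (b : B) (a : A) : ap (𝟙 φ) b a = LinearMap.id := rfl

@[simp] lemma ap_comp {φ ψ χ : Bimod A B} (η : φ ⟶ ψ) (θ : ψ ⟶ χ) (b : B) (a : A) :
    ap (η ≫ θ) b a = ap θ b a ∘ₗ ap η b a := rfl

lemma ap_actCol {φ ψ : Bimod A B} (η : φ ⟶ ψ) {b b' : B} (v : b ⟶ b') (a : A) (x : φ.val b' a) :
    ap η b a (φ.actCol v a x) = ψ.actCol v a (ap η b' a x) :=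
  congr($((η.hom.app a).naturality v.op).hom x)

lemma ap_actRow {φ ψ : Bimod A B} (η : φ ⟶ ψ) {a a' : A} (b : B) (u : a ⟶ a') (x : φ.val b a) :
    ap η b a' (φ.actRow b u x) = ψ.actRow b u (ap η b a x) :=
  congr($(congr_app (η.hom.naturality u) (op b)).hom x)

/-- Constructor for isomorphisms of bimodules. -/
def isoMk {φ ψ : Bimod A B} (e : ∀ b a, φ.val b a ≃ₗ[K] ψ.val b a)
    (h₁ : ∀ {b b' : B} (v : b ⟶ b') (a : A),
      (e b a).toLinearMap ∘ₗ φ.actCol v a = ψ.actCol v a ∘ₗ (e b' a).toLinearMap)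
    (h₂ : ∀ {a a' : A} (b : B) (u : a ⟶ a'),
      (e b a').toLinearMap ∘ₗ φ.actRow b u = ψ.actRow b u ∘ₗ (e b a).toLinearMap) : φ ≅ ψ :=
  ObjectProperty.isoMk _ (NatIso.ofComponents (fun a => NatIso.ofComponents
    (fun b => (e b.unop a).toModuleIso) (fun v => by ext x; exact LinearMap.congr_fun (h₁ v.unop a) x))
    (fun u => by ext b x; exact LinearMap.congr_fun (h₂ b.unop u) x))

@[simp] lemma ap_isoMk_hom {φ ψ : Bimod A B} (e : ∀ b a, φ.val b a ≃ₗ[K] ψ.val b a) (h₁ h₂)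
    (b : B) (a : A) : ap (isoMk e h₁ h₂).hom b a = (e b a).toLinearMap := rfl

@[simp] lemma ap_isoMk_inv {φ ψ : Bimod A B} (e : ∀ b a, φ.val b a ≃ₗ[K] ψ.val b a) (h₁ h₂)
    (b : B) (a : A) : ap (isoMk e h₁ h₂).inv b a = (e b a).symm.toLinearMap := rfl

/-- The unit bimodule `1_A (b, a) = A(b, a)`. -/
def one (A : KCat K) : Bimod A A :=
  ⟨linearYoneda K A, isKLinear_yoneda, isKLinear_coyoneda⟩

lemma isKLinear_tensL {F : B ⥤ ModuleCat.{u} K} {G : A ⥤ Bᵒᵖ ⥤ ModuleCat.{u} K}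
    (hG : ∀ b, IsKLinear (G.flip.obj b)) : IsKLinear (tensL F G) := by
  refine IsKLinear.mk' (fun {a b} f g x => ?_) (fun {a b} r f x => ?_)
  · exact LinearMap.congr_fun (Tens.hom_ext (φ := Tens.map (𝟙 F) (G.map (f + g)))
      (ψ := Tens.map (𝟙 F) (G.map f) + Tens.map (𝟙 F) (G.map g)) fun c s t => by
        rw [LinearMap.add_apply, Tens.map_mk, Tens.map_mk, Tens.map_mk, ← map_add]
        exact congrArg _ ((hG (op c)).map_add f g t)) x
  · exact LinearMap.congr_fun (Tens.hom_ext (φ := Tens.map (𝟙 F) (G.map (r • f)))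
      (ψ := r • Tens.map (𝟙 F) (G.map f)) fun c s t => by
        rw [LinearMap.smul_apply, Tens.map_mk, Tens.map_mk, ← map_smul]
        exact congrArg _ ((hG (op c)).map_smul r f t)) x

lemma isKLinear_tensR {H : Bᵒᵖ ⥤ ModuleCat.{u} K} {G : B ⥤ Cᵒᵖ ⥤ ModuleCat.{u} K}
    (hG : ∀ b, IsKLinear (G.obj b)) : IsKLinear (tensR G H) := by
  refine IsKLinear.mk' (fun {a b} f g x => ?_) (fun {a b} r f x => ?_)
  · exact LinearMap.congr_fun (Tens.hom_ext (φ := Tens.map (G.flip.map (f + g)) (𝟙 H))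
      (ψ := Tens.map (G.flip.map f) (𝟙 H) + Tens.map (G.flip.map g) (𝟙 H)) fun c s t => by
        rw [LinearMap.add_apply, Tens.map_mk, Tens.map_mk, Tens.map_mk, ← LinearMap.add_apply,
          ← map_add]
        exact congrArg (fun z => Tens.mk (G.flip.obj b) H c z t) ((hG c).map_add f g s)) x
  · exact LinearMap.congr_fun (Tens.hom_ext (φ := Tens.map (G.flip.map (r • f)) (𝟙 H))
      (ψ := r • Tens.map (G.flip.map f) (𝟙 H)) fun c s t => by
        rw [LinearMap.smul_apply, Tens.map_mk, Tens.map_mk, ← LinearMap.smul_apply, ← map_smul]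
        exact congrArg (fun z => Tens.mk (G.flip.obj b) H c z t) ((hG c).map_smul r f s)) x

/-- The tensor product `ψ ⊗ φ`, `(ψ ⊗ φ)(c, a) = ψ(c, -) ⊗ φ(-, a)`. -/
def tens (ψ : Bimod B C) (φ : Bimod A B) : Bimod A C :=
  ⟨φ.obj ⋙ tensorFunctor.flip ⋙ (Functor.whiskeringLeft _ _ _).obj ψ.obj.flip,
    fun a => isKLinear_tensR (H := φ.col a) ψ.property.1,
    fun c => isKLinear_tensL (F := ψ.obj.flip.obj c) φ.property.2⟩

/-- The element `y ⊗ x` of `(ψ ⊗ φ)(c, a)`. -/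
def tmk (ψ : Bimod B C) (φ : Bimod A B) (c : C) (b : B) (a : A) :
    ψ.val c b →ₗ[K] φ.val b a →ₗ[K] (ψ.tens φ).val c a :=
  Tens.mk (ψ.row c) (φ.col a) b

lemma tens_ext {ψ : Bimod B C} {φ : Bimod A B} {c : C} {a : A} {M : Type*} [AddCommGroup M]
    [Module K M] {f g : (ψ.tens φ).val c a →ₗ[K] M}
    (h : ∀ b y x, f (tmk ψ φ c b a y x) = g (tmk ψ φ c b a y x)) : f = g :=
  Tens.hom_ext h

lemma tmk_act (ψ : Bimod B C) (φ : Bimod A B) (c : C) {b b' : B} (v : b ⟶ b') (a : A)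
    (y : ψ.val c b) (x : φ.val b' a) :
    tmk ψ φ c b' a (ψ.actRow c v y) x = tmk ψ φ c b a y (φ.actCol v a x) :=
  Tens.mk_map (F := ψ.row c) (G := φ.col a) v y x

@[simp] lemma actCol_tmk (ψ : Bimod B C) (φ : Bimod A B) {c c' : C} (w : c ⟶ c') (b : B) (a : A)
    (y : ψ.val c' b) (x : φ.val b a) :
    (ψ.tens φ).actCol w a (tmk ψ φ c' b a y x) = tmk ψ φ c b a (ψ.actCol w b y) x :=
  Tens.map_mk (ψ.obj.flip.map w.op) (𝟙 (φ.col a)) b y x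

@[simp] lemma actRow_tmk (ψ : Bimod B C) (φ : Bimod A B) (c : C) (b : B) {a a' : A} (u : a ⟶ a')
    (y : ψ.val c b) (x : φ.val b a) :
    (ψ.tens φ).actRow c u (tmk ψ φ c b a y x) = tmk ψ φ c b a' y (φ.actRow b u x) :=
  Tens.map_mk (𝟙 (ψ.row c)) (φ.obj.map u) b y x

/-- `θ ⊗ φ` for a morphism `θ` of bimodules. -/
def whiskerL {ψ ψ' : Bimod B C} (θ : ψ ⟶ ψ') (φ : Bimod A B) : ψ.tens φ ⟶ ψ'.tens φ :=
  ObjectProperty.homMk (Functor.whiskerLeft (φ.obj ⋙ tensorFunctor.flip)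
    ((Functor.whiskeringLeft _ _ _).map ((flipFunctor _ _ _).map θ.hom)))

/-- `ψ ⊗ η` for a morphism `η` of bimodules. -/
def whiskerR (ψ : Bimod B C) {φ φ' : Bimod A B} (η : φ ⟶ φ') : ψ.tens φ ⟶ ψ.tens φ' :=
  ObjectProperty.homMk (Functor.whiskerRight η.hom
    (tensorFunctor.flip ⋙ (Functor.whiskeringLeft _ _ _).obj ψ.obj.flip))

@[simp] lemma ap_whiskerL {ψ ψ' : Bimod B C} (θ : ψ ⟶ ψ') (φ : Bimod A B) (c : C) (b : B) (a : A)
    (y : ψ.val c b) (x : φ.val b a) :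
    ap (whiskerL θ φ) c a (tmk ψ φ c b a y x) = tmk ψ' φ c b a (ap θ c b y) x :=
  Tens.map_mk ..

@[simp] lemma ap_whiskerR (ψ : Bimod B C) {φ φ' : Bimod A B} (η : φ ⟶ φ') (c : C) (b : B) (a : A)
    (y : ψ.val c b) (x : φ.val b a) :
    ap (whiskerR ψ η) c a (tmk ψ φ c b a y x) = tmk ψ φ' c b a y (ap η b a x) :=
  Tens.map_mk ..

lemma tens_ext_left {χ : Bimod C D} {ψ : Bimod B C} {φ : Bimod A B} {d : D} {a : A} {M : Type*}
    [AddCommGroup M] [Module K M] {f g : ((χ.tens ψ).tens φ).val d a →ₗ[K] M}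
    (h : ∀ c b z y x, f (tmk _ φ d b a (tmk χ ψ d c b z y) x) =
      g (tmk _ φ d b a (tmk χ ψ d c b z y) x)) : f = g :=
  tens_ext fun b w x => LinearMap.congr_fun (tens_ext
    (f := f ∘ₗ (tmk (χ.tens ψ) φ d b a).flip x) (g := g ∘ₗ (tmk (χ.tens ψ) φ d b a).flip x)
    fun c z y => h c b z y x) w

lemma tens_ext_right {χ : Bimod C D} {ψ : Bimod B C} {φ : Bimod A B} {d : D} {a : A} {M : Type*}
    [AddCommGroup M] [Module K M] {f g : (χ.tens (ψ.tens φ)).val d a →ₗ[K] M}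
    (h : ∀ c b z y x, f (tmk χ _ d c a z (tmk ψ φ c b a y x)) =
      g (tmk χ _ d c a z (tmk ψ φ c b a y x))) : f = g :=
  tens_ext fun c z w => LinearMap.congr_fun (tens_ext
    (f := f ∘ₗ (tmk χ (ψ.tens φ) d c a) z) (g := g ∘ₗ (tmk χ (ψ.tens φ) d c a) z)
    fun b y x => h c b z y x) w

/-- The components of the associator. -/
def assocEquiv (χ : Bimod C D) (ψ : Bimod B C) (φ : Bimod A B) (d : D) (a : A) :
    ((χ.tens ψ).tens φ).val d a ≃ₗ[K] (χ.tens (ψ.tens φ)).val d a :=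
  tensAssoc (χ.row d) ψ.obj (φ.col a)

@[simp] lemma assocEquiv_tmk (χ : Bimod C D) (ψ : Bimod B C) (φ : Bimod A B) (d : D) (c : C)
    (b : B) (a : A) (z : χ.val d c) (y : ψ.val c b) (x : φ.val b a) :
    assocEquiv χ ψ φ d a (tmk _ φ d b a (tmk χ ψ d c b z y) x) =
      tmk χ _ d c a z (tmk ψ φ c b a y x) :=
  tensAssoc_mkL ..

@[simp] lemma assocEquiv_symm_tmk (χ : Bimod C D) (ψ : Bimod B C) (φ : Bimod A B) (d : D) (c : C)
    (b : B) (a : A) (z : χ.val d c) (y : ψ.val c b) (x : φ.val b a) :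
    (assocEquiv χ ψ φ d a).symm (tmk χ _ d c a z (tmk ψ φ c b a y x)) =
      tmk _ φ d b a (tmk χ ψ d c b z y) x :=
  tensAssoc_symm_mkR ..

/-- The associator `(χ ⊗ ψ) ⊗ φ ≅ χ ⊗ (ψ ⊗ φ)`. -/
def assoc (χ : Bimod C D) (ψ : Bimod B C) (φ : Bimod A B) :
    (χ.tens ψ).tens φ ≅ χ.tens (ψ.tens φ) :=
  isoMk (assocEquiv χ ψ φ)
    (fun v a => tens_ext_left fun c b z y x => by simp)
    (fun b u => tens_ext_left fun c b z y x => by simp)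

/-- A morphism `a' ⟶ a`, as an element of `1_A (a', a)`. -/
def ofHom {a' a : A} (u : a' ⟶ a) : (one A).val a' a := u

lemma ofHom_surj {a' a : A} (s : (one A).val a' a) : ∃ u : a' ⟶ a, s = ofHom u := ⟨s, rfl⟩

@[simp] lemma actRow_ofHom {a a' a'' : A} (u : a ⟶ a') (w : a' ⟶ a'') :
    (one A).actRow a w (ofHom u) = ofHom (u ≫ w) := rfl

@[simp] lemma actCol_ofHom {a a' a'' : A} (w : a ⟶ a') (u : a' ⟶ a'') :
    (one A).actCol w a'' (ofHom u) = ofHom (w ≫ u) := rfl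

/-- The components of the isomorphism `φ ⊗ 1_A ≅ φ`. -/
def tensOneEquiv (φ : Bimod A B) (b : B) (a : A) : (φ.tens (one A)).val b a ≃ₗ[K] φ.val b a :=
  tensYoneda (φ.property.2 (op b)) a

/-- The components of the isomorphism `1_B ⊗ φ ≅ φ`. -/
def oneTensEquiv (φ : Bimod A B) (b : B) (a : A) : ((one B).tens φ).val b a ≃ₗ[K] φ.val b a :=
  coyonedaTens (φ.property.1 a) b

@[simp] lemma tensOneEquiv_tmk (φ : Bimod A B) (b : B) (a a' : A) (x : φ.val b a') (u : a' ⟶ a) :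
    tensOneEquiv φ b a (tmk φ (one A) b a' a x (ofHom u)) = φ.actRow b u x :=
  tensYonedaHom_mk (φ.property.2 (op b)) a a' x u

@[simp] lemma oneTensEquiv_tmk (φ : Bimod A B) (b b' : B) (a : A) (v : b ⟶ b') (x : φ.val b' a) :
    oneTensEquiv φ b a (tmk (one B) φ b b' a (ofHom v) x) = φ.actCol v a x :=
  coyonedaTensHom_mk (φ.property.1 a) b b' v x

lemma actRow_comp (φ : Bimod A B) (b : B) {a a' a'' : A} (u : a ⟶ a') (u' : a' ⟶ a'')
    (x : φ.val b a) : φ.actRow b (u ≫ u') x = φ.actRow b u' (φ.actRow b u x) :=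
  congr($(congr_app (φ.obj.map_comp u u') (op b)).hom x)

lemma actCol_comp (φ : Bimod A B) {b b' b'' : B} (v : b ⟶ b') (v' : b' ⟶ b'') (a : A)
    (x : φ.val b'' a) : φ.actCol (v ≫ v') a x = φ.actCol v a (φ.actCol v' a x) :=
  congr($((φ.obj.obj a).map_comp v'.op v.op).hom x)

lemma actCol_actRow (φ : Bimod A B) {b b' : B} (v : b ⟶ b') {a a' : A} (u : a ⟶ a')
    (x : φ.val b' a) : φ.actCol v a' (φ.actRow b' u x) = φ.actRow b u (φ.actCol v a x) :=
  congr($((φ.obj.map u).naturality v.op).hom x).symm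

/-- The isomorphism `φ ⊗ 1_A ≅ φ`. -/
def tensOne (φ : Bimod A B) : φ.tens (one A) ≅ φ :=
  isoMk (tensOneEquiv φ)
    (fun v a => tens_ext fun a' x s => by
      obtain ⟨u, hs⟩ := ofHom_surj s
      rw [hs]
      simp [actCol_actRow])
    (fun b w => tens_ext fun a' x s => by
      obtain ⟨u, hs⟩ := ofHom_surj s
      rw [hs]
      simp [actRow_comp])

/-- The isomorphism `1_B ⊗ φ ≅ φ`. -/
def oneTens (φ : Bimod A B) : (one B).tens φ ≅ φ :=
  isoMk (oneTensEquiv φ)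
    (fun w a => tens_ext fun b' s x => by
      obtain ⟨v, hs⟩ := ofHom_surj s
      rw [hs]
      simp [actCol_comp])
    (fun b u => tens_ext fun b' s x => by
      obtain ⟨v, hs⟩ := ofHom_surj s
      rw [hs]
      simp [actCol_actRow])

lemma tens_ext_four {ω : Bimod D E} {χ : Bimod C D} {ψ : Bimod B C} {φ : Bimod A B} {e : E} {a : A}
    {M : Type*} [AddCommGroup M] [Module K M] {f g : (ω.tens (χ.tens (ψ.tens φ))).val e a →ₗ[K] M}
    (h : ∀ d c b w z y x, f (tmk ω _ e d a w (tmk χ _ d c a z (tmk ψ φ c b a y x))) =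
      g (tmk ω _ e d a w (tmk χ _ d c a z (tmk ψ φ c b a y x)))) : f = g :=
  tens_ext fun d w v => LinearMap.congr_fun (tens_ext_right
    (f := f ∘ₗ (tmk ω (χ.tens (ψ.tens φ)) e d a) w) (g := g ∘ₗ (tmk ω (χ.tens (ψ.tens φ)) e d a) w)
    fun c b z y x => h d c b w z y x) v

section Axioms

variable {φ φ' φ'' : Bimod A B} {ψ ψ' ψ'' : Bimod B C} {χ χ' : Bimod C D} {ω : Bimod D E}

lemma whiskerR_id : whiskerR ψ (𝟙 φ) = 𝟙 _ :=
  hom_ext' fun c a => tens_ext fun b y x => by simp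

lemma whiskerL_id : whiskerL (𝟙 ψ) φ = 𝟙 _ :=
  hom_ext' fun c a => tens_ext fun b y x => by simp

lemma whiskerR_comp (η : φ ⟶ φ') (η' : φ' ⟶ φ'') :
    whiskerR ψ (η ≫ η') = whiskerR ψ η ≫ whiskerR ψ η' :=
  hom_ext' fun c a => tens_ext fun b y x => by simp

lemma whiskerL_comp (θ : ψ ⟶ ψ') (θ' : ψ' ⟶ ψ'') :
    whiskerL (θ ≫ θ') φ = whiskerL θ φ ≫ whiskerL θ' φ :=
  hom_ext' fun c a => tens_ext fun b y x => by simp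

lemma whiskerL_tensOne (θ : φ ⟶ φ') :
    whiskerL θ (one A) = φ.tensOne.hom ≫ θ ≫ φ'.tensOne.inv := by
  rw [← Category.assoc, Iso.eq_comp_inv]
  refine hom_ext' fun c a => tens_ext fun b y s => ?_
  obtain ⟨u, hs⟩ := ofHom_surj s
  rw [hs]
  simp [tensOne, ap_actRow]

lemma whiskerR_oneTens (θ : φ ⟶ φ') :
    whiskerR (one B) θ = φ.oneTens.hom ≫ θ ≫ φ'.oneTens.inv := by
  rw [← Category.assoc, Iso.eq_comp_inv]
  refine hom_ext' fun c a => tens_ext fun b s y => ?_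
  obtain ⟨u, hs⟩ := ofHom_surj s
  rw [hs]
  simp [oneTens, ap_actCol]

lemma whiskerL_tens (θ : χ ⟶ χ') :
    whiskerL θ (ψ.tens φ) = (assoc χ ψ φ).inv ≫ whiskerL (whiskerL θ ψ) φ ≫ (assoc χ' ψ φ).hom :=
  hom_ext' fun d a => tens_ext_right fun c b z y x => by simp [assoc]

lemma whiskerR_tens (η : φ ⟶ φ') :
    whiskerR (χ.tens ψ) η = (assoc χ ψ φ).hom ≫ whiskerR χ (whiskerR ψ η) ≫ (assoc χ ψ φ').inv :=
  hom_ext' fun d a => tens_ext_left fun c b z y x => by simp [assoc]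

lemma whiskerR_whiskerL (θ : ψ ⟶ ψ') :
    whiskerR χ (whiskerL θ φ) = (assoc χ ψ φ).inv ≫ whiskerL (whiskerR χ θ) φ ≫
      (assoc χ ψ' φ).hom :=
  hom_ext' fun d a => tens_ext_right fun c b z y x => by simp [assoc]

lemma whisker_exchange (η : φ ⟶ φ') (θ : ψ ⟶ ψ') :
    whiskerL θ φ ≫ whiskerR ψ' η = whiskerR ψ η ≫ whiskerL θ φ' :=
  hom_ext' fun c a => tens_ext fun b y x => by simp

lemma pentagon :
    whiskerR ω (assoc χ ψ φ).inv ≫ (assoc ω (χ.tens ψ) φ).inv ≫ whiskerL (assoc ω χ ψ).inv φ =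
      (assoc ω χ (ψ.tens φ)).inv ≫ (assoc (ω.tens χ) ψ φ).inv :=
  hom_ext' fun e a => tens_ext_four fun d c b w z y x => by simp [assoc]

lemma triangle : (assoc ψ (one B) φ).inv ≫ whiskerL ψ.tensOne.hom φ = whiskerR ψ φ.oneTens.hom :=
  hom_ext' fun c a => tens_ext_right fun b b' y s x => by
    obtain ⟨u, hs⟩ := ofHom_surj s
    rw [hs]
    simp [assoc, tensOne, oneTens, tmk_act]

end Axioms

end Bimod

/-- The bicategory `Bim` of small `K`-categories and bimodules. The composite `φ ≫ ψ` of
`φ : A ⟶ B` and `ψ : B ⟶ C` is `ψ ⊗ φ`. -/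
instance : Bicategory (KCat K) where
  Hom A B := Bimod A B
  id A := Bimod.one A
  comp φ ψ := ψ.tens φ
  homCategory A B := inferInstanceAs (Category (Bimod A B))
  whiskerLeft φ _ _ θ := Bimod.whiskerL θ φ
  whiskerRight η ψ := Bimod.whiskerR ψ η
  associator φ ψ χ := (Bimod.assoc χ ψ φ).symm
  leftUnitor φ := φ.tensOne
  rightUnitor φ := φ.oneTens
  whiskerLeft_id _ _ := Bimod.whiskerL_id
  whiskerLeft_comp _ _ _ _ θ θ' := Bimod.whiskerL_comp θ θ'
  id_whiskerLeft θ := Bimod.whiskerL_tensOne θ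
  comp_whiskerLeft _ _ _ _ θ := Bimod.whiskerL_tens θ
  id_whiskerRight _ _ := Bimod.whiskerR_id
  comp_whiskerRight η η' _ := Bimod.whiskerR_comp η η'
  whiskerRight_id η := Bimod.whiskerR_oneTens η
  whiskerRight_comp η _ _ := Bimod.whiskerR_tens η
  whisker_assoc _ _ _ θ _ := Bimod.whiskerR_whiskerL θ
  whisker_exchange η θ := Bimod.whisker_exchange η θ
  pentagon _ _ _ _ := Bimod.pentagon
  triangle _ _ := Bimod.triangle

end Bimodules
section Adjunctions

open Bicategory

universe w v₁ v₂
variable {𝔹 : Type v₂} [Bicategory.{w, v₁} 𝔹] {a b : 𝔹} {f : a ⟶ b} {g : b ⟶ a}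

/-- The multiplication of `S_f`. -/
def adjMul (adj : f ⊣ g) : (f ≫ g) ≫ (f ≫ g) ⟶ f ≫ g :=
  (α_ f g (f ≫ g)).hom ≫ f ◁ (α_ g f g).inv ≫ f ◁ adj.counit ▷ g ≫ f ◁ (λ_ g).hom

/-- The comultiplication of `𝔠_f`. -/
def adjComul (adj : f ⊣ g) : g ≫ f ⟶ (g ≫ f) ≫ (g ≫ f) :=
  g ◁ (λ_ f).inv ≫ g ◁ adj.unit ▷ f ≫ g ◁ (α_ f g f).hom ≫ (α_ g f (g ≫ f)).inv

lemma adj_one_mul (adj : f ⊣ g) : adj.unit ▷ (f ≫ g) ≫ adjMul adj = (λ_ (f ≫ g)).hom := by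
  calc
    _ = 𝟙 _ ⊗≫ leftZigzag adj.unit adj.counit ▷ g ⊗≫ 𝟙 _ := by
      dsimp only [adjMul]; bicategory
    _ = _ := by rw [adj.left_triangle]; bicategory

lemma adj_mul_one (adj : f ⊣ g) : (f ≫ g) ◁ adj.unit ≫ adjMul adj = (ρ_ (f ≫ g)).hom := by
  calc
    _ = 𝟙 _ ⊗≫ f ◁ rightZigzag adj.unit adj.counit ⊗≫ 𝟙 _ := by
      dsimp only [adjMul]; bicategory
    _ = _ := by rw [adj.right_triangle]; bicategory

lemma adj_mul_assoc (adj : f ⊣ g) : adjMul adj ▷ (f ≫ g) ≫ adjMul adj =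
    (α_ (f ≫ g) (f ≫ g) (f ≫ g)).hom ≫ (f ≫ g) ◁ adjMul adj ≫ adjMul adj := by
  calc
    _ = 𝟙 _ ⊗≫ f ◁ (adj.counit ▷ (g ≫ f) ≫ 𝟙 b ◁ adj.counit) ▷ g ⊗≫ 𝟙 _ := by
      dsimp only [adjMul]; bicategory
    _ = _ := by rw [← whisker_exchange]; dsimp only [adjMul]; bicategory

lemma adj_counit_comul (adj : f ⊣ g) :
    adjComul adj ≫ adj.counit ▷ (g ≫ f) = (λ_ (g ≫ f)).inv := by
  calc
    _ = 𝟙 _ ⊗≫ rightZigzag adj.unit adj.counit ▷ f ⊗≫ 𝟙 _ := by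
      dsimp only [adjComul]; bicategory
    _ = _ := by rw [adj.right_triangle]; bicategory

lemma adj_comul_counit (adj : f ⊣ g) :
    adjComul adj ≫ (g ≫ f) ◁ adj.counit = (ρ_ (g ≫ f)).inv := by
  calc
    _ = 𝟙 _ ⊗≫ g ◁ leftZigzag adj.unit adj.counit ⊗≫ 𝟙 _ := by
      dsimp only [adjComul]; bicategory
    _ = _ := by rw [adj.left_triangle]; bicategory

lemma adj_comul_assoc (adj : f ⊣ g) : adjComul adj ≫ (g ≫ f) ◁ adjComul adj =
    adjComul adj ≫ adjComul adj ▷ (g ≫ f) ≫ (α_ (g ≫ f) (g ≫ f) (g ≫ f)).hom := by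
  calc
    _ = 𝟙 _ ⊗≫ g ◁ (𝟙 a ◁ adj.unit ≫ adj.unit ▷ (f ≫ g)) ▷ f ⊗≫ 𝟙 _ := by
      rw [whisker_exchange]; dsimp only [adjComul]; bicategory
    _ = _ := by dsimp only [adjComul]; bicategory

/-- The monoid `S_f` of an adjunction `f ⊣ g`. -/
def adjRing (adj : f ⊣ g) : Mon (a ⟶ a) where
  X := f ≫ g
  mon :=
    { one := adj.unit
      mul := adjMul adj
      one_mul := adj_one_mul adj
      mul_one := adj_mul_one adj
      mul_assoc := adj_mul_assoc adj }

/-- The comonoid `𝔠_f` of an adjunction `f ⊣ g`. -/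
def adjCoring (adj : f ⊣ g) : Comon (b ⟶ b) where
  X := g ≫ f
  comon :=
    { counit := adj.counit
      comul := adjComul adj
      counit_comul := adj_counit_comul adj
      comul_counit := adj_comul_counit adj
      comul_assoc := adj_comul_assoc adj }

/-- `ξ_i : f ⊗ h → f`, obtained from `i : h → f* ⊗ f` and the counit. -/
def xiL (adj : f ⊣ g) {h : a ⟶ a} (i : h ⟶ f ≫ g) : h ≫ f ⟶ f :=
  i ▷ f ≫ (α_ f g f).hom ≫ f ◁ adj.counit ≫ (ρ_ f).hom

/-- `ξ_i : h ⊗ f* → f*`, obtained from `i : h → f* ⊗ f` and the counit. -/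
def xiR (adj : f ⊣ g) {h : a ⟶ a} (i : h ⟶ f ≫ g) : g ≫ h ⟶ g :=
  g ◁ i ≫ (α_ g f g).inv ≫ adj.counit ▷ g ≫ (λ_ g).hom

/-- The composite `f f* → f h f* → f f* f f* → f f*` of `ξ_i⁻¹ f*`, `f i f*` and `f f* ε`. -/
def gammaL (adj : f ⊣ g) {h : a ⟶ a} (i : h ⟶ f ≫ g) [IsIso (xiL adj i)] : g ≫ f ⟶ g ≫ f :=
  g ◁ inv (xiL adj i) ≫ g ◁ i ▷ f ≫ g ◁ (α_ f g f).hom ≫ (α_ g f (g ≫ f)).inv ≫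
    adj.counit ▷ (g ≫ f) ≫ (λ_ (g ≫ f)).hom

/-- The composite `f f* → f h f* → f f* f f* → f f*` of `f ξ_i⁻¹`, `f i f*` and `ε f f*`. -/
def gammaR (adj : f ⊣ g) {h : a ⟶ a} (i : h ⟶ f ≫ g) [IsIso (xiR adj i)] : g ≫ f ⟶ g ≫ f :=
  inv (xiR adj i) ▷ f ≫ (g ◁ i) ▷ f ≫ (α_ g f g).inv ▷ f ≫ (α_ (g ≫ f) g f).hom ≫
    (g ≫ f) ◁ adj.counit ≫ (ρ_ (g ≫ f)).hom

/-- `f` is right flat if all functors `f ⊗ -` preserve equalizers. -/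
def RightFlat (f : a ⟶ b) : Prop :=
  ∀ c : 𝔹, Limits.PreservesLimitsOfShape Limits.WalkingParallelPair (postcomp c f)

/-- `f` is left flat if all functors `- ⊗ f` preserve equalizers. -/
def LeftFlat (f : a ⟶ b) : Prop :=
  ∀ c : 𝔹, Limits.PreservesLimitsOfShape Limits.WalkingParallelPair (precomp c f)

/-- `τ` is right pure if all `τ ⊗ h` are regular monomorphisms. -/
def RightPure {f f' : a ⟶ b} (τ : f ⟶ f') : Prop :=
  ∀ (c : 𝔹) (h : c ⟶ a), IsRegularMono (h ◁ τ)

/-- `τ` is left pure if all `h ⊗ τ` are regular monomorphisms. -/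
def LeftPure {f f' : a ⟶ b} (τ : f ⟶ f') : Prop :=
  ∀ (c : 𝔹) (h : b ⟶ c), IsRegularMono (τ ▷ h)

end Adjunctions

section Functors

variable {A B : KCat K}

/-- `f ⊗ - : [Aᵒᵖ, Mod_K] ⥤ [Bᵒᵖ, Mod_K]`. -/
def tensorLeft (f : Bimod A B) : KFun K (A : Type u)ᵒᵖ ⥤ KFun K (B : Type u)ᵒᵖ :=
  ObjectProperty.lift (fun F => IsKLinear F)
    ((ObjectProperty.ι (fun F => IsKLinear F)) ⋙ tensorFunctor.flip ⋙
      (Functor.whiskeringLeft _ _ _).obj f.obj.flip)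
    (fun G => Bimod.isKLinear_tensR (C := B) (H := G.obj) (G := f.obj) f.property.1)

/-- `- ⊗ g : [A, Mod_K] ⥤ [B, Mod_K]` for `g : B ⇝ A`. -/
def tensorRight (g : Bimod B A) : KFun K (A : Type u) ⥤ KFun K (B : Type u) :=
  ObjectProperty.lift (fun F => IsKLinear F)
    ((ObjectProperty.ι (fun F => IsKLinear F)) ⋙ tensorFunctor ⋙
      (Functor.whiskeringLeft _ _ _).obj g.obj)
    (fun F => Bimod.isKLinear_tensL (A := B) (B := A) (F := F.obj) (G := g.obj) g.property.2)

end Functors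

section Subbimodules

variable {A B : KCat K}

namespace Bimod

/-- Subbimodules. -/
@[ext]
structure Sub (φ : Bimod A B) where
  /-- the elements -/
  carrier (b : B) (a : A) : Submodule K (φ.val b a)
  actCol_mem {b b' : B} (v : b ⟶ b') (a : A) {x : φ.val b' a} (hx : x ∈ carrier b' a) :
    φ.actCol v a x ∈ carrier b a
  actRow_mem {a a' : A} (b : B) (u : a ⟶ a') {x : φ.val b a} (hx : x ∈ carrier b a) :
    φ.actRow b u x ∈ carrier b a'

lemma actRow_id (φ : Bimod A B) (b : B) (a : A) (x : φ.val b a) : φ.actRow b (𝟙 a) x = x :=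
  congr($(congr_app (φ.obj.map_id a) (op b)).hom x)

lemma actCol_id (φ : Bimod A B) (b : B) (a : A) (x : φ.val b a) : φ.actCol (𝟙 b) a x = x :=
  congr($((φ.obj.obj a).map_id (op b)).hom x)

namespace Sub

variable {φ : Bimod A B}

/-- The action on a subbimodule. -/
def col (I : φ.Sub) (a : A) : (B : Type u)ᵒᵖ ⥤ ModuleCat.{u} K where
  obj b := ModuleCat.of K (I.carrier b.unop a)
  map {b b'} v := ModuleCat.ofHom
    ((φ.actCol v.unop a).restrict fun x hx => I.actCol_mem v.unop a hx)
  map_id b := ModuleCat.hom_ext (LinearMap.ext fun x => Subtype.ext (φ.actCol_id b.unop a x.1))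
  map_comp v w := ModuleCat.hom_ext (LinearMap.ext fun x =>
    Subtype.ext (φ.actCol_comp w.unop v.unop a x.1))

/-- A subbimodule, as a bimodule. -/
def toBimod (I : φ.Sub) : Bimod A B :=
  ⟨{  obj := I.col
      map := fun {a a'} u =>
        { app := fun b => ModuleCat.ofHom
            ((φ.actRow b.unop u).restrict fun x hx => I.actRow_mem b.unop u hx)
          naturality := fun b b' v => ModuleCat.hom_ext (LinearMap.ext fun x =>
            Subtype.ext (φ.actCol_actRow v.unop u x.1).symm) }
      map_id := fun a => NatTrans.ext (funext fun b => ModuleCat.hom_ext (LinearMap.ext fun x =>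
        Subtype.ext (φ.actRow_id b.unop a x.1)))
      map_comp := fun u u' => NatTrans.ext (funext fun b => ModuleCat.hom_ext
        (LinearMap.ext fun x => Subtype.ext (φ.actRow_comp b.unop u u' x.1))) },
    fun a => IsKLinear.mk' (fun v w x => Subtype.ext ((φ.property.1 a).map_add v w x.1))
      (fun r v x => Subtype.ext ((φ.property.1 a).map_smul r v x.1)),
    fun b => IsKLinear.mk' (fun v w x => Subtype.ext ((φ.property.2 b).map_add v w x.1))
      (fun r v x => Subtype.ext ((φ.property.2 b).map_smul r v x.1))⟩

/-- The inclusion of a subbimodule. -/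
def incl (I : φ.Sub) : I.toBimod ⟶ φ :=
  ObjectProperty.homMk
    { app := fun a => { app := fun b => ModuleCat.ofHom (I.carrier b.unop a).subtype } }

end Sub

end Bimod

namespace ARing

variable {A : KCat K} (S : Mon (A ⟶ A))

/-- The underlying bimodule of an `A`-ring. -/
abbrev bimod : Bimod A A := S.X

/-- The multiplication `S ⊗ S → S` of an `A`-ring. -/
def mulHom : (bimod S).tens (bimod S) ⟶ bimod S := MonObj.mul (X := S.X)

/-- The unit `1_A → S` of an `A`-ring. -/
def unitHom : Bimod.one A ⟶ bimod S := MonObj.one (X := S.X)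

/-- The multiplication `S(c, b) × S(b, a) → S(c, a)`, `(s, t) ↦ st`, of an `A`-ring. -/
def mul (c b a : A) : (bimod S).val c b →ₗ[K] (bimod S).val b a →ₗ[K] (bimod S).val c a :=
  ((bimod S).tmk (bimod S) c b a).compr₂
    (Bimod.ap (mulHom S) c a)

/-- The unit `A(b, a) → S(b, a)` of an `A`-ring. -/
def unit (b a : A) : (b ⟶ a) →ₗ[K] (bimod S).val b a :=
  Bimod.ap (unitHom S) b a

variable {S}

lemma mulHom_assoc : Bimod.whiskerR (bimod S) (mulHom S) ≫ mulHom S =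
    (Bimod.assoc _ _ _).inv ≫ Bimod.whiskerL (mulHom S) (bimod S) ≫ mulHom S :=
  MonObj.mul_assoc S.X

lemma unitHom_mul : Bimod.whiskerR (bimod S) (unitHom S) ≫ mulHom S = (Bimod.tensOne _).hom :=
  MonObj.one_mul S.X

lemma mulHom_unit : Bimod.whiskerL (unitHom S) (bimod S) ≫ mulHom S = (Bimod.oneTens _).hom :=
  MonObj.mul_one S.X

lemma mul_assoc {d c b a : A} (s : (bimod S).val d c) (t : (bimod S).val c b)
    (r : (bimod S).val b a) :
    mul S d b a (mul S d c b s t) r = mul S d c a s (mul S c b a t r) := by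
  have h := congrArg (fun η => Bimod.ap η d a (Bimod.tmk _ _ d c a s (Bimod.tmk _ _ c b a t r)))
    (mulHom_assoc (S := S))
  simp [Bimod.assoc] at h
  exact h.symm

lemma unit_mul {c b a : A} (v : c ⟶ b) (t : (bimod S).val b a) :
    mul S c b a (unit S c b v) t = (bimod S).actCol v a t := by
  have h := congrArg (fun η => Bimod.ap η c a (Bimod.tmk _ _ c b a (Bimod.ofHom v) t))
    (mulHom_unit (S := S))
  simp [Bimod.oneTens] at h
  exact h

lemma mul_unit {c b a : A} (s : (bimod S).val c b) (u : b ⟶ a) :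
    mul S c b a s (unit S b a u) = (bimod S).actRow c u s := by
  have h := congrArg (fun η => Bimod.ap η c a (Bimod.tmk _ _ c b a s (Bimod.ofHom u)))
    (unitHom_mul (S := S))
  simp [Bimod.tensOne] at h
  exact h

lemma actCol_mul {c c' b a : A} (v : c ⟶ c') (s : (bimod S).val c' b) (t : (bimod S).val b a) :
    (bimod S).actCol v a (mul S c' b a s t) = mul S c b a ((bimod S).actCol v b s) t := by
  simp [mul, ← Bimod.ap_actCol]

lemma actRow_mul {c b a a' : A} (u : a ⟶ a') (s : (bimod S).val c b) (t : (bimod S).val b a) :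
    (bimod S).actRow c u (mul S c b a s t) = mul S c b a' s ((bimod S).actRow b u t) := by
  simp [mul, ← Bimod.ap_actRow]

lemma actCol_unit {c b a : A} (v : c ⟶ b) (u : b ⟶ a) :
    (bimod S).actCol v a (unit S b a u) = unit S c a (v ≫ u) :=
  (Bimod.ap_actCol (unitHom S) v a (Bimod.ofHom u)).symm

lemma actRow_unit {c b a : A} (v : c ⟶ b) (u : b ⟶ a) :
    (bimod S).actRow c u (unit S c b v) = unit S c a (v ≫ u) :=
  (Bimod.ap_actRow (unitHom S) c u (Bimod.ofHom v)).symm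

/-- The product `I J` of subbimodules: `(I J)(c, a)` consists of the finite sums of products `s t`
with `s ∈ I(c, b)` and `t ∈ J(b, a)`. -/
instance : Mul (bimod S).Sub where
  mul I J :=
    { carrier := fun c a => Submodule.span K
        {x | ∃ (b : A) (s : (bimod S).val c b) (t : (bimod S).val b a),
          s ∈ I.carrier c b ∧ t ∈ J.carrier b a ∧ x = mul S c b a s t}
      actCol_mem := fun {c c'} v a x hx => by
        refine (Submodule.span_le (p := (Submodule.span K _).comap ((bimod S).actCol v a))).2 ?_ hx
        rintro _ ⟨b, s, t, hs, ht, rfl⟩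
        exact Submodule.subset_span ⟨b, _, t, I.actCol_mem v b hs, ht, actCol_mul v s t⟩
      actRow_mem := fun {a a'} c u x hx => by
        refine (Submodule.span_le (p := (Submodule.span K _).comap ((bimod S).actRow c u))).2 ?_ hx
        rintro _ ⟨b, s, t, hs, ht, rfl⟩
        exact Submodule.subset_span ⟨b, s, _, hs, J.actRow_mem b u ht, actRow_mul u s t⟩ }

/-- The image of the unit `1_A → S`. -/
instance : One (bimod S).Sub where
  one :=
    { carrier := fun b a => LinearMap.range (unit S b a)
      actCol_mem := by
        rintro c b v a _ ⟨u, rfl⟩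
        exact ⟨v ≫ u, (actCol_unit v u).symm⟩
      actRow_mem := by
        rintro b a c u _ ⟨v, rfl⟩
        exact ⟨v ≫ u, (actRow_unit v u).symm⟩ }

lemma mul_mem {I J : (bimod S).Sub} {c b a : A} {s : (bimod S).val c b} {t : (bimod S).val b a}
    (hs : s ∈ I.carrier c b) (ht : t ∈ J.carrier b a) :
    mul S c b a s t ∈ (I * J).carrier c a :=
  Submodule.subset_span ⟨b, s, t, hs, ht, rfl⟩

lemma mul_le {I J : (bimod S).Sub} {c a : A} {M : Submodule K ((bimod S).val c a)} :
    (I * J).carrier c a ≤ M ↔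
      ∀ b, ∀ s ∈ I.carrier c b, ∀ t ∈ J.carrier b a, mul S c b a s t ∈ M :=
  Submodule.span_le.trans ⟨fun h b s hs t ht => h ⟨b, s, t, hs, ht, rfl⟩,
    fun h => by rintro _ ⟨b, s, t, hs, ht, rfl⟩; exact h b s hs t ht⟩

/-- The monoid of `A`-subbimodules of an `A`-ring. -/
instance : Monoid (bimod S).Sub where
  mul_assoc I J L := by
    refine Bimod.Sub.ext (funext fun d => funext fun a => le_antisymm ?_ ?_)
    · refine mul_le.2 fun b x hx r hr => ?_
      refine (mul_le (M := (((I * (J * L)).carrier d a).comap ((mul S d b a).flip r)))).2 ?_ hx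
      intro c s hs t ht
      exact Submodule.mem_comap.2 ((mul_assoc s t r).symm ▸ mul_mem hs (mul_mem ht hr))
    · refine mul_le.2 fun c s hs x hx => ?_
      refine (mul_le (M := ((((I * J) * L).carrier d a).comap (mul S d c a s)))).2 ?_ hx
      intro b t ht r hr
      exact Submodule.mem_comap.2 ((mul_assoc s t r) ▸ mul_mem (mul_mem hs ht) hr)
  one_mul I := by
    refine Bimod.Sub.ext (funext fun c => funext fun a => le_antisymm ?_ fun x hx => ?_)
    · refine mul_le.2 ?_
      rintro b _ ⟨v, rfl⟩ t ht
      exact (unit_mul v t).symm ▸ I.actCol_mem v a ht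
    · have h := unit_mul (S := S) (𝟙 c) x
      rw [Bimod.actCol_id] at h
      exact h ▸ mul_mem ⟨𝟙 c, rfl⟩ hx
  mul_one I := by
    refine Bimod.Sub.ext (funext fun c => funext fun a => le_antisymm ?_ fun x hx => ?_)
    · refine mul_le.2 ?_
      rintro b s hs _ ⟨u, rfl⟩
      exact (mul_unit s u).symm ▸ I.actRow_mem c u hs
    · have h := mul_unit (S := S) x (𝟙 a)
      rw [Bimod.actRow_id] at h
      exact h ▸ mul_mem hx ⟨𝟙 a, rfl⟩

variable (S) in
/-- `I` is left genuine if `S ⊗ I → S`, `s ⊗ i ↦ s i`, is an isomorphism. -/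
def IsLeftGenuine (I : (bimod S).Sub) : Prop :=
  IsIso (Bimod.whiskerR (bimod S) I.incl ≫ mulHom S)

variable (S) in
/-- `I` is right genuine if `I ⊗ S → S`, `i ⊗ s ↦ i s`, is an isomorphism. -/
def IsRightGenuine (I : (bimod S).Sub) : Prop :=
  IsIso (Bimod.whiskerL I.incl (bimod S) ≫ mulHom S)

end ARing

end Subbimodules
section GammaMaps

variable {A B : KCat K} {f : A ⟶ B} {g : B ⟶ A}

/-- The left genuine subbimodules `I` of `S_f` form a submonoid, all `ξ_I : f ⊗ I → f` are
isomorphisms, and `Γ_f` is an isomorphism of monoids onto the endomorphisms of the coring `𝔠_f`. -/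
def GammaLeftIso (adj : Bicategory.Adjunction f g) : Prop :=
  ∃ M : Submonoid (ARing.bimod (adjRing adj)).Sub,
    (∀ I, I ∈ M ↔ ARing.IsLeftGenuine (adjRing adj) I) ∧
    ∃ e : M ≃* End (adjCoring adj),
      ∀ I : M, ∃ _ : IsIso (xiL adj I.1.incl), (e I).hom = gammaL adj I.1.incl

/-- The right genuine subbimodules `I` of `S_f` form a submonoid, all `ξ_I : I ⊗ f* → f*` are
isomorphisms, and `Γ_{f*}` is an isomorphism from the opposite monoid onto the endomorphisms of the
coring `𝔠_f`. -/
def GammaRightIso (adj : Bicategory.Adjunction f g) : Prop :=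
  ∃ M : Submonoid (ARing.bimod (adjRing adj)).Sub,
    (∀ I, I ∈ M ↔ ARing.IsRightGenuine (adjRing adj) I) ∧
    ∃ e : Mᵐᵒᵖ ≃* End (adjCoring adj),
      ∀ I : M, ∃ _ : IsIso (xiR adj I.1.incl), (e (MulOpposite.op I)).hom = gammaR adj I.1.incl

end GammaMaps

end KBim

end

/-! In composition order `f ≫ g` is S = f*⊗f and `g ≫ f` is C = f⊗f*, while `i ▷ f` is f⊗i and `g ◁
i` is i⊗f*.

(L) is a descent statement. Under the adjunction (-⊗f*) ⊣ (-⊗f), a 2-cell γ : C → C has a mate θ : f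
→ C⊗f, and γ is a comonoid morphism exactly when θ is a counital and coassociative coaction of C on
f (`homEquiv_symm_counit`, `comul_iff_coactL`). So End(C) is the set of C-coactions on f. As in
Beck's comonadicity theorem, the object that descends from (f, θ) is the equalizer I of f*⊗θ and
η⊗S, two maps from S to S⊗S, and this is a subbimodule of S. After f⊗- the pair is split by the
counit, with equalizer θ (`splitL`). Hence, if f⊗- preserves this equalizer, f⊗I ≅ f; the
isomorphism is ξ_I (`isIso_xiL_of_factors`), and Γ(I) = γ. This is surjectivity.

Conversely, the multiplication S⊗I → S is f*⊗ξ_I up to an associator, and a computation with mates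
shows that ξ_I is invertible as soon as f*⊗ξ_I is (`isIso_xiL`). This needs no hypothesis on f. Then
θ_I = (f⊗i)∘ξ_I⁻¹ is a coaction whose equalizer E contains I (`comp_coactL`). If p : I → E is the
inclusion, ξ_E∘(f⊗p) = ξ_I, so f⊗p is invertible once ξ_E is. If f⊗- detects surjectivity, I = E,
and Γ(I) determines I. This is injectivity. Compatibility with products comes from the associativity
of the action of S on f (`product_xiL`) together with right exactness of ⊗.

Everything thus rests on two properties, `PreservesEqL` and `ReflectsSurjL`. Comonadicity gives
both, column by column. Flatness gives the first and purity the second. If η splits, the pair on S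
is itself split, and split equalizers are absolute.

(R) is the same argument in the bicategory with 1-cells reversed, where f* becomes the left adjoint.
The product of subbimodules is reversed there but composition of endomorphisms is not, hence the
opposite monoid. -/

noncomputable section

namespace KBim

/-! ### Mates in a bicategory: ξ^l, Γ_f and coactions of C on f. -/

section AdjunctionLeft

open Bicategory

universe w v₁ v₂
variable {𝔹 : Type v₂} [Bicategory.{w, v₁} 𝔹] {a b : 𝔹} {f : a ⟶ b} {g : b ⟶ a}

lemma whiskerRight_comp_adjMul (adj : f ⊣ g) {h : a ⟶ a} (i : h ⟶ f ≫ g) :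
    i ▷ (f ≫ g) ≫ adjMul adj = (α_ h f g).inv ≫ xiL adj i ▷ g := by
  dsimp only [adjMul, xiL]; bicategory

/-- The 2-cells i and ξ_i are mates under (f⊗-) ⊣ (f*⊗-), so i is recovered from f*⊗ξ_i by
precomposing with η⊗h. -/
lemma unit_comp_xiL (adj : f ⊣ g) {h : a ⟶ a} (i : h ⟶ f ≫ g) :
    (ρ_ h).inv ≫ h ◁ adj.unit ≫ (α_ h f g).inv ≫ xiL adj i ▷ g = i := by
  calc
    _ = 𝟙 _ ⊗≫ (h ◁ adj.unit ≫ i ▷ (f ≫ g)) ⊗≫ f ◁ adj.counit ▷ g ⊗≫ 𝟙 _ := by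
      dsimp only [xiL]; bicategory
    _ = i ⊗≫ f ◁ rightZigzag adj.unit adj.counit ⊗≫ 𝟙 _ := by
      rw [whisker_exchange]; bicategory
    _ = i := by rw [adj.right_triangle]; bicategory

/-- The inverse of `xiL` obtained from an inverse of `xiL ▷ g`. -/
def xiLInv (adj : f ⊣ g) {h : a ⟶ a} (κ : f ≫ g ⟶ (h ≫ f) ≫ g) : f ⟶ h ≫ f :=
  (λ_ f).inv ≫ adj.unit ▷ f ≫ κ ▷ f ≫ (α_ (h ≫ f) g f).hom ≫ (h ≫ f) ◁ adj.counit ≫ (ρ_ _).hom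

/-- Naturality of ε brings f*⊗x next to κ, the two cancel, and a triangle identity remains. This
works for any x; only the other composite uses the form of ξ_i. -/
lemma xiLInv_comp (adj : f ⊣ g) {h : a ⟶ a} {κ : f ≫ g ⟶ (h ≫ f) ≫ g} {x : h ≫ f ⟶ f}
    (hκ : κ ≫ x ▷ g = 𝟙 _) : xiLInv adj κ ≫ x = 𝟙 _ := by
  calc
    _ = 𝟙 _ ⊗≫ adj.unit ▷ f ≫ κ ▷ f ⊗≫ ((h ≫ f) ◁ adj.counit ≫ x ▷ 𝟙 b) ⊗≫ 𝟙 _ := by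
      dsimp only [xiLInv]; bicategory
    _ = 𝟙 _ ⊗≫ adj.unit ▷ f ≫ (κ ≫ x ▷ g) ▷ f ⊗≫ f ◁ adj.counit ⊗≫ 𝟙 _ := by
      rw [whisker_exchange]; bicategory
    _ = 𝟙 _ ⊗≫ leftZigzag adj.unit adj.counit ⊗≫ 𝟙 _ := by rw [hκ]; bicategory
    _ = _ := by rw [adj.left_triangle]; bicategory

lemma comp_xiLInv (adj : f ⊣ g) {h : a ⟶ a} (i : h ⟶ f ≫ g) {κ : f ≫ g ⟶ (h ≫ f) ≫ g}
    (hκ : κ ≫ xiL adj i ▷ g = 𝟙 _) (hκ' : xiL adj i ▷ g ≫ κ = 𝟙 _) :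
    xiL adj i ≫ xiLInv adj κ = 𝟙 _ := by
  -- With κ' = `xiLInv adj κ`, this says that (f*⊗κ')∘i is the unit h → f*⊗f⊗h. Both sides become i
  -- after composition with f*⊗ξ_i, which κ makes injective.
  have key : i ⊗≫ adj.unit ▷ (f ≫ g) ≫ κ ▷ (f ≫ g) ⊗≫ (h ≫ f) ◁ adj.counit ▷ g ⊗≫ 𝟙 _ =
      (ρ_ h).inv ≫ h ◁ adj.unit ≫ (α_ h f g).inv := by
    have inj : Function.Injective fun z : h ⟶ (h ≫ f) ≫ g => z ≫ xiL adj i ▷ g := fun z z' e => by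
      simpa [hκ'] using congrArg (· ≫ κ) e
    apply inj
    have h2 := unit_comp_xiL adj i
    simp only [Category.assoc] at h2 ⊢
    rw [h2]
    calc
      _ = i ⊗≫ adj.unit ▷ (f ≫ g) ≫ κ ▷ (f ≫ g) ⊗≫
            ((h ≫ f) ◁ adj.counit ≫ xiL adj i ▷ 𝟙 b) ▷ g ⊗≫ 𝟙 _ := by bicategory
      _ = i ⊗≫ adj.unit ▷ (f ≫ g) ≫ (κ ≫ xiL adj i ▷ g) ▷ (f ≫ g) ⊗≫
            f ◁ adj.counit ▷ g ⊗≫ 𝟙 _ := by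
        rw [whisker_exchange]; bicategory
      _ = i ⊗≫ leftZigzag adj.unit adj.counit ▷ g ⊗≫ 𝟙 _ := by rw [hκ]; bicategory
      _ = _ := by rw [adj.left_triangle]; bicategory
  calc
    _ = i ▷ f ⊗≫ (f ◁ adj.counit ≫ xiLInv (h := h) adj κ ▷ 𝟙 b) ⊗≫ 𝟙 _ := by
      dsimp only [xiL]; bicategory
    _ = 𝟙 _ ⊗≫ (i ⊗≫ adj.unit ▷ (f ≫ g) ≫ κ ▷ (f ≫ g) ⊗≫ (h ≫ f) ◁ adj.counit ▷ g ⊗≫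
          𝟙 ((h ≫ f) ≫ g)) ▷ f ⊗≫
          (h ≫ f) ◁ adj.counit ⊗≫ 𝟙 _ := by
      rw [whisker_exchange]; dsimp only [xiLInv]; bicategory
    _ = 𝟙 _ ⊗≫ h ◁ leftZigzag adj.unit adj.counit ⊗≫ 𝟙 _ := by rw [key]; bicategory
    _ = _ := by rw [adj.left_triangle]; bicategory

/-- `ξ_i` is an isomorphism as soon as `f* ⊗ ξ_i` is. -/
lemma isIso_xiL (adj : f ⊣ g) {h : a ⟶ a} (i : h ⟶ f ≫ g) [IsIso (xiL adj i ▷ g)] :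
    IsIso (xiL adj i) :=
  ⟨xiLInv adj (inv (xiL adj i ▷ g)), comp_xiLInv adj i (by simp) (by simp),
    xiLInv_comp adj (by simp)⟩

lemma isIso_whiskerRight_adjMul_iff (adj : f ⊣ g) {h : a ⟶ a} (i : h ⟶ f ≫ g) :
    IsIso (i ▷ (f ≫ g) ≫ adjMul adj) ↔ IsIso (xiL adj i) := by
  rw [whiskerRight_comp_adjMul]
  refine ⟨fun h => ?_, fun h => inferInstance⟩
  have : IsIso (xiL adj i ▷ g) := IsIso.of_isIso_comp_left (α_ _ f g).inv _
  exact isIso_xiL adj i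

/-- The mate `f → f f* f` of `gammaL`. -/
def thetaL (adj : f ⊣ g) {h : a ⟶ a} (i : h ⟶ f ≫ g) [IsIso (xiL adj i)] : f ⟶ f ≫ g ≫ f :=
  inv (xiL adj i) ≫ i ▷ f ≫ (α_ f g f).hom

lemma homEquiv_thetaL (adj : f ⊣ g) {h : a ⟶ a} (i : h ⟶ f ≫ g) [IsIso (xiL adj i)] :
    adj.homEquiv₁ (thetaL adj i) = gammaL adj i := by
  simp [Adjunction.homEquiv₁_apply, thetaL, gammaL]

lemma homEquiv_symm_gammaL (adj : f ⊣ g) {h : a ⟶ a} (i : h ⟶ f ≫ g) [IsIso (xiL adj i)] :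
    adj.homEquiv₁.symm (gammaL adj i) = thetaL adj i := by
  rw [← homEquiv_thetaL, Equiv.symm_apply_apply]

/-- The mate of ε is a unit isomorphism, so passing to mates turns counitality of γ into the counit
law of the coaction θ. -/
lemma homEquiv_symm_counit (adj : f ⊣ g) (γ : g ≫ f ⟶ g ≫ f) :
    γ ≫ adj.counit = adj.counit ↔
      adj.homEquiv₁.symm γ ≫ f ◁ adj.counit ≫ (ρ_ f).hom = 𝟙 f := by
  have h1 : adj.homEquiv₁.symm γ ≫ f ◁ adj.counit = adj.homEquiv₁.symm (γ ≫ adj.counit) := by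
    simp [Adjunction.homEquiv₁_symm_apply]
  have h2 : adj.homEquiv₁.symm adj.counit = (ρ_ f).inv := by
    rw [Adjunction.homEquiv₁_symm_apply]
    calc
      _ = 𝟙 _ ⊗≫ leftZigzag adj.unit adj.counit ⊗≫ 𝟙 _ := by bicategory
      _ = _ := by rw [adj.left_triangle]; bicategory
  rw [← Category.assoc, ← Iso.eq_comp_inv, Category.id_comp, h1, ← h2, Equiv.apply_eq_iff_eq]

lemma gammaL_counit (adj : f ⊣ g) {h : a ⟶ a} (i : h ⟶ f ≫ g) [IsIso (xiL adj i)] :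
    gammaL adj i ≫ adj.counit = adj.counit := by
  rw [homEquiv_symm_counit, homEquiv_symm_gammaL]
  simp only [thetaL, Category.assoc]
  exact IsIso.inv_hom_id (xiL adj i)

/-- A counital endomorphism whose mate factors through `i` is `gammaL i`. -/
lemma gammaL_eq_of_factors (adj : f ⊣ g) {h : a ⟶ a} (i : h ⟶ f ≫ g) [IsIso (xiL adj i)]
    {γ : g ≫ f ⟶ g ≫ f} (hγ : γ ≫ adj.counit = adj.counit) (φ : f ⟶ h ≫ f)
    (hφ : adj.homEquiv₁.symm γ = φ ≫ i ▷ f ≫ (α_ f g f).hom) : gammaL adj i = γ := by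
  rw [homEquiv_symm_counit, hφ] at hγ
  apply adj.homEquiv₁.symm.injective
  rw [homEquiv_symm_gammaL, hφ, thetaL]
  -- Counitality of γ says that φ is a section of ξ_i; since ξ_i is invertible, φ is its inverse.
  congr 1
  rw [IsIso.inv_eq_of_inv_hom_id]
  simpa [xiL] using hγ

/-- `f* ⊗ θ : S → S ⊗ S`. -/
def coactL (f : a ⟶ b) (g : b ⟶ a) (θ : f ⟶ f ≫ g ≫ f) : f ≫ g ⟶ (f ≫ g) ≫ (f ≫ g) :=
  θ ▷ g ≫ (α_ f (g ≫ f) g).hom ≫ f ◁ (α_ g f g).hom ≫ (α_ f g (f ≫ g)).inv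

/-- `η ⊗ S : S → S ⊗ S`. -/
def unitL (adj : f ⊣ g) : f ≫ g ⟶ (f ≫ g) ≫ (f ≫ g) :=
  (ρ_ _).inv ≫ (f ≫ g) ◁ adj.unit

/-- A coherence isomorphism. -/
def tripleL (f : a ⟶ b) (g : b ⟶ a) : ((f ≫ g) ≫ (f ≫ g)) ≫ f ≅ f ≫ ((g ≫ f) ≫ (g ≫ f)) :=
  α_ (f ≫ g) (f ≫ g) f ≪≫ α_ f g ((f ≫ g) ≫ f) ≪≫ whiskerLeftIso f (whiskerLeftIso g (α_ f g f)) ≪≫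
    whiskerLeftIso f (α_ g f (g ≫ f)).symm

lemma homEquiv_symm_comul (adj : f ⊣ g) (γ : g ≫ f ⟶ g ≫ f) :
    adj.homEquiv₁.symm (γ ≫ adjComul adj) =
      adj.homEquiv₁.symm γ ≫ (α_ f g f).inv ≫ unitL adj ▷ f ≫ (tripleL f g).hom := by
  simp only [Adjunction.homEquiv₁_symm_apply, adjComul, unitL, tripleL, Iso.trans_hom,
    whiskerLeftIso_hom, Iso.symm_hom]
  bicategory

lemma homEquiv_symm_comul' (adj : f ⊣ g) (γ : g ≫ f ⟶ g ≫ f) :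
    adj.homEquiv₁.symm (adjComul adj ≫ γ ▷ (g ≫ f) ≫ (g ≫ f) ◁ γ) =
      adj.homEquiv₁.symm γ ≫ (α_ f g f).inv ≫ coactL f g (adj.homEquiv₁.symm γ) ▷ f ≫
        (tripleL f g).hom := by
  simp only [Adjunction.homEquiv₁_symm_apply, adjComul, coactL, tripleL, Iso.trans_hom,
    whiskerLeftIso_hom, Iso.symm_hom]
  calc
    -- Interchange separates the two units and the two copies of γ until each γ follows its own
    -- unit, so that θ appears twice in succession.
    _ = 𝟙 _ ⊗≫ (𝟙 a ◁ adj.unit ≫ adj.unit ▷ (f ≫ g)) ▷ f ⊗≫ f ◁ (γ ▷ (g ≫ f) ≫ (g ≫ f) ◁ γ) := by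
      rw [whisker_exchange]; bicategory
    _ = 𝟙 _ ⊗≫ adj.unit ▷ f ⊗≫ (adj.unit ▷ (f ≫ g ≫ f) ≫ (f ≫ g) ◁ f ◁ γ) ⊗≫
          f ◁ γ ▷ (g ≫ f) := by
      rw [← whisker_exchange γ γ]; bicategory
    _ = _ := by rw [← whisker_exchange]; bicategory

/-- Since f⊗η⊗f* is the comultiplication Δ of C, the second condition is coassociativity of θ: C⊗θ
and Δ⊗f agree after θ. -/
lemma comul_iff_coactL (adj : f ⊣ g) (γ : g ≫ f ⟶ g ≫ f) :
    γ ≫ adjComul adj = adjComul adj ≫ γ ▷ (g ≫ f) ≫ (g ≫ f) ◁ γ ↔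
      (adj.homEquiv₁.symm γ ≫ (α_ f g f).inv) ≫ coactL f g (adj.homEquiv₁.symm γ) ▷ f =
        (adj.homEquiv₁.symm γ ≫ (α_ f g f).inv) ≫ unitL adj ▷ f := by
  rw [← adj.homEquiv₁.symm.apply_eq_iff_eq, homEquiv_symm_comul, homEquiv_symm_comul',
    ← cancel_mono (tripleL f g).hom]
  simp only [Category.assoc]
  exact eq_comm

/-- Write i as (f*⊗ξ_i)∘(η⊗h). Then θ_i∘ξ_i = f⊗i by cancellation, and naturality of η finishes. For
a left genuine I it follows that I lies in the equalizer attached to its own coaction. -/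
lemma comp_coactL (adj : f ⊣ g) {h : a ⟶ a} (i : h ⟶ f ≫ g) [IsIso (xiL adj i)] :
    i ≫ coactL f g (thetaL adj i) = i ≫ unitL adj := by
  calc
    _ = ((ρ_ h).inv ≫ h ◁ adj.unit ≫ (α_ h f g).inv ≫ xiL adj i ▷ g) ≫
          coactL f g (thetaL adj i) := by rw [unit_comp_xiL]
    _ = 𝟙 _ ⊗≫ h ◁ adj.unit ⊗≫ (xiL adj i ≫ inv (xiL adj i)) ▷ g ⊗≫ i ▷ (f ≫ g) ⊗≫ 𝟙 _ := by
      dsimp only [coactL, thetaL]; bicategory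
    _ = 𝟙 _ ⊗≫ (h ◁ adj.unit ≫ i ▷ (f ≫ g)) ⊗≫ 𝟙 _ := by rw [IsIso.hom_inv_id]; bicategory
    _ = _ := by rw [whisker_exchange]; dsimp only [unitL]; bicategory

/-- Coassociativity of θ_i is immediate, because θ_i factors through f⊗i and i already equalizes
f*⊗θ_i and η⊗S. -/
lemma gammaL_comul (adj : f ⊣ g) {h : a ⟶ a} (i : h ⟶ f ≫ g) [IsIso (xiL adj i)] :
    gammaL adj i ≫ adjComul adj =
      adjComul adj ≫ gammaL adj i ▷ (g ≫ f) ≫ (g ≫ f) ◁ gammaL adj i := by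
  have h1 : thetaL adj i ≫ (α_ f g f).inv = inv (xiL adj i) ≫ i ▷ f := by simp [thetaL]
  rw [comul_iff_coactL, homEquiv_symm_gammaL, h1, Category.assoc, Category.assoc,
    ← comp_whiskerRight, ← comp_whiskerRight, comp_coactL]

/-- The action `f ⊗ S → f`. -/
def actionL (adj : f ⊣ g) : (f ≫ g) ≫ f ⟶ f :=
  (α_ f g f).hom ≫ f ◁ adj.counit ≫ (ρ_ f).hom

lemma xiL_eq (adj : f ⊣ g) {h : a ⟶ a} (i : h ⟶ f ≫ g) : xiL adj i = i ▷ f ≫ actionL adj := rfl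

/-- The action `f ⊗ S ⊗ S → f ⊗ S` on the first two factors. -/
def actionL₂ (adj : f ⊣ g) : ((f ≫ g) ≫ (f ≫ g)) ≫ f ⟶ (f ≫ g) ≫ f :=
  (α_ (f ≫ g) (f ≫ g) f).hom ≫ (f ≫ g) ◁ actionL adj

lemma unitL_actionL₂ (adj : f ⊣ g) : unitL adj ▷ f ≫ actionL₂ adj = 𝟙 _ := by
  calc
    _ = 𝟙 _ ⊗≫ (f ≫ g) ◁ leftZigzag adj.unit adj.counit ⊗≫ 𝟙 _ := by
      dsimp only [unitL, actionL₂, actionL]; bicategory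
    _ = _ := by rw [adj.left_triangle]; bicategory

/-- Naturality of ε with respect to θ. With the triangle identity of `unitL_actionL₂` this gives the
standard splitting of the resolution of a coalgebra. -/
lemma coactL_actionL₂ (adj : f ⊣ g) (θ : f ⟶ f ≫ g ≫ f) :
    coactL f g θ ▷ f ≫ actionL₂ adj = actionL adj ≫ θ ≫ (α_ f g f).inv := by
  calc
    _ = 𝟙 _ ⊗≫ (θ ▷ (g ≫ f) ≫ (f ≫ g ≫ f) ◁ adj.counit) ⊗≫ 𝟙 _ := by
      dsimp only [coactL, actionL₂, actionL]; bicategory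
    _ = _ := by rw [← whisker_exchange]; dsimp only [actionL]; bicategory

/-- The pair `f ⊗ f* ⊗ θ`, `f ⊗ η ⊗ S` is split by the actions. -/
def splitL (adj : f ⊣ g) {θ : f ⟶ f ≫ g ≫ f} (h₁ : θ ≫ f ◁ adj.counit ≫ (ρ_ f).hom = 𝟙 f)
    (h₂ : (θ ≫ (α_ f g f).inv) ≫ coactL f g θ ▷ f = (θ ≫ (α_ f g f).inv) ≫ unitL adj ▷ f) :
    IsSplitEqualizer (coactL f g θ ▷ f) (unitL adj ▷ f) (θ ≫ (α_ f g f).inv) where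
  leftRetraction := actionL adj
  rightRetraction := actionL₂ adj
  condition := h₂
  ι_leftRetraction := by simpa [actionL] using h₁
  bottom_rightRetraction := unitL_actionL₂ adj
  top_rightRetraction := coactL_actionL₂ adj θ

/-- If `θ` factors through the equalizer `i` of `f* ⊗ θ` and `η ⊗ S`, then `ξ_i` is an
isomorphism. -/
lemma isIso_xiL_of_factors (adj : f ⊣ g) {θ : f ⟶ f ≫ g ≫ f}
    (h₁ : θ ≫ f ◁ adj.counit ≫ (ρ_ f).hom = 𝟙 f) {h : a ⟶ a} (i : h ⟶ f ≫ g) [Mono (i ▷ f)]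
    (hi : i ≫ coactL f g θ = i ≫ unitL adj) (φ : f ⟶ h ≫ f) (hφ : φ ≫ i ▷ f = θ ≫ (α_ f g f).inv) :
    IsIso (xiL adj i) := by
  refine ⟨φ, ?_, ?_⟩
  -- The composite θ∘ξ_i is (ε⊗S)-contraction after (f⊗f*⊗θ)∘(f⊗i). As i equalizes the pair, f*⊗θ
  -- may be replaced by η⊗S, which the contraction cancels.
  · rw [← cancel_mono (i ▷ f), Category.assoc, hφ, xiL_eq, Category.assoc, ← coactL_actionL₂,
      ← Category.assoc, ← comp_whiskerRight, hi, comp_whiskerRight, Category.assoc,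
      unitL_actionL₂]
    simp
  · rw [xiL_eq, ← Category.assoc, hφ]
    simpa [actionL] using h₁

section Product

variable (adj : f ⊣ g) {h k l : a ⟶ a} (i : h ⟶ f ≫ g) (j : k ⟶ f ≫ g) (q : l ⟶ f ≫ g)
  (p : k ≫ h ⟶ l) (hp : p ≫ q = k ◁ i ≫ j ▷ (f ≫ g) ≫ adjMul adj)

include hp in
-- Associativity of the action of S on f: acting by a product in IJ is acting by the factor in I,
-- then by the factor in J. Here h, k, l stand for I, J, IJ.
lemma product_xiL : p ▷ f ≫ xiL adj q = (α_ k h f).hom ≫ k ◁ xiL adj i ≫ xiL adj j := by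
  calc
    _ = (p ≫ q) ▷ f ≫ actionL adj := by rw [xiL_eq]; simp
    _ = 𝟙 _ ⊗≫ k ◁ i ▷ f ⊗≫ j ▷ (f ≫ g ≫ f) ⊗≫
          f ◁ (adj.counit ▷ (g ≫ f) ≫ 𝟙 b ◁ adj.counit) ⊗≫ 𝟙 _ := by
      rw [hp]; dsimp only [adjMul, actionL]; bicategory
    _ = 𝟙 _ ⊗≫ k ◁ i ▷ f ⊗≫ (j ▷ (f ≫ g ≫ f) ≫ (f ≫ g) ◁ f ◁ adj.counit) ⊗≫
          f ◁ adj.counit ⊗≫ 𝟙 _ := by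
      rw [← whisker_exchange]; bicategory
    _ = _ := by rw [← whisker_exchange]; dsimp only [xiL]; bicategory

include hp in
lemma isIso_xiL_product [IsIso (xiL adj i)] [IsIso (xiL adj j)] [Epi (p ▷ f)] :
    IsIso (xiL adj q) := by
  have : IsIso (p ▷ f ≫ xiL adj q) := by
    rw [product_xiL adj i j q p hp]; infer_instance
  -- The map f⊗p is epi by hypothesis and split mono because it starts a composite that is
  -- invertible, so it is invertible and can be cancelled.
  have : IsSplitMono (p ▷ f) := ⟨⟨⟨xiL adj q ≫ inv (p ▷ f ≫ xiL adj q), by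
    rw [← Category.assoc, IsIso.hom_inv_id]⟩⟩⟩
  have : IsIso (p ▷ f) := isIso_of_epi_of_isSplitMono _
  exact IsIso.of_isIso_comp_left (p ▷ f) _

include hp in
-- The mate of Γ(I)∘Γ(J) factors through f⊗IJ: undo ξ_J, then ξ_I, then multiply by p. A counital
-- endomorphism with such a factorization is Γ(IJ).
lemma gammaL_product [IsIso (xiL adj i)] [IsIso (xiL adj j)] [IsIso (xiL adj q)] :
    gammaL adj q = gammaL adj j ≫ gammaL adj i := by
  refine gammaL_eq_of_factors adj q (by rw [Category.assoc, gammaL_counit, gammaL_counit])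
    (inv (xiL adj j) ≫ k ◁ inv (xiL adj i) ≫ (α_ k h f).inv ≫ p ▷ f) ?_
  have h1 : adj.homEquiv₁.symm (gammaL adj j ≫ gammaL adj i) =
      thetaL adj j ≫ f ◁ gammaL adj i := by
    rw [← homEquiv_symm_gammaL]; simp [Adjunction.homEquiv₁_symm_apply]
  rw [h1]
  calc
    _ = inv (xiL adj j) ⊗≫ (j ▷ f ≫ (f ≫ g) ◁ thetaL adj i) ⊗≫ f ◁ adj.counit ▷ (g ≫ f) ⊗≫ 𝟙 _ := by
      rw [← homEquiv_thetaL, Adjunction.homEquiv₁_apply]; dsimp only [thetaL]; bicategory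
    _ = inv (xiL adj j) ⊗≫ k ◁ inv (xiL adj i) ⊗≫ (k ◁ i ≫ j ▷ (f ≫ g) ≫ adjMul adj) ▷ f ⊗≫
          𝟙 _ := by
      rw [← whisker_exchange]; dsimp only [thetaL, adjMul]; bicategory
    _ = _ := by rw [← hp]; bicategory

end Product

section Unit

variable (adj : f ⊣ g) {l : a ⟶ a} (q : l ⟶ f ≫ g) (p : 𝟙 a ⟶ l) (hp : p ≫ q = adj.unit)

include hp in
lemma unit_xiL : p ▷ f ≫ xiL adj q = (λ_ f).hom := by
  calc
    _ = (p ≫ q) ▷ f ≫ actionL adj := by rw [xiL_eq]; simp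
    _ = 𝟙 _ ⊗≫ leftZigzag adj.unit adj.counit ⊗≫ 𝟙 _ := by
      rw [hp]; dsimp only [actionL]; bicategory
    _ = _ := by rw [adj.left_triangle]; bicategory

include hp in
lemma isIso_xiL_unit [Epi (p ▷ f)] : IsIso (xiL adj q) := by
  have h := unit_xiL adj q p hp
  have : IsSplitMono (p ▷ f) := ⟨⟨⟨xiL adj q ≫ (λ_ f).inv, by
    rw [← Category.assoc, h, Iso.hom_inv_id]⟩⟩⟩
  have : IsIso (p ▷ f) := isIso_of_epi_of_isSplitMono _
  have : IsIso (p ▷ f ≫ xiL adj q) := by rw [h]; infer_instance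
  exact IsIso.of_isIso_comp_left (p ▷ f) _

include hp in
lemma gammaL_unit [IsIso (xiL adj q)] : gammaL adj q = 𝟙 _ := by
  refine gammaL_eq_of_factors adj q (by simp) ((λ_ f).inv ≫ p ▷ f) ?_
  rw [Category.assoc, ← comp_whiskerRight_assoc, hp]
  simp [Adjunction.homEquiv₁_symm_apply]

end Unit

end AdjunctionLeft

/-! ### The mirror image: ξ^r, Γ_{f*} and coactions of C on f*. -/

section AdjunctionRight

open Bicategory

universe w v₁ v₂
variable {𝔹 : Type v₂} [Bicategory.{w, v₁} 𝔹] {a b : 𝔹} {f : a ⟶ b} {g : b ⟶ a}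

lemma whiskerLeft_comp_adjMul (adj : f ⊣ g) {h : a ⟶ a} (i : h ⟶ f ≫ g) :
    (f ≫ g) ◁ i ≫ adjMul adj = (α_ f g h).hom ≫ f ◁ xiR adj i := by
  dsimp only [adjMul, xiR]; bicategory

/-- Here i and ξ_i are mates under (-⊗f*) ⊣ (-⊗f). -/
lemma unit_comp_xiR (adj : f ⊣ g) {h : a ⟶ a} (i : h ⟶ f ≫ g) :
    (λ_ h).inv ≫ adj.unit ▷ h ≫ (α_ f g h).hom ≫ f ◁ xiR adj i = i := by
  calc
    _ = 𝟙 _ ⊗≫ (adj.unit ▷ h ≫ (f ≫ g) ◁ i) ⊗≫ f ◁ adj.counit ▷ g ⊗≫ 𝟙 _ := by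
      dsimp only [xiR]; bicategory
    _ = i ⊗≫ leftZigzag adj.unit adj.counit ▷ g ⊗≫ 𝟙 _ := by
      rw [← whisker_exchange]; bicategory
    _ = i := by rw [adj.left_triangle]; bicategory

/-- The inverse of `xiR` obtained from an inverse of `f ◁ xiR`. -/
def xiRInv (adj : f ⊣ g) {h : a ⟶ a} (κ : f ≫ g ⟶ f ≫ g ≫ h) : g ⟶ g ≫ h :=
  (ρ_ g).inv ≫ g ◁ adj.unit ≫ g ◁ κ ≫ (α_ g f (g ≫ h)).inv ≫ adj.counit ▷ (g ≫ h) ≫ (λ_ _).hom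

lemma xiRInv_comp (adj : f ⊣ g) {h : a ⟶ a} {κ : f ≫ g ⟶ f ≫ g ≫ h} {x : g ≫ h ⟶ g}
    (hκ : κ ≫ f ◁ x = 𝟙 _) : xiRInv adj κ ≫ x = 𝟙 _ := by
  calc
    _ = 𝟙 _ ⊗≫ g ◁ adj.unit ≫ g ◁ κ ⊗≫ (adj.counit ▷ (g ≫ h) ≫ 𝟙 b ◁ x) ⊗≫ 𝟙 _ := by
      dsimp only [xiRInv]; bicategory
    _ = 𝟙 _ ⊗≫ g ◁ adj.unit ≫ g ◁ (κ ≫ f ◁ x) ⊗≫ adj.counit ▷ g ⊗≫ 𝟙 _ := by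
      rw [← whisker_exchange]; bicategory
    _ = 𝟙 _ ⊗≫ rightZigzag adj.unit adj.counit ⊗≫ 𝟙 _ := by rw [hκ]; bicategory
    _ = _ := by rw [adj.right_triangle]; bicategory

lemma comp_xiRInv (adj : f ⊣ g) {h : a ⟶ a} (i : h ⟶ f ≫ g) {κ : f ≫ g ⟶ f ≫ g ≫ h}
    (hκ : κ ≫ f ◁ xiR adj i = 𝟙 _) (hκ' : f ◁ xiR adj i ≫ κ = 𝟙 _) :
    xiR adj i ≫ xiRInv adj κ = 𝟙 _ := by
  -- The left side is (κ'⊗f)∘i with κ' = `xiRInv adj κ`, the right side the unit h → h⊗f*⊗f; ξ_i⊗f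
  -- takes both to i.
  have key : i ⊗≫ (f ≫ g) ◁ adj.unit ≫ (f ≫ g) ◁ κ ⊗≫ f ◁ adj.counit ▷ (g ≫ h) ⊗≫ 𝟙 _ =
      (λ_ h).inv ≫ adj.unit ▷ h ≫ (α_ f g h).hom := by
    have inj : Function.Injective fun z : h ⟶ f ≫ g ≫ h => z ≫ f ◁ xiR adj i := fun z z' e => by
      simpa [hκ'] using congrArg (· ≫ κ) e
    apply inj
    have h2 := unit_comp_xiR adj i
    simp only [Category.assoc] at h2 ⊢
    rw [h2]
    calc
      _ = i ⊗≫ (f ≫ g) ◁ adj.unit ≫ (f ≫ g) ◁ κ ⊗≫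
            f ◁ (adj.counit ▷ (g ≫ h) ≫ 𝟙 b ◁ xiR adj i) ⊗≫ 𝟙 _ := by bicategory
      _ = i ⊗≫ (f ≫ g) ◁ adj.unit ≫ (f ≫ g) ◁ (κ ≫ f ◁ xiR adj i) ⊗≫
            f ◁ adj.counit ▷ g ⊗≫ 𝟙 _ := by
        rw [← whisker_exchange]; bicategory
      _ = i ⊗≫ f ◁ rightZigzag adj.unit adj.counit ⊗≫ 𝟙 _ := by rw [hκ]; bicategory
      _ = _ := by rw [adj.right_triangle]; bicategory
  calc
    _ = g ◁ i ⊗≫ (adj.counit ▷ g ≫ 𝟙 b ◁ xiRInv (h := h) adj κ) ⊗≫ 𝟙 _ := by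
      dsimp only [xiR]; bicategory
    _ = 𝟙 _ ⊗≫ g ◁ (i ⊗≫ (f ≫ g) ◁ adj.unit ≫ (f ≫ g) ◁ κ ⊗≫ f ◁ adj.counit ▷ (g ≫ h) ⊗≫
          𝟙 (f ≫ g ≫ h)) ⊗≫ adj.counit ▷ (g ≫ h) ⊗≫ 𝟙 _ := by
      rw [← whisker_exchange]; dsimp only [xiRInv]; bicategory
    _ = 𝟙 _ ⊗≫ rightZigzag adj.unit adj.counit ▷ h ⊗≫ 𝟙 _ := by rw [key]; bicategory
    _ = _ := by rw [adj.right_triangle]; bicategory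

/-- `ξ_i` is an isomorphism as soon as `ξ_i ⊗ f` is. -/
lemma isIso_xiR (adj : f ⊣ g) {h : a ⟶ a} (i : h ⟶ f ≫ g) [IsIso (f ◁ xiR adj i)] :
    IsIso (xiR adj i) :=
  ⟨xiRInv adj (inv (f ◁ xiR adj i)), comp_xiRInv adj i (by simp) (by simp),
    xiRInv_comp adj (by simp)⟩

lemma isIso_whiskerLeft_adjMul_iff (adj : f ⊣ g) {h : a ⟶ a} (i : h ⟶ f ≫ g) :
    IsIso ((f ≫ g) ◁ i ≫ adjMul adj) ↔ IsIso (xiR adj i) := by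
  rw [whiskerLeft_comp_adjMul]
  refine ⟨fun h => ?_, fun h => inferInstance⟩
  have : IsIso (f ◁ xiR adj i) := IsIso.of_isIso_comp_left (α_ f g _).hom _
  exact isIso_xiR adj i

/-- The mate `f* → f* f f*` of `gammaR`. -/
def thetaR (adj : f ⊣ g) {h : a ⟶ a} (i : h ⟶ f ≫ g) [IsIso (xiR adj i)] : g ⟶ (g ≫ f) ≫ g :=
  inv (xiR adj i) ≫ g ◁ i ≫ (α_ g f g).inv

lemma homEquiv_symm_thetaR (adj : f ⊣ g) {h : a ⟶ a} (i : h ⟶ f ≫ g) [IsIso (xiR adj i)] :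
    adj.homEquiv₂.symm (thetaR adj i) = gammaR adj i := by
  simp [Adjunction.homEquiv₂_symm_apply, thetaR, gammaR]

lemma homEquiv_gammaR (adj : f ⊣ g) {h : a ⟶ a} (i : h ⟶ f ≫ g) [IsIso (xiR adj i)] :
    adj.homEquiv₂ (gammaR adj i) = thetaR adj i := by
  rw [← homEquiv_symm_thetaR, Equiv.apply_symm_apply]

lemma homEquiv_counit (adj : f ⊣ g) (γ : g ≫ f ⟶ g ≫ f) :
    γ ≫ adj.counit = adj.counit ↔
      adj.homEquiv₂ γ ≫ adj.counit ▷ g ≫ (λ_ g).hom = 𝟙 g := by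
  have h1 : adj.homEquiv₂ γ ≫ adj.counit ▷ g = adj.homEquiv₂ (γ ≫ adj.counit) := by
    simp [Adjunction.homEquiv₂_apply]
  have h2 : adj.homEquiv₂ adj.counit = (λ_ g).inv := by
    rw [Adjunction.homEquiv₂_apply]
    calc
      _ = 𝟙 _ ⊗≫ rightZigzag adj.unit adj.counit ⊗≫ 𝟙 _ := by bicategory
      _ = _ := by rw [adj.right_triangle]; bicategory
  rw [← Category.assoc, ← Iso.eq_comp_inv, Category.id_comp, h1, ← h2, Equiv.apply_eq_iff_eq]

lemma gammaR_counit (adj : f ⊣ g) {h : a ⟶ a} (i : h ⟶ f ≫ g) [IsIso (xiR adj i)] :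
    gammaR adj i ≫ adj.counit = adj.counit := by
  rw [homEquiv_counit, homEquiv_gammaR]
  simp only [thetaR, Category.assoc]
  exact IsIso.inv_hom_id (xiR adj i)

/-- A counital endomorphism whose mate factors through `i` is `gammaR i`. -/
lemma gammaR_eq_of_factors (adj : f ⊣ g) {h : a ⟶ a} (i : h ⟶ f ≫ g) [IsIso (xiR adj i)]
    {γ : g ≫ f ⟶ g ≫ f} (hγ : γ ≫ adj.counit = adj.counit) (φ : g ⟶ g ≫ h)
    (hφ : adj.homEquiv₂ γ = φ ≫ g ◁ i ≫ (α_ g f g).inv) : gammaR adj i = γ := by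
  rw [homEquiv_counit, hφ] at hγ
  apply adj.homEquiv₂.injective
  rw [homEquiv_gammaR, hφ, thetaR]
  congr 1
  rw [IsIso.inv_eq_of_inv_hom_id]
  simpa [xiR] using hγ

/-- `θ ⊗ f : S → S ⊗ S`. -/
def coactR (f : a ⟶ b) (g : b ⟶ a) (θ : g ⟶ (g ≫ f) ≫ g) : f ≫ g ⟶ (f ≫ g) ≫ (f ≫ g) :=
  f ◁ θ ≫ f ◁ (α_ g f g).hom ≫ (α_ f g (f ≫ g)).inv

/-- `S ⊗ η : S → S ⊗ S`. -/
def unitR (adj : f ⊣ g) : f ≫ g ⟶ (f ≫ g) ≫ (f ≫ g) :=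
  (λ_ _).inv ≫ adj.unit ▷ (f ≫ g)

/-- A coherence isomorphism. -/
def tripleR (f : a ⟶ b) (g : b ⟶ a) : g ≫ ((f ≫ g) ≫ (f ≫ g)) ≅ ((g ≫ f) ≫ (g ≫ f)) ≫ g :=
  (α_ g (f ≫ g) (f ≫ g)).symm ≪≫ whiskerRightIso (α_ g f g).symm (f ≫ g) ≪≫
    (α_ ((g ≫ f) ≫ g) f g).symm ≪≫ whiskerRightIso (α_ (g ≫ f) g f) g

lemma homEquiv_comul (adj : f ⊣ g) (γ : g ≫ f ⟶ g ≫ f) :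
    adj.homEquiv₂ (γ ≫ adjComul adj) =
      adj.homEquiv₂ γ ≫ (α_ g f g).hom ≫ g ◁ unitR adj ≫ (tripleR f g).hom := by
  simp only [Adjunction.homEquiv₂_apply, adjComul, unitR, tripleR, Iso.trans_hom,
    whiskerRightIso_hom, Iso.symm_hom]
  bicategory

lemma homEquiv_comul' (adj : f ⊣ g) (γ : g ≫ f ⟶ g ≫ f) :
    adj.homEquiv₂ (adjComul adj ≫ γ ▷ (g ≫ f) ≫ (g ≫ f) ◁ γ) =
      adj.homEquiv₂ γ ≫ (α_ g f g).hom ≫ g ◁ coactR f g (adj.homEquiv₂ γ) ≫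
        (tripleR f g).hom := by
  simp only [Adjunction.homEquiv₂_apply, adjComul, coactR, tripleR, Iso.trans_hom,
    whiskerRightIso_hom, Iso.symm_hom]
  calc
    _ = 𝟙 _ ⊗≫ g ◁ (adj.unit ▷ 𝟙 a ≫ (f ≫ g) ◁ adj.unit) ⊗≫
          (γ ▷ (g ≫ f) ≫ (g ≫ f) ◁ γ) ▷ g ⊗≫ 𝟙 _ := by
      rw [← whisker_exchange adj.unit adj.unit]; bicategory
    _ = 𝟙 _ ⊗≫ g ◁ adj.unit ⊗≫ ((g ≫ f) ◁ g ◁ adj.unit ≫ γ ▷ (g ≫ f ≫ g)) ⊗≫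
          (g ≫ f) ◁ γ ▷ g ⊗≫ 𝟙 _ := by
      bicategory
    _ = _ := by rw [whisker_exchange]; bicategory

/-- Coassociativity of the right coaction θ : f* → f*⊗C. -/
lemma comul_iff_coactR (adj : f ⊣ g) (γ : g ≫ f ⟶ g ≫ f) :
    γ ≫ adjComul adj = adjComul adj ≫ γ ▷ (g ≫ f) ≫ (g ≫ f) ◁ γ ↔
      (adj.homEquiv₂ γ ≫ (α_ g f g).hom) ≫ g ◁ coactR f g (adj.homEquiv₂ γ) =
        (adj.homEquiv₂ γ ≫ (α_ g f g).hom) ≫ g ◁ unitR adj := by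
  rw [← adj.homEquiv₂.apply_eq_iff_eq, homEquiv_comul, homEquiv_comul',
    ← cancel_mono (tripleR f g).hom]
  simp only [Category.assoc]
  exact eq_comm

lemma comp_coactR (adj : f ⊣ g) {h : a ⟶ a} (i : h ⟶ f ≫ g) [IsIso (xiR adj i)] :
    i ≫ coactR f g (thetaR adj i) = i ≫ unitR adj := by
  calc
    _ = ((λ_ h).inv ≫ adj.unit ▷ h ≫ (α_ f g h).hom ≫ f ◁ xiR adj i) ≫
          coactR f g (thetaR adj i) := by rw [unit_comp_xiR]
    _ = 𝟙 _ ⊗≫ adj.unit ▷ h ⊗≫ f ◁ (xiR adj i ≫ inv (xiR adj i)) ⊗≫ (f ≫ g) ◁ i ⊗≫ 𝟙 _ := by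
      dsimp only [coactR, thetaR]; bicategory
    _ = 𝟙 _ ⊗≫ (adj.unit ▷ h ≫ (f ≫ g) ◁ i) ⊗≫ 𝟙 _ := by rw [IsIso.hom_inv_id]; bicategory
    _ = _ := by rw [← whisker_exchange]; dsimp only [unitR]; bicategory

lemma gammaR_comul (adj : f ⊣ g) {h : a ⟶ a} (i : h ⟶ f ≫ g) [IsIso (xiR adj i)] :
    gammaR adj i ≫ adjComul adj =
      adjComul adj ≫ gammaR adj i ▷ (g ≫ f) ≫ (g ≫ f) ◁ gammaR adj i := by
  have h1 : thetaR adj i ≫ (α_ g f g).hom = inv (xiR adj i) ≫ g ◁ i := by simp [thetaR]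
  rw [comul_iff_coactR, homEquiv_gammaR, h1, Category.assoc, Category.assoc,
    ← whiskerLeft_comp, ← whiskerLeft_comp, comp_coactR]

/-- The action `S ⊗ f* → f*`. -/
def actionR (adj : f ⊣ g) : g ≫ f ≫ g ⟶ g :=
  (α_ g f g).inv ≫ adj.counit ▷ g ≫ (λ_ g).hom

lemma xiR_eq (adj : f ⊣ g) {h : a ⟶ a} (i : h ⟶ f ≫ g) : xiR adj i = g ◁ i ≫ actionR adj := rfl

/-- The action `S ⊗ S ⊗ f* → S ⊗ f*` on the last two factors. -/
def actionR₂ (adj : f ⊣ g) : g ≫ ((f ≫ g) ≫ (f ≫ g)) ⟶ g ≫ (f ≫ g) :=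
  (α_ g (f ≫ g) (f ≫ g)).inv ≫ actionR adj ▷ (f ≫ g)

lemma unitR_actionR₂ (adj : f ⊣ g) : g ◁ unitR adj ≫ actionR₂ adj = 𝟙 _ := by
  calc
    _ = 𝟙 _ ⊗≫ rightZigzag adj.unit adj.counit ▷ (f ≫ g) ⊗≫ 𝟙 _ := by
      dsimp only [unitR, actionR₂, actionR]; bicategory
    _ = _ := by rw [adj.right_triangle]; bicategory

lemma coactR_actionR₂ (adj : f ⊣ g) (θ : g ⟶ (g ≫ f) ≫ g) :
    g ◁ coactR f g θ ≫ actionR₂ adj = actionR adj ≫ θ ≫ (α_ g f g).hom := by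
  calc
    _ = 𝟙 _ ⊗≫ ((g ≫ f) ◁ θ ≫ adj.counit ▷ ((g ≫ f) ≫ g)) ⊗≫ 𝟙 _ := by
      dsimp only [coactR, actionR₂, actionR]; bicategory
    _ = _ := by rw [whisker_exchange]; dsimp only [actionR]; bicategory

/-- The pair `θ ⊗ f ⊗ f*`, `S ⊗ η ⊗ f*` is split by the actions. -/
def splitR (adj : f ⊣ g) {θ : g ⟶ (g ≫ f) ≫ g} (h₁ : θ ≫ adj.counit ▷ g ≫ (λ_ g).hom = 𝟙 g)
    (h₂ : (θ ≫ (α_ g f g).hom) ≫ g ◁ coactR f g θ = (θ ≫ (α_ g f g).hom) ≫ g ◁ unitR adj) :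
    IsSplitEqualizer (g ◁ coactR f g θ) (g ◁ unitR adj) (θ ≫ (α_ g f g).hom) where
  leftRetraction := actionR adj
  rightRetraction := actionR₂ adj
  condition := h₂
  ι_leftRetraction := by simpa [actionR] using h₁
  bottom_rightRetraction := unitR_actionR₂ adj
  top_rightRetraction := coactR_actionR₂ adj θ

/-- If `θ` factors through the equalizer `i` of `θ ⊗ f` and `S ⊗ η`, then `ξ_i` is an
isomorphism. -/
lemma isIso_xiR_of_factors (adj : f ⊣ g) {θ : g ⟶ (g ≫ f) ≫ g}
    (h₁ : θ ≫ adj.counit ▷ g ≫ (λ_ g).hom = 𝟙 g) {h : a ⟶ a} (i : h ⟶ f ≫ g) [Mono (g ◁ i)]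
    (hi : i ≫ coactR f g θ = i ≫ unitR adj) (φ : g ⟶ g ≫ h) (hφ : φ ≫ g ◁ i = θ ≫ (α_ g f g).hom) :
    IsIso (xiR adj i) := by
  refine ⟨φ, ?_, ?_⟩
  · rw [← cancel_mono (g ◁ i), Category.assoc, hφ, xiR_eq, Category.assoc, ← coactR_actionR₂,
      ← Category.assoc, ← whiskerLeft_comp, hi, whiskerLeft_comp, Category.assoc,
      unitR_actionR₂]
    simp
  · rw [xiR_eq, ← Category.assoc, hφ]
    simpa [actionR] using h₁

section Product

variable (adj : f ⊣ g) {h k l : a ⟶ a} (i : h ⟶ f ≫ g) (j : k ⟶ f ≫ g) (q : l ⟶ f ≫ g)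
  (p : k ≫ h ⟶ l) (hp : p ≫ q = k ◁ i ≫ j ▷ (f ≫ g) ≫ adjMul adj)

include hp in
-- On f* the algebra S acts from the left, so the factor in J acts first. This reversal is the
-- source of the opposite monoid in (R).
lemma product_xiR : g ◁ p ≫ xiR adj q = (α_ g k h).inv ≫ xiR adj j ▷ h ≫ xiR adj i := by
  calc
    _ = g ◁ (p ≫ q) ≫ actionR adj := by rw [xiR_eq]; simp
    _ = 𝟙 _ ⊗≫ g ◁ (k ◁ i ≫ j ▷ (f ≫ g)) ⊗≫
          ((g ≫ f) ◁ adj.counit ≫ adj.counit ▷ 𝟙 b) ▷ g ⊗≫ 𝟙 _ := by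
      rw [hp]; dsimp only [adjMul, actionR]; bicategory
    _ = 𝟙 _ ⊗≫ g ◁ j ▷ h ⊗≫ ((g ≫ f ≫ g) ◁ i ≫ actionR adj ▷ (f ≫ g)) ⊗≫
          adj.counit ▷ g ⊗≫ 𝟙 _ := by
      rw [whisker_exchange j i, whisker_exchange adj.counit adj.counit]
      dsimp only [actionR]; bicategory
    _ = _ := by rw [whisker_exchange]; dsimp only [xiR, actionR]; bicategory

include hp in
lemma isIso_xiR_product [IsIso (xiR adj i)] [IsIso (xiR adj j)] [Epi (g ◁ p)] :
    IsIso (xiR adj q) := by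
  have : IsIso (g ◁ p ≫ xiR adj q) := by
    rw [product_xiR adj i j q p hp]; infer_instance
  have : IsSplitMono (g ◁ p) := ⟨⟨⟨xiR adj q ≫ inv (g ◁ p ≫ xiR adj q), by
    rw [← Category.assoc, IsIso.hom_inv_id]⟩⟩⟩
  have : IsIso (g ◁ p) := isIso_of_epi_of_isSplitMono _
  exact IsIso.of_isIso_comp_left (g ◁ p) _

include hp in
lemma gammaR_product [IsIso (xiR adj i)] [IsIso (xiR adj j)] [IsIso (xiR adj q)] :
    gammaR adj q = gammaR adj i ≫ gammaR adj j := by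
  refine gammaR_eq_of_factors adj q (by rw [Category.assoc, gammaR_counit, gammaR_counit])
    (inv (xiR adj i) ≫ inv (xiR adj j) ▷ h ≫ (α_ g k h).hom ≫ g ◁ p) ?_
  have h1 : adj.homEquiv₂ (gammaR adj i ≫ gammaR adj j) =
      thetaR adj i ≫ gammaR adj j ▷ g := by
    rw [← homEquiv_gammaR]; simp [Adjunction.homEquiv₂_apply]
  rw [h1]
  calc
    _ = inv (xiR adj i) ⊗≫ (g ◁ i ≫ thetaR adj j ▷ (f ≫ g)) ⊗≫ (g ≫ f) ◁ adj.counit ▷ g ⊗≫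
          𝟙 _ := by
      rw [← homEquiv_symm_thetaR, Adjunction.homEquiv₂_symm_apply]; dsimp only [thetaR]; bicategory
    _ = inv (xiR adj i) ⊗≫ inv (xiR adj j) ▷ h ⊗≫ g ◁ (j ▷ h ≫ (f ≫ g) ◁ i) ⊗≫ g ◁ adjMul adj ⊗≫
          𝟙 _ := by
      rw [whisker_exchange]; dsimp only [thetaR, adjMul]; bicategory
    _ = inv (xiR adj i) ⊗≫ inv (xiR adj j) ▷ h ⊗≫ g ◁ (k ◁ i ≫ j ▷ (f ≫ g) ≫ adjMul adj) ⊗≫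
          𝟙 _ := by
      rw [← whisker_exchange]; bicategory
    _ = _ := by rw [← hp]; bicategory

end Product

section Unit

variable (adj : f ⊣ g) {l : a ⟶ a} (q : l ⟶ f ≫ g) (p : 𝟙 a ⟶ l) (hp : p ≫ q = adj.unit)

include hp in
lemma unit_xiR : g ◁ p ≫ xiR adj q = (ρ_ g).hom := by
  calc
    _ = g ◁ (p ≫ q) ≫ actionR adj := by rw [xiR_eq]; simp
    _ = 𝟙 _ ⊗≫ rightZigzag adj.unit adj.counit ⊗≫ 𝟙 _ := by
      rw [hp]; dsimp only [actionR]; bicategory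
    _ = _ := by rw [adj.right_triangle]; bicategory

include hp in
lemma isIso_xiR_unit [Epi (g ◁ p)] : IsIso (xiR adj q) := by
  have h := unit_xiR adj q p hp
  have : IsSplitMono (g ◁ p) := ⟨⟨⟨xiR adj q ≫ (ρ_ g).inv, by
    rw [← Category.assoc, h, Iso.hom_inv_id]⟩⟩⟩
  have : IsIso (g ◁ p) := isIso_of_epi_of_isSplitMono _
  have : IsIso (g ◁ p ≫ xiR adj q) := by rw [h]; infer_instance
  exact IsIso.of_isIso_comp_left (g ◁ p) _

include hp in
lemma gammaR_unit [IsIso (xiR adj q)] : gammaR adj q = 𝟙 _ := by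
  refine gammaR_eq_of_factors adj q (by simp) ((ρ_ g).inv ≫ g ◁ p) ?_
  rw [Category.assoc, ← whiskerLeft_comp_assoc, hp]
  simp [Adjunction.homEquiv₂_apply]

end Unit

end AdjunctionRight

variable {K : Type u} [CommRing K]

/-! ### Comonadic functors and split equalizers. -/

section Comonadic

universe v₁ u₁ u₂
variable {𝒞 : Type u₁} [Category.{v₁} 𝒞] {𝒟 : Type u₂} [Category.{v₁} 𝒟]

/-- L is the comparison equivalence followed by the forgetful functor from coalgebras, and both
reflect isomorphisms. -/
lemma reflectsIsomorphisms_of_comonadic (L : 𝒞 ⥤ 𝒟) [ComonadicLeftAdjoint L] :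
    L.ReflectsIsomorphisms :=
  reflectsIsomorphisms_of_iso (Comonad.comparisonForget (comonadicAdjunction L))

/-- A comonadic functor preserves equalizers of cosplit pairs. -/
def isLimitMapOfComonadic (L : 𝒞 ⥤ 𝒟) [ComonadicLeftAdjoint L] {X Y Z : 𝒞} {p q : X ⟶ Y}
    {e : Z ⟶ X} (w : e ≫ p = e ≫ q) (he : Limits.IsLimit (Limits.Fork.ofι e w)) {W : 𝒟}
    {s : W ⟶ L.obj X} (hs : IsSplitEqualizer (L.map p) (L.map q) s) :
    Limits.IsLimit (Limits.Fork.ofι (L.map e) (by rw [← L.map_comp, w, L.map_comp]) :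
      Limits.Fork (L.map p) (L.map q)) :=
  have h : HasSplitEqualizer (L.map p) (L.map q) := ⟨W, s, ⟨hs⟩⟩
  letI : L.IsCosplitPair p q := h
  letI := Comonad.createsFSplitEqualizersOfComonadic (F := L) p q
  -- The split equalizer shows that the image pair has a limit, and a created limit over an existing
  -- one is preserved.
  have : Limits.HasEqualizer (L.map p) (L.map q) := ⟨⟨_, hs.isEqualizer⟩⟩
  have : Limits.HasLimit (Limits.parallelPair p q ⋙ L) :=
    Limits.hasLimit_of_iso (F := Limits.parallelPair (L.map p) (L.map q))
      (Limits.diagramIsoParallelPair (Limits.parallelPair p q ⋙ L)).symm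
  Limits.isLimitForkMapOfIsLimit L w he

/-- A pair is split if its image under `L` is, when the identity is a retract of `L`. -/
def splitOfSplitMap (L : 𝒞 ⥤ 𝒞) (η : 𝟭 𝒞 ⟶ L) (r : L ⟶ 𝟭 𝒞) (hr : η ≫ r = 𝟙 _)
    {X Y Z : 𝒞} {p q : X ⟶ Y} {e : Z ⟶ X} (w : e ≫ p = e ≫ q)
    (he : Limits.IsLimit (Limits.Fork.ofι e w)) {W : 𝒞}
    {s : W ⟶ L.obj X} (hs : IsSplitEqualizer (L.map p) (L.map q) s) : IsSplitEqualizer p q e :=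
  let t : Y ⟶ X := η.app Y ≫ hs.rightRetraction ≫ r.app X
  have hr' (Z : 𝒞) : η.app Z ≫ r.app Z = 𝟙 Z := congr_app hr Z
  have hp (z : X ⟶ Y) : z ≫ t = η.app X ≫ (L.map z ≫ hs.rightRetraction) ≫ r.app X := by
    have := η.naturality_assoc z (hs.rightRetraction ≫ r.app X)
    simpa [t] using this
  have hq : q ≫ t = 𝟙 X := by
    rw [hp, hs.bottom_rightRetraction, Category.id_comp, hr']
  -- By naturality of r the composite passes through s ≫ L(z), which is the same for z = p and z =
  -- q. So p ≫ t equalizes the pair and lifts along e to the left retraction.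
  have hpt (z : X ⟶ Y) : (p ≫ t) ≫ z =
      η.app X ≫ (hs.leftRetraction ≫ s ≫ L.map z) ≫ r.app Y := by
    rw [hp, hs.top_rightRetraction]
    simp
  let l := Limits.Fork.IsLimit.lift he (p ≫ t) (by rw [hpt, hpt, hs.condition])
  have hl : l ≫ e = p ≫ t := Limits.Fork.IsLimit.lift_ι he
  { leftRetraction := l
    rightRetraction := t
    condition := w
    -- Since e ≫ p ≫ t = e ≫ q ≫ t = e, the claim holds after e, and an equalizer is monic.
    ι_leftRetraction := Limits.Fork.IsLimit.hom_ext he (by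
      have : e ≫ l ≫ e = e := by rw [hl, reassoc_of% w, hq, Category.comp_id]
      simpa using this)
    bottom_rightRetraction := hq
    top_rightRetraction := hl.symm }

end Comonadic

variable {A B C D : KCat K}

/-! ### Equalizers of bimodules are detected on columns and on rows. -/

section Functors

/-- The functor `φ ↦ φ(-, a)`. -/
def colFunctor (B : KCat K) (a : A) : Bimod A B ⥤ KFun K (B : Type u)ᵒᵖ where
  obj φ := ⟨φ.col a, φ.property.1 a⟩
  map η := ObjectProperty.homMk (η.hom.app a)

/-- The functor `φ ↦ φ(b, -)`. -/
def rowFunctor (A : KCat K) (b : B) : Bimod A B ⥤ KFun K (A : Type u) where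
  obj φ := ⟨φ.row b, φ.property.2 (op b)⟩
  map η := ObjectProperty.homMk (((flipFunctor _ _ _).map η.hom).app (op b))

/-- The transformation `φ(-, a) → φ(-, a')` given by `a ⟶ a'`. -/
def colTrans (B : KCat K) {a a' : A} (u : a ⟶ a') : colFunctor B a ⟶ colFunctor B a' where
  app φ := ObjectProperty.homMk (φ.obj.map u)
  naturality φ ψ η := ObjectProperty.hom_ext _ (η.hom.naturality u).symm

/-- The transformation `φ(b', -) → φ(b, -)` given by `b ⟶ b'`. -/
def rowTrans (A : KCat K) {b b' : B} (v : b ⟶ b') : rowFunctor A b' ⟶ rowFunctor A b where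
  app φ := ObjectProperty.homMk (φ.obj.flip.map v.op)
  naturality φ ψ η := ObjectProperty.hom_ext _
    (((flipFunctor _ _ _).map η.hom).naturality v.op).symm

variable {φ ψ χ : Bimod A B} {p q : φ ⟶ ψ} {e : χ ⟶ φ} (w : e ≫ p = e ≫ q)

/-- The functors `φ ↦ φ(-, a)` jointly reflect equalizers. -/
def isLimitOfCol (h : ∀ a : A, Limits.IsLimit (Limits.Fork.ofι ((colFunctor B a).map e)
      (by rw [← Functor.map_comp, w, Functor.map_comp]) :
      Limits.Fork ((colFunctor B a).map p) ((colFunctor B a).map q))) :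
    Limits.IsLimit (Limits.Fork.ofι e w) := by
  have cond (s : Limits.Fork p q) (a : A) : (colFunctor B a).map s.ι ≫ (colFunctor B a).map p =
      (colFunctor B a).map s.ι ≫ (colFunctor B a).map q := by
    rw [← Functor.map_comp, s.condition, Functor.map_comp]
  let l (s : Limits.Fork p q) (a : A) : (colFunctor B a).obj s.pt ⟶ (colFunctor B a).obj χ :=
    Limits.Fork.IsLimit.lift (h a) _ (cond s a)
  have hl (s : Limits.Fork p q) (a : A) : l s a ≫ (colFunctor B a).map e =
      (colFunctor B a).map s.ι := Limits.Fork.IsLimit.lift_ι (h a)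
  refine Limits.Fork.IsLimit.mk _ (fun s => ObjectProperty.homMk
    { app := fun a => (l s a).hom
      naturality := fun a a' u => ?_ }) (fun s => ?_) (fun s m hm => ?_)
  -- The columnwise lifts are natural in a because both sides agree after the column of e at a',
  -- which is monic.
  · have : (colTrans B u).app s.pt ≫ l s a' = l s a ≫ (colTrans B u).app χ := by
      refine Limits.Fork.IsLimit.hom_ext (h a') ?_
      change (_ ≫ _) ≫ (colFunctor B a').map e = (_ ≫ _) ≫ (colFunctor B a').map e
      rw [Category.assoc, Category.assoc, hl, ← NatTrans.naturality, ← NatTrans.naturality,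
        reassoc_of% hl]
    exact congrArg (·.hom) this
  · refine ObjectProperty.hom_ext _ (NatTrans.ext (funext fun a => ?_))
    exact congrArg (·.hom) (hl s a)
  · refine ObjectProperty.hom_ext _ (NatTrans.ext (funext fun a => ?_))
    refine congrArg (·.hom) (a₁ := (colFunctor B a).map m) (a₂ := l s a)
      (Limits.Fork.IsLimit.hom_ext (h a) ?_)
    change (colFunctor B a).map m ≫ (colFunctor B a).map e = l s a ≫ (colFunctor B a).map e
    rw [hl, ← Functor.map_comp]
    exact congrArg _ hm

/-- The functors `φ ↦ φ(b, -)` jointly reflect equalizers. -/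
def isLimitOfRow (h : ∀ b : B, Limits.IsLimit (Limits.Fork.ofι ((rowFunctor A b).map e)
      (by rw [← Functor.map_comp, w, Functor.map_comp]) :
      Limits.Fork ((rowFunctor A b).map p) ((rowFunctor A b).map q))) :
    Limits.IsLimit (Limits.Fork.ofι e w) := by
  have cond (s : Limits.Fork p q) (b : B) : (rowFunctor A b).map s.ι ≫ (rowFunctor A b).map p =
      (rowFunctor A b).map s.ι ≫ (rowFunctor A b).map q := by
    rw [← Functor.map_comp, s.condition, Functor.map_comp]
  let l (s : Limits.Fork p q) (b : B) : (rowFunctor A b).obj s.pt ⟶ (rowFunctor A b).obj χ :=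
    Limits.Fork.IsLimit.lift (h b) _ (cond s b)
  have hl (s : Limits.Fork p q) (b : B) : l s b ≫ (rowFunctor A b).map e =
      (rowFunctor A b).map s.ι := Limits.Fork.IsLimit.lift_ι (h b)
  -- The rowwise lifts form a transformation of the flipped functors; flipping it back gives the
  -- morphism of bimodules.
  refine Limits.Fork.IsLimit.mk _ (fun s => ObjectProperty.homMk ((flipFunctor _ _ _).map
    { app := fun b => (l s b.unop).hom
      naturality := fun b b' v => ?_ : s.pt.obj.flip ⟶ χ.obj.flip })) (fun s => ?_) (fun s m hm => ?_)
  · have : (rowTrans A v.unop).app s.pt ≫ l s b'.unop = l s b.unop ≫ (rowTrans A v.unop).app χ := by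
      refine Limits.Fork.IsLimit.hom_ext (h b'.unop) ?_
      change (_ ≫ _) ≫ (rowFunctor A b'.unop).map e = (_ ≫ _) ≫ (rowFunctor A b'.unop).map e
      rw [Category.assoc, Category.assoc, hl, ← NatTrans.naturality, ← NatTrans.naturality,
        reassoc_of% hl]
    exact congrArg (·.hom) this
  · refine Bimod.hom_ext' fun b a => ?_
    exact congrArg (fun z => (z.hom.app a).hom) (hl s b)
  · refine Bimod.hom_ext' fun b a => ?_
    refine congrArg (fun z => (z.hom.app a).hom) (a₁ := (rowFunctor A b).map m) (a₂ := l s b)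
      (Limits.Fork.IsLimit.hom_ext (h b) ?_)
    change (rowFunctor A b).map m ≫ (rowFunctor A b).map e = l s b ≫ (rowFunctor A b).map e
    rw [hl, ← Functor.map_comp]
    exact congrArg _ hm

end Functors

/-! ### Equalizers, quotients and ranges of bimodules. -/

namespace Bimod

namespace Sub

variable {φ ψ χ : Bimod A B}

/-- The equalizer of two morphisms of bimodules. -/
def eq (p q : φ ⟶ ψ) : φ.Sub where
  carrier b a := LinearMap.eqLocus (ap p b a) (ap q b a)
  actCol_mem v a x hx := by
    rw [LinearMap.mem_eqLocus] at hx ⊢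
    rw [ap_actCol, ap_actCol, hx]
  actRow_mem b u x hx := by
    rw [LinearMap.mem_eqLocus] at hx ⊢
    rw [ap_actRow, ap_actRow, hx]

lemma mem_incl (I : φ.Sub) {b : B} {a : A} (x : I.toBimod.val b a) :
    ap I.incl b a x ∈ I.carrier b a := x.2

lemma ap_incl_injective (I : φ.Sub) (b : B) (a : A) : Function.Injective (ap I.incl b a) :=
  Subtype.val_injective

lemma exists_ap_incl (I : φ.Sub) {b : B} {a : A} {x : φ.val b a} (hx : x ∈ I.carrier b a) :
    ∃ y : I.toBimod.val b a, ap I.incl b a y = x := ⟨⟨x, hx⟩, rfl⟩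

lemma eq_condition (p q : φ ⟶ ψ) : (eq p q).incl ≫ p = (eq p q).incl ≫ q :=
  hom_ext' fun b a => LinearMap.ext fun x => (eq p q).mem_incl x

/-- The corestriction of a morphism to a subbimodule. -/
def lift (I : φ.Sub) (θ : χ ⟶ φ) (h : ∀ b a x, ap θ b a x ∈ I.carrier b a) : χ ⟶ I.toBimod :=
  ObjectProperty.homMk
    { app := fun a =>
        { app := fun b => ModuleCat.ofHom ((ap θ b.unop a).codRestrict (I.carrier b.unop a)
            (h b.unop a))
          naturality := fun b b' v => ModuleCat.hom_ext (LinearMap.ext fun x =>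
            Subtype.ext (ap_actCol θ v.unop a x)) }
      naturality := fun a a' u => NatTrans.ext (funext fun b => ModuleCat.hom_ext
        (LinearMap.ext fun x => Subtype.ext (ap_actRow θ b.unop u x))) }

instance (I : φ.Sub) : Mono I.incl :=
  ⟨fun z z' h => hom_ext' fun b a => LinearMap.ext fun x => I.ap_incl_injective b a
    (congrArg (fun t => ap t b a x) h)⟩

/-- The equalizer is a limit. -/
def isLimitEq (p q : φ ⟶ ψ) : Limits.IsLimit (Limits.Fork.ofι (eq p q).incl (eq_condition p q)) :=
  Limits.Fork.IsLimit.mk _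
    (fun s => (eq p q).lift s.ι fun b a x => congrArg (fun t => ap t b a x) s.condition)
    (fun s => rfl)
    (fun s m hm => (cancel_mono (eq p q).incl).1 hm)

/-- The columns of the equalizer are equalizers. -/
def isLimitColEq (p q : φ ⟶ ψ) (a : A) : Limits.IsLimit (Limits.Fork.ofι
    ((colFunctor B a).map (eq p q).incl)
    (by rw [← Functor.map_comp, eq_condition, Functor.map_comp]) :
      Limits.Fork ((colFunctor B a).map p) ((colFunctor B a).map q)) :=
  Limits.Fork.IsLimit.mk _
    (fun s => ObjectProperty.homMk
      { app := fun b => ModuleCat.ofHom ((s.ι.hom.app b).hom.codRestrict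
          ((eq p q).carrier b.unop a)
          fun x => LinearMap.mem_eqLocus.2 (congrArg
            (fun t : s.pt ⟶ (colFunctor B a).obj ψ => (t.hom.app b).hom x) s.condition))
        naturality := fun b b' v => ModuleCat.hom_ext (LinearMap.ext fun x =>
          Subtype.ext (congrArg (fun t => t.hom x) (s.ι.hom.naturality v))) })
    (fun s => rfl)
    (fun s m hm => ObjectProperty.hom_ext _ (NatTrans.ext (funext fun b =>
      ModuleCat.hom_ext (LinearMap.ext fun x =>
        Subtype.ext (congrArg (fun t => (t.hom.app b).hom x) hm)))))

/-- The rows of the equalizer are equalizers. -/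
def isLimitRowEq (p q : φ ⟶ ψ) (b : B) : Limits.IsLimit (Limits.Fork.ofι
    ((rowFunctor A b).map (eq p q).incl)
    (by rw [← Functor.map_comp, eq_condition, Functor.map_comp]) :
      Limits.Fork ((rowFunctor A b).map p) ((rowFunctor A b).map q)) :=
  Limits.Fork.IsLimit.mk _
    (fun s => ObjectProperty.homMk
      { app := fun a => ModuleCat.ofHom ((s.ι.hom.app a).hom.codRestrict
          ((eq p q).carrier b a)
          fun x => LinearMap.mem_eqLocus.2 (congrArg
            (fun t : s.pt ⟶ (rowFunctor A b).obj ψ => (t.hom.app a).hom x) s.condition))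
        naturality := fun a a' v => ModuleCat.hom_ext (LinearMap.ext fun x =>
          Subtype.ext (congrArg (fun t => t.hom x) (s.ι.hom.naturality v))) })
    (fun s => rfl)
    (fun s m hm => ObjectProperty.hom_ext _ (NatTrans.ext (funext fun b =>
      ModuleCat.hom_ext (LinearMap.ext fun x =>
        Subtype.ext (congrArg (fun t => (t.hom.app b).hom x) hm)))))

/-- The quotient by a subbimodule, for fixed `a`. -/
def quotCol (I : φ.Sub) (a : A) : (B : Type u)ᵒᵖ ⥤ ModuleCat.{u} K where
  obj b := ModuleCat.of K (φ.val b.unop a ⧸ I.carrier b.unop a)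
  map {b b'} v := ModuleCat.ofHom
    ((I.carrier b.unop a).mapQ (I.carrier b'.unop a) (φ.actCol v.unop a)
      fun x hx => I.actCol_mem v.unop a hx)
  map_id b := ModuleCat.hom_ext (Submodule.linearMap_qext _ (LinearMap.ext fun x =>
    congrArg (Submodule.mkQ _) (φ.actCol_id b.unop a x)))
  map_comp v w := ModuleCat.hom_ext (Submodule.linearMap_qext _ (LinearMap.ext fun x =>
    congrArg (Submodule.mkQ _) (φ.actCol_comp w.unop v.unop a x)))

/-- The quotient by a subbimodule. -/
def quot (I : φ.Sub) : Bimod A B :=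
  ⟨{  obj := I.quotCol
      map := fun {a a'} u =>
        { app := fun b => ModuleCat.ofHom
            ((I.carrier b.unop a).mapQ (I.carrier b.unop a') (φ.actRow b.unop u)
              fun x hx => I.actRow_mem b.unop u hx)
          naturality := fun b b' v => ModuleCat.hom_ext (Submodule.linearMap_qext _
            (LinearMap.ext fun x =>
              congrArg (Submodule.mkQ _) (φ.actCol_actRow v.unop u x).symm)) }
      map_id := fun a => NatTrans.ext (funext fun b => ModuleCat.hom_ext
        (Submodule.linearMap_qext _ (LinearMap.ext fun x =>
          congrArg (Submodule.mkQ _) (φ.actRow_id b.unop a x))))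
      map_comp := fun u u' => NatTrans.ext (funext fun b => ModuleCat.hom_ext
        (Submodule.linearMap_qext _ (LinearMap.ext fun x =>
          congrArg (Submodule.mkQ _) (φ.actRow_comp b.unop u u' x)))) },
    fun a => IsKLinear.mk'
      (fun v w x => Submodule.Quotient.induction_on _ x fun x =>
        congrArg (Submodule.mkQ _) ((φ.property.1 a).map_add v w x))
      (fun r v x => Submodule.Quotient.induction_on _ x fun x =>
        congrArg (Submodule.mkQ _) ((φ.property.1 a).map_smul r v x)),
    fun b => IsKLinear.mk'
      (fun v w x => Submodule.Quotient.induction_on _ x fun x =>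
        congrArg (Submodule.mkQ _) ((φ.property.2 b).map_add v w x))
      (fun r v x => Submodule.Quotient.induction_on _ x fun x =>
        congrArg (Submodule.mkQ _) ((φ.property.2 b).map_smul r v x))⟩

/-- The projection onto the quotient by a subbimodule. -/
def proj (I : φ.Sub) : φ ⟶ I.quot :=
  ObjectProperty.homMk
    { app := fun a => { app := fun b => ModuleCat.ofHom (I.carrier b.unop a).mkQ } }

lemma ap_proj_eq_zero (I : φ.Sub) {b : B} {a : A} (x : φ.val b a) :
    ap I.proj b a x = 0 ↔ x ∈ I.carrier b a :=
  Submodule.Quotient.mk_eq_zero _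

/-- The range of a morphism of bimodules. -/
def range (p : φ ⟶ ψ) : ψ.Sub where
  carrier b a := LinearMap.range (ap p b a)
  actCol_mem := by
    rintro b b' v a _ ⟨x, rfl⟩
    exact ⟨_, ap_actCol p v a x⟩
  actRow_mem := by
    rintro a a' b u _ ⟨x, rfl⟩
    exact ⟨_, ap_actRow p b u x⟩

end Sub

end Bimod

/-! ### The unit of the adjunction as a natural transformation, and its retraction. -/

section Unit

open Bicategory

universe w v₁ v₂
variable {𝔹 : Type v₂} [Bicategory.{w, v₁} 𝔹] {a b : 𝔹} {f : a ⟶ b} {g : b ⟶ a}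

/-- The transformation `h → f* ⊗ f ⊗ h` given by the unit. -/
def unitTransL (adj : f ⊣ g) (c : 𝔹) : 𝟭 (c ⟶ a) ⟶ postcomp c f ⋙ postcomp c g where
  app h := (ρ_ h).inv ≫ h ◁ adj.unit ≫ (α_ h f g).inv
  naturality h k z := by
    dsimp only [Functor.id_map, Functor.comp_map, postcomp, Functor.id_obj, Functor.comp_obj]
    calc
      _ = 𝟙 _ ⊗≫ (z ▷ 𝟙 a ≫ k ◁ adj.unit) ⊗≫ 𝟙 _ := by bicategory
      _ = _ := by rw [← whisker_exchange]; bicategory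

/-- The transformation `f* ⊗ f ⊗ h → h` given by a map `f* ⊗ f → 1`. -/
def retrTransL (r : f ≫ g ⟶ 𝟙 a) (c : 𝔹) : postcomp c f ⋙ postcomp c g ⟶ 𝟭 (c ⟶ a) where
  app h := (α_ h f g).hom ≫ h ◁ r ≫ (ρ_ h).hom
  naturality h k z := by
    dsimp only [Functor.id_map, Functor.comp_map, postcomp, Functor.id_obj, Functor.comp_obj]
    calc
      _ = 𝟙 _ ⊗≫ (z ▷ (f ≫ g) ≫ k ◁ r) ⊗≫ 𝟙 _ := by bicategory
      _ = _ := by rw [← whisker_exchange]; bicategory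

lemma unitTransL_retrTransL (adj : f ⊣ g) {r : f ≫ g ⟶ 𝟙 a} (hr : adj.unit ≫ r = 𝟙 _) (c : 𝔹) :
    unitTransL adj c ≫ retrTransL r c = 𝟙 _ := by
  ext h
  change ((ρ_ h).inv ≫ h ◁ adj.unit ≫ (α_ h f g).inv) ≫ (α_ h f g).hom ≫ h ◁ r ≫ (ρ_ h).hom = 𝟙 h
  rw [Category.assoc, Category.assoc, Iso.inv_hom_id_assoc, ← whiskerLeft_comp_assoc, hr]
  simp

instance (adj : f ⊣ g) {c : 𝔹} (h : c ⟶ a) [Mono (h ◁ adj.unit)] :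
    Mono ((unitTransL adj c).app h) :=
  inferInstanceAs (Mono ((ρ_ h).inv ≫ h ◁ adj.unit ≫ (α_ h f g).inv))

/-- The transformation `h → h ⊗ f* ⊗ f` given by the unit. -/
def unitTransR (adj : f ⊣ g) (c : 𝔹) : 𝟭 (a ⟶ c) ⟶ precomp c g ⋙ precomp c f where
  app h := (λ_ h).inv ≫ adj.unit ▷ h ≫ (α_ f g h).hom
  naturality h k z := by
    dsimp only [Functor.id_map, Functor.comp_map, precomp, Functor.id_obj, Functor.comp_obj]
    calc
      _ = 𝟙 _ ⊗≫ (𝟙 a ◁ z ≫ adj.unit ▷ k) ⊗≫ 𝟙 _ := by bicategory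
      _ = _ := by rw [whisker_exchange]; bicategory

/-- The transformation `h ⊗ f* ⊗ f → h` given by a map `f* ⊗ f → 1`. -/
def retrTransR (r : f ≫ g ⟶ 𝟙 a) (c : 𝔹) : precomp c g ⋙ precomp c f ⟶ 𝟭 (a ⟶ c) where
  app h := (α_ f g h).inv ≫ r ▷ h ≫ (λ_ h).hom
  naturality h k z := by
    dsimp only [Functor.id_map, Functor.comp_map, precomp, Functor.id_obj, Functor.comp_obj]
    calc
      _ = 𝟙 _ ⊗≫ ((f ≫ g) ◁ z ≫ r ▷ k) ⊗≫ 𝟙 _ := by bicategory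
      _ = _ := by rw [whisker_exchange]; bicategory

lemma unitTransR_retrTransR (adj : f ⊣ g) {r : f ≫ g ⟶ 𝟙 a} (hr : adj.unit ≫ r = 𝟙 _) (c : 𝔹) :
    unitTransR adj c ≫ retrTransR r c = 𝟙 _ := by
  ext h
  change ((λ_ h).inv ≫ adj.unit ▷ h ≫ (α_ f g h).hom) ≫ (α_ f g h).inv ≫ r ▷ h ≫ (λ_ h).hom = 𝟙 h
  rw [Category.assoc, Category.assoc, Iso.hom_inv_id_assoc, ← comp_whiskerRight_assoc, hr]
  simp

instance (adj : f ⊣ g) {c : 𝔹} (h : a ⟶ c) [Mono (adj.unit ▷ h)] :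
    Mono ((unitTransR adj c).app h) :=
  inferInstanceAs (Mono ((λ_ h).inv ≫ adj.unit ▷ h ≫ (α_ f g h).hom))

end Unit

/-! ### Tensoring with surjections and with zero morphisms. -/

namespace Bimod

variable {φ φ' : Bimod A B}

/-- Right exactness of ⊗: a map out of χ⊗φ' is determined on elements y ⊗ x, and each x lifts along
p. -/
lemma epi_whiskerR (χ : Bimod B C) {p : φ ⟶ φ'} (hp : ∀ b a, Function.Surjective (ap p b a)) :
    Epi (whiskerR χ p) :=
  ⟨fun z z' h => hom_ext' fun c a => tens_ext fun b y x => by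
    obtain ⟨x, rfl⟩ := hp b a x
    simpa using congrArg (fun t => ap t c a (tmk χ φ c b a y x)) h⟩

lemma epi_whiskerL (χ : Bimod D A) {p : φ ⟶ φ'} (hp : ∀ b a, Function.Surjective (ap p b a)) :
    Epi (whiskerL p χ) :=
  ⟨fun z z' h => hom_ext' fun b d => tens_ext fun a y x => by
    obtain ⟨y, rfl⟩ := hp b a y
    simpa using congrArg (fun t => ap t b d (tmk φ χ b a d y x)) h⟩

lemma whiskerR_zero (χ : Bimod B C) : whiskerR χ (0 : φ ⟶ φ') = 0 :=
  hom_ext' fun c a => tens_ext fun b y x => by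
    rw [ap_whiskerR]
    exact map_zero (tmk χ φ' c b a y)

lemma whiskerL_zero (χ : Bimod D A) : whiskerL (0 : φ ⟶ φ') χ = 0 :=
  hom_ext' fun b d => tens_ext fun a y x => by
    rw [ap_whiskerL]
    exact LinearMap.map_zero₂ (tmk φ' χ b a d) x

lemma comp_proj_range (p : φ ⟶ φ') : p ≫ (Sub.range p).proj = 0 :=
  hom_ext' fun b a => LinearMap.ext fun x => ((Sub.range p).ap_proj_eq_zero _).2 ⟨x, rfl⟩

lemma surjective_of_proj_range {p : φ ⟶ φ'} (h : (Sub.range p).proj = 0) (b : B) (a : A) :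
    Function.Surjective (ap p b a) := fun x =>
  ((Sub.range p).ap_proj_eq_zero x).1 (congrArg (fun t => ap t b a x) h)

end Bimod

/-! ### The product of subbimodules as an image of I⊗J. -/

namespace ARing

variable {S : Mon (A ⟶ A)}

/-- The multiplication `I ⊗ J → S`. -/
def prodMap (I J : (bimod S).Sub) : I.toBimod.tens J.toBimod ⟶ bimod S :=
  Bimod.whiskerL I.incl J.toBimod ≫ Bimod.whiskerR (bimod S) J.incl ≫ mulHom S

lemma ap_prodMap (I J : (bimod S).Sub) (c b a : A) (y : I.toBimod.val c b)
    (x : J.toBimod.val b a) : Bimod.ap (prodMap I J) c a (Bimod.tmk _ _ c b a y x) =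
      mul S c b a (Bimod.ap I.incl c b y) (Bimod.ap J.incl b a x) := by
  simp [prodMap, mul]

lemma range_prodMap (I J : (bimod S).Sub) (c a : A) :
    LinearMap.range (Bimod.ap (prodMap I J) c a) = (I * J).carrier c a := by
  apply le_antisymm
  -- The inclusion is restated as the vanishing of a linear map into the quotient by IJ, which can
  -- be tested on pure tensors.
  · rw [LinearMap.range_le_iff_comap, ← Submodule.ker_mkQ ((I * J).carrier c a),
      ← LinearMap.ker_comp, LinearMap.ker_eq_top]
    refine Bimod.tens_ext fun b y x => ?_
    rw [LinearMap.comp_apply, ap_prodMap, LinearMap.zero_apply, Submodule.mkQ_apply,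
      Submodule.Quotient.mk_eq_zero]
    exact mul_mem (I.mem_incl y) (J.mem_incl x)
  · refine mul_le.2 fun b s hs t ht => ?_
    obtain ⟨y, rfl⟩ := I.exists_ap_incl hs
    obtain ⟨x, rfl⟩ := J.exists_ap_incl ht
    exact ⟨Bimod.tmk _ _ c b a y x, ap_prodMap I J c b a y x⟩

/-- The multiplication `I ⊗ J → I J`. -/
def prodHom (I J : (bimod S).Sub) : I.toBimod.tens J.toBimod ⟶ (I * J).toBimod :=
  (I * J).lift (prodMap I J) fun b a x => range_prodMap I J b a ▸ ⟨x, rfl⟩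

lemma prodHom_surjective (I J : (bimod S).Sub) (c a : A) :
    Function.Surjective (Bimod.ap (prodHom I J) c a) := fun y => by
  obtain ⟨x, hx⟩ := (range_prodMap I J c a).ge ((I * J).mem_incl y)
  exact ⟨x, (I * J).ap_incl_injective c a hx⟩

/-- The unit `1_A → 1`. -/
def oneHom (S : Mon (A ⟶ A)) : Bimod.one A ⟶ (1 : (bimod S).Sub).toBimod :=
  (1 : (bimod S).Sub).lift (unitHom S) fun b a x => ⟨x, rfl⟩

lemma oneHom_surjective (c a : A) : Function.Surjective (Bimod.ap (oneHom S) c a) := fun y => by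
  obtain ⟨x, hx⟩ := (1 : (bimod S).Sub).mem_incl y
  exact ⟨x, (1 : (bimod S).Sub).ap_incl_injective c a hx⟩

end ARing

/-! ### Statement (L). -/

section Left

open Bicategory ARing

variable {f : A ⟶ B} {g : B ⟶ A} (adj : Bicategory.Adjunction f g)

/-- The subbimodule of `S_f` attached to an endomorphism of `𝔠_f` with mate `θ`. -/
def eqL (θ : f ⟶ f ≫ g ≫ f) : (bimod (adjRing adj)).Sub :=
  Bimod.Sub.eq (φ := bimod (adjRing adj)) (coactL f g θ) (unitL adj)

/-- The inclusion of a subbimodule of `S_f`, as a `2`-cell. -/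
abbrev inclHom (I : (bimod (adjRing adj)).Sub) : (I.toBimod : A ⟶ A) ⟶ f ≫ g := I.incl

lemma eqL_condition (θ : f ⟶ f ≫ g ≫ f) :
    inclHom adj (eqL adj θ) ≫ coactL f g θ = inclHom adj (eqL adj θ) ≫ unitL adj :=
  Bimod.Sub.eq_condition _ _

/-- `f ⊗ -` preserves the equalizer that defines `eqL`. -/
def PreservesEqL : Prop :=
  ∀ θ : f ⟶ f ≫ g ≫ f, θ ≫ f ◁ adj.counit ≫ (ρ_ f).hom = 𝟙 f →
    (θ ≫ (α_ f g f).inv) ≫ coactL f g θ ▷ f = (θ ≫ (α_ f g f).inv) ≫ unitL adj ▷ f →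
    Nonempty (Limits.IsLimit (Limits.Fork.ofι (inclHom adj (eqL adj θ) ▷ f)
      (by rw [← comp_whiskerRight, eqL_condition, comp_whiskerRight]) :
        Limits.Fork (coactL f g θ ▷ f) (unitL adj ▷ f)))

/-- Morphisms that become invertible under `f ⊗ -` are surjective. -/
def ReflectsSurjL (f : A ⟶ B) : Prop :=
  ∀ (h k : A ⟶ A) (p : h ⟶ k), IsIso (p ▷ f) →
    ∀ b a, Function.Surjective (Bimod.ap (φ := h) (ψ := k) p b a)

lemma isLeftGenuine_iff (I : (bimod (adjRing adj)).Sub) :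
    IsLeftGenuine (adjRing adj) I ↔ IsIso (xiL adj (inclHom adj I)) :=
  isIso_whiskerRight_adjMul_iff adj (inclHom adj I)

lemma isIso_xiL_mul (I J : (bimod (adjRing adj)).Sub) [IsIso (xiL adj (inclHom adj I))]
    [IsIso (xiL adj (inclHom adj J))] : IsIso (xiL adj (inclHom adj (I * J))) :=
  have : Epi (Bicategory.whiskerRight (prodHom I J) f) :=
    Bimod.epi_whiskerR f (prodHom_surjective I J)
  isIso_xiL_product adj (inclHom adj I) (inclHom adj J) (inclHom adj (I * J)) (prodHom I J) rfl

lemma gammaL_mul (I J : (bimod (adjRing adj)).Sub) [IsIso (xiL adj (inclHom adj I))]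
    [IsIso (xiL adj (inclHom adj J))] [IsIso (xiL adj (inclHom adj (I * J)))] :
    gammaL adj (inclHom adj (I * J)) =
      gammaL adj (inclHom adj J) ≫ gammaL adj (inclHom adj I) :=
  gammaL_product adj (inclHom adj I) (inclHom adj J) (inclHom adj (I * J)) (prodHom I J) rfl

lemma isIso_xiL_one : IsIso (xiL adj (inclHom adj 1)) :=
  have : Epi (Bicategory.whiskerRight (oneHom (adjRing adj)) f) :=
    Bimod.epi_whiskerR f oneHom_surjective
  isIso_xiL_unit adj (inclHom adj 1) (oneHom (adjRing adj)) rfl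

lemma gammaL_one [IsIso (xiL adj (inclHom adj 1))] : gammaL adj (inclHom adj 1) = 𝟙 _ :=
  gammaL_unit adj (inclHom adj 1) (oneHom (adjRing adj)) rfl

/-- The monoid of left genuine subbimodules. -/
def leftGenuine : Submonoid (bimod (adjRing adj)).Sub where
  carrier := {I | IsLeftGenuine (adjRing adj) I}
  mul_mem' {I J} hI hJ := by
    have := (isLeftGenuine_iff adj I).1 hI
    have := (isLeftGenuine_iff adj J).1 hJ
    exact (isLeftGenuine_iff adj _).2 (isIso_xiL_mul adj I J)
  one_mem' := (isLeftGenuine_iff adj _).2 (isIso_xiL_one adj)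

instance (I : leftGenuine adj) : IsIso (xiL adj (inclHom adj I.1)) :=
  (isLeftGenuine_iff adj _).1 I.2

/-- The monoid homomorphism `Γ_f`. -/
def gammaLHom : leftGenuine adj →* End (adjCoring adj) where
  toFun I := Comon.Hom.mk' (M := adjCoring adj) (N := adjCoring adj) (gammaL adj (inclHom adj I.1))
    (gammaL_counit adj _) (gammaL_comul adj _)
  map_one' := by
    have : IsIso (xiL adj (inclHom adj 1)) := isIso_xiL_one adj
    exact Comon.ext (gammaL_one adj)
  map_mul' I J := by
    have : IsIso (xiL adj (inclHom adj (I.1 * J.1))) := isIso_xiL_mul adj I.1 J.1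
    -- The product α * β in `End` is β ≫ α, that is α∘β, which matches the order in `gammaL_mul`.
    exact Comon.ext (gammaL_mul adj I.1 J.1)

variable {adj}

lemma isIso_xiL_eqL (hA : PreservesEqL adj) {θ : f ⟶ f ≫ g ≫ f}
    (h₁ : θ ≫ f ◁ adj.counit ≫ (ρ_ f).hom = 𝟙 f)
    (h₂ : (θ ≫ (α_ f g f).inv) ≫ coactL f g θ ▷ f = (θ ≫ (α_ f g f).inv) ≫ unitL adj ▷ f) :
    IsIso (xiL adj (inclHom adj (eqL adj θ))) ∧
      ∃ φ, φ ≫ inclHom adj (eqL adj θ) ▷ f = θ ≫ (α_ f g f).inv := by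
  obtain ⟨hl⟩ := hA θ h₁ h₂
  have : Mono (inclHom adj (eqL adj θ) ▷ f) := Limits.mono_of_isLimit_fork hl
  have hφ : Limits.Fork.IsLimit.lift hl _ h₂ ≫ inclHom adj (eqL adj θ) ▷ f = _ :=
    Limits.Fork.IsLimit.lift_ι hl
  exact ⟨isIso_xiL_of_factors adj h₁ _ (eqL_condition adj θ) _ hφ, _, hφ⟩

lemma gammaLHom_surjective (hA : PreservesEqL adj) : Function.Surjective (gammaLHom adj) := by
  intro γ
  have hc : γ.hom ≫ adj.counit = adj.counit := IsComonHom.hom_counit γ.hom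
  have h₁ := (homEquiv_symm_counit adj γ.hom).1 hc
  have h₂ := (comul_iff_coactL adj γ.hom).1 (IsComonHom.hom_comul γ.hom)
  obtain ⟨h, φ, hφ⟩ := isIso_xiL_eqL hA h₁ h₂
  refine ⟨⟨eqL adj _, (isLeftGenuine_iff adj _).2 h⟩, Comon.ext ?_⟩
  refine gammaL_eq_of_factors adj _ hc φ ?_
  rw [← Category.assoc, hφ, Category.assoc, Iso.inv_hom_id, Category.comp_id]

lemma le_eqL {I : (bimod (adjRing adj)).Sub} {θ : f ⟶ f ≫ g ≫ f}
    (h : inclHom adj I ≫ coactL f g θ = inclHom adj I ≫ unitL adj) (b a : A)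
    (x : I.toBimod.val b a) : Bimod.ap I.incl b a x ∈ (eqL adj θ).carrier b a :=
  congrArg (fun t => Bimod.ap (φ := I.toBimod) t b a x) h

/-- The inclusion p of I into the equalizer E satisfies ξ_E∘(f⊗p) = ξ_I with both ξ invertible, so
f⊗p is invertible and p is onto. -/
lemma eq_eqL (hB : ReflectsSurjL f) (I : (bimod (adjRing adj)).Sub)
    [IsIso (xiL adj (inclHom adj I))]
    (h : IsIso (xiL adj (inclHom adj (eqL adj (thetaL adj (inclHom adj I)))))) :
    I = eqL adj (thetaL adj (inclHom adj I)) := by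
  set E := eqL adj (thetaL adj (inclHom adj I))
  have hle := le_eqL (comp_coactL adj (inclHom adj I))
  let p : (I.toBimod : A ⟶ A) ⟶ E.toBimod := E.lift I.incl hle
  have hp : p ≫ inclHom adj E = inclHom adj I := rfl
  have hp' : p ▷ f ≫ xiL adj (inclHom adj E) = xiL adj (inclHom adj I) := by
    rw [xiL_eq, xiL_eq, ← Category.assoc, ← comp_whiskerRight, hp]
  have : IsIso (p ▷ f ≫ xiL adj (inclHom adj E)) := by rw [hp']; infer_instance
  have : IsIso (p ▷ f) := IsIso.of_isIso_comp_right _ (xiL adj (inclHom adj E))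
  refine Bimod.Sub.ext (funext fun b => funext fun a => le_antisymm (fun x hx => ?_) fun x hx => ?_)
  · exact hle b a ⟨x, hx⟩
  · obtain ⟨y, hy⟩ := hB _ _ p this b a ⟨x, hx⟩
    have : Bimod.ap I.incl b a y = x := congrArg (Bimod.ap E.incl b a) hy
    exact this ▸ I.mem_incl y

/-- A left genuine I is the equalizer attached to θ_I, the mate of Γ(I), so Γ(I) determines it. -/
lemma gammaLHom_injective (hA : PreservesEqL adj) (hB : ReflectsSurjL f) :
    Function.Injective (gammaLHom adj) := by
  intro I J h
  have hγ : gammaL adj (inclHom adj I.1) = gammaL adj (inclHom adj J.1) := congrArg (·.hom) h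
  have hθ : thetaL adj (inclHom adj I.1) = thetaL adj (inclHom adj J.1) := by
    rw [← homEquiv_symm_gammaL, hγ, homEquiv_symm_gammaL]
  have key (I : leftGenuine adj) :
      IsIso (xiL adj (inclHom adj (eqL adj (thetaL adj (inclHom adj I.1))))) := by
    rw [← homEquiv_symm_gammaL]
    exact (isIso_xiL_eqL hA ((homEquiv_symm_counit adj _).1 (gammaL_counit adj _))
      ((comul_iff_coactL adj _).1 (gammaL_comul adj _))).1
  exact Subtype.ext ((eq_eqL hB I.1 (key I)).trans (hθ ▸ (eq_eqL hB J.1 (key J)).symm))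

theorem gammaLeftIso_of_preserves (hA : PreservesEqL adj) (hB : ReflectsSurjL f) :
    GammaLeftIso adj :=
  ⟨leftGenuine adj, fun I => Iff.rfl,
    MulEquiv.ofBijective (gammaLHom adj) ⟨gammaLHom_injective hA hB, gammaLHom_surjective hA⟩,
    fun I => ⟨inferInstanceAs (IsIso (xiL adj (inclHom adj I.1))), rfl⟩⟩

/-- By naturality of the unit, q followed by η⊗ψ equals η⊗φ followed by f*⊗f⊗q, which is zero; and
η⊗ψ is monic. -/
lemma eq_zero_of_whiskerR (h : ∀ k : A ⟶ A, Mono (k ◁ adj.unit)) {φ ψ : Bimod A A} {q : φ ⟶ ψ}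
    (hq : Bimod.whiskerR f q = 0) : q = 0 := by
  have := h ψ
  have n (z : φ ⟶ ψ) := (unitTransL adj A).naturality z
  refine (cancel_mono ((unitTransL adj A).app ψ)).1 ((n q).trans (Eq.trans ?_ (n 0).symm))
  refine congrArg (fun t => (unitTransL adj A).app φ ≫ t) ?_
  exact congrArg (Bimod.whiskerR g) (hq.trans (Bimod.whiskerR_zero f).symm)

/-- Test on the cokernel projection of p: tensored with f it vanishes after the isomorphism f⊗p,
hence is zero, hence so is the projection itself. -/
lemma reflectsSurjL_of_mono (h : ∀ k : A ⟶ A, Mono (k ◁ adj.unit)) : ReflectsSurjL f := by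
  intro φ ψ p hp
  refine Bimod.surjective_of_proj_range (eq_zero_of_whiskerR h ?_)
  refine (cancel_epi (p ▷ f)).1 ((Bimod.whiskerR_comp _ _).symm.trans ?_)
  refine (congrArg _ (Bimod.comp_proj_range _)).trans ((Bimod.whiskerR_zero _).trans ?_)
  exact Limits.comp_zero.symm

lemma reflectsSurjL_of_comonadic (f : A ⟶ B) [ComonadicLeftAdjoint (tensorLeft f)] :
    ReflectsSurjL f := by
  intro φ ψ p hp b a
  have := reflectsIsomorphisms_of_comonadic (tensorLeft f)
  -- By definition the column of f⊗p at a is f⊗- applied to the column of p, so the hypothesis on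
  -- [Aᵒᵖ, Mod_K] applies column by column.
  have h₁ : IsIso ((tensorLeft f).map ((colFunctor A a).map p)) :=
    inferInstanceAs (IsIso ((colFunctor B a).map (p ▷ f)))
  have h₂ : IsIso ((colFunctor A a).map p) := isIso_of_reflects_iso _ (tensorLeft f)
  intro y
  refine ⟨((inv ((colFunctor A a).map p)).hom.app (op b)).hom y, ?_⟩
  exact congrArg (fun t => (t.hom.app (op b)).hom y) (IsIso.inv_hom_id ((colFunctor A a).map p))

/-- The columns of a fork `f ⊗ e`. -/
def isLimitColWhiskerR (f : Bimod A B) {φ ψ χ : Bimod C A} {p q : φ ⟶ ψ} {e : χ ⟶ φ}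
    (w : e ≫ p = e ≫ q) (c : C)
    (h : Limits.IsLimit (Limits.Fork.ofι ((tensorLeft f).map ((colFunctor A c).map e))
      (by rw [← Functor.map_comp, ← Functor.map_comp, w, Functor.map_comp, Functor.map_comp]) :
        Limits.Fork ((tensorLeft f).map ((colFunctor A c).map p))
          ((tensorLeft f).map ((colFunctor A c).map q)))) :
    Limits.IsLimit (Limits.Fork.ofι ((colFunctor B c).map (Bimod.whiskerR f e))
      (by rw [← Functor.map_comp, ← Bimod.whiskerR_comp, w, Bimod.whiskerR_comp,
        Functor.map_comp]) :
        Limits.Fork ((colFunctor B c).map (Bimod.whiskerR f p))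
          ((colFunctor B c).map (Bimod.whiskerR f q))) := h

/-- The columns of a split pair `f ⊗ p`, `f ⊗ q`. -/
def splitColWhiskerR (f : Bimod A B) {φ ψ : Bimod C A} {p q : φ ⟶ ψ} {χ : Bimod C B}
    {s : χ ⟶ f.tens φ} (hs : IsSplitEqualizer (Bimod.whiskerR f p) (Bimod.whiskerR f q) s) (c : C) :
    IsSplitEqualizer ((tensorLeft f).map ((colFunctor A c).map p))
      ((tensorLeft f).map ((colFunctor A c).map q)) ((colFunctor B c).map s) :=
  hs.map (colFunctor B c)

/-- If `f ⊗ -` is comonadic, it preserves equalizers of bimodules that it splits. -/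
def isLimitWhiskerREq (f : Bimod A B) [ComonadicLeftAdjoint (tensorLeft f)] {φ ψ : Bimod C A}
    (p q : φ ⟶ ψ) {χ : Bimod C B} {s : χ ⟶ f.tens φ}
    (hs : IsSplitEqualizer (Bimod.whiskerR f p) (Bimod.whiskerR f q) s) :
    Limits.IsLimit (Limits.Fork.ofι (Bimod.whiskerR f (Bimod.Sub.eq p q).incl)
      (by rw [← Bimod.whiskerR_comp, Bimod.Sub.eq_condition, Bimod.whiskerR_comp]) :
        Limits.Fork (Bimod.whiskerR f p) (Bimod.whiskerR f q)) :=
  isLimitOfCol _ fun c => isLimitColWhiskerR f (Bimod.Sub.eq_condition p q) c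
    (isLimitMapOfComonadic (tensorLeft f) _ (Bimod.Sub.isLimitColEq p q c)
      (splitColWhiskerR f hs c))

lemma preservesEqL_of_comonadic (adj : Bicategory.Adjunction f g)
    [ComonadicLeftAdjoint (tensorLeft f)] : PreservesEqL adj := by
  intro θ h₁ h₂
  exact ⟨isLimitWhiskerREq f (coactL f g θ) (unitL adj) (splitL adj h₁ h₂)⟩

lemma preservesEqL_of_rightFlat (h : RightFlat f) : PreservesEqL adj := by
  intro θ h₁ h₂
  have := h A
  exact ⟨Limits.isLimitForkMapOfIsLimit (postcomp A f) (eqL_condition adj θ)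
    (Bimod.Sub.isLimitEq _ _)⟩

lemma preservesEqL_of_isSplitMono [IsSplitMono adj.unit] : PreservesEqL adj := by
  intro θ h₁ h₂
  -- Applying f*⊗- to the splitting of `splitL` splits the pair under f*⊗f⊗-. A retraction of η
  -- makes the identity a retract of this functor, so the original pair is split and every functor
  -- preserves its equalizer.
  have s := splitOfSplitMap _ (unitTransL adj A) (retrTransL (retraction adj.unit) A)
    (unitTransL_retrTransL adj (IsSplitMono.id _) A) (eqL_condition adj θ)
    (Bimod.Sub.isLimitEq _ _) ((splitL adj h₁ h₂).map (postcomp A g))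
  exact ⟨(s.map (postcomp A f)).isEqualizer⟩

end Left

/-! ### Statement (R), with rows in place of columns. -/

section Right

open Bicategory ARing

variable {f : A ⟶ B} {g : B ⟶ A} (adj : Bicategory.Adjunction f g)

/-- The subbimodule of `S_f` attached to an endomorphism of `𝔠_f` with mate `θ`. -/
def eqR (θ : g ⟶ (g ≫ f) ≫ g) : (bimod (adjRing adj)).Sub :=
  Bimod.Sub.eq (φ := bimod (adjRing adj)) (coactR f g θ) (unitR adj)

lemma eqR_condition (θ : g ⟶ (g ≫ f) ≫ g) :
    inclHom adj (eqR adj θ) ≫ coactR f g θ = inclHom adj (eqR adj θ) ≫ unitR adj :=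
  Bimod.Sub.eq_condition _ _

/-- `- ⊗ f*` preserves the equalizer that defines `eqR`. -/
def PreservesEqR : Prop :=
  ∀ θ : g ⟶ (g ≫ f) ≫ g, θ ≫ adj.counit ▷ g ≫ (λ_ g).hom = 𝟙 g →
    (θ ≫ (α_ g f g).hom) ≫ g ◁ coactR f g θ = (θ ≫ (α_ g f g).hom) ≫ g ◁ unitR adj →
    Nonempty (Limits.IsLimit (Limits.Fork.ofι (g ◁ inclHom adj (eqR adj θ))
      (by rw [← whiskerLeft_comp, eqR_condition, whiskerLeft_comp]) :
        Limits.Fork (g ◁ coactR f g θ) (g ◁ unitR adj)))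

/-- Morphisms that become invertible under `- ⊗ g` are surjective. -/
def ReflectsSurjR (g : B ⟶ A) : Prop :=
  ∀ (h k : A ⟶ A) (p : h ⟶ k), IsIso (g ◁ p) →
    ∀ b a, Function.Surjective (Bimod.ap (φ := h) (ψ := k) p b a)

lemma isRightGenuine_iff (I : (bimod (adjRing adj)).Sub) :
    IsRightGenuine (adjRing adj) I ↔ IsIso (xiR adj (inclHom adj I)) :=
  isIso_whiskerLeft_adjMul_iff adj (inclHom adj I)

lemma isIso_xiR_mul (I J : (bimod (adjRing adj)).Sub) [IsIso (xiR adj (inclHom adj I))]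
    [IsIso (xiR adj (inclHom adj J))] : IsIso (xiR adj (inclHom adj (I * J))) :=
  have : Epi (Bicategory.whiskerLeft g (prodHom I J)) :=
    Bimod.epi_whiskerL g (prodHom_surjective I J)
  isIso_xiR_product adj (inclHom adj I) (inclHom adj J) (inclHom adj (I * J)) (prodHom I J) rfl

lemma gammaR_mul (I J : (bimod (adjRing adj)).Sub) [IsIso (xiR adj (inclHom adj I))]
    [IsIso (xiR adj (inclHom adj J))] [IsIso (xiR adj (inclHom adj (I * J)))] :
    gammaR adj (inclHom adj (I * J)) =
      gammaR adj (inclHom adj I) ≫ gammaR adj (inclHom adj J) :=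
  gammaR_product adj (inclHom adj I) (inclHom adj J) (inclHom adj (I * J)) (prodHom I J) rfl

lemma isIso_xiR_one : IsIso (xiR adj (inclHom adj 1)) :=
  have : Epi (Bicategory.whiskerLeft g (oneHom (adjRing adj))) :=
    Bimod.epi_whiskerL g oneHom_surjective
  isIso_xiR_unit adj (inclHom adj 1) (oneHom (adjRing adj)) rfl

lemma gammaR_one [IsIso (xiR adj (inclHom adj 1))] : gammaR adj (inclHom adj 1) = 𝟙 _ :=
  gammaR_unit adj (inclHom adj 1) (oneHom (adjRing adj)) rfl

/-- The monoid of right genuine subbimodules. -/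
def rightGenuine : Submonoid (bimod (adjRing adj)).Sub where
  carrier := {I | IsRightGenuine (adjRing adj) I}
  mul_mem' {I J} hI hJ := by
    have := (isRightGenuine_iff adj I).1 hI
    have := (isRightGenuine_iff adj J).1 hJ
    exact (isRightGenuine_iff adj _).2 (isIso_xiR_mul adj I J)
  one_mem' := (isRightGenuine_iff adj _).2 (isIso_xiR_one adj)

instance (I : rightGenuine adj) : IsIso (xiR adj (inclHom adj I.1)) :=
  (isRightGenuine_iff adj _).1 I.2

/-- The monoid homomorphism `Γ_{f*}`. -/
def gammaRHom : (rightGenuine adj)ᵐᵒᵖ →* End (adjCoring adj) where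
  toFun I := Comon.Hom.mk' (M := adjCoring adj) (N := adjCoring adj)
    (gammaR adj (inclHom adj I.unop.1)) (gammaR_counit adj _) (gammaR_comul adj _)
  map_one' := by
    have : IsIso (xiR adj (inclHom adj 1)) := isIso_xiR_one adj
    exact Comon.ext (gammaR_one adj)
  map_mul' I J := by
    -- The product of I and J in the opposite monoid has J·I as its underlying subbimodule.
    have : IsIso (xiR adj (inclHom adj (J.unop.1 * I.unop.1))) :=
      isIso_xiR_mul adj J.unop.1 I.unop.1
    exact Comon.ext (gammaR_mul adj J.unop.1 I.unop.1)

variable {adj}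

lemma isIso_xiR_eqR (hA : PreservesEqR adj) {θ : g ⟶ (g ≫ f) ≫ g}
    (h₁ : θ ≫ adj.counit ▷ g ≫ (λ_ g).hom = 𝟙 g)
    (h₂ : (θ ≫ (α_ g f g).hom) ≫ g ◁ coactR f g θ = (θ ≫ (α_ g f g).hom) ≫ g ◁ unitR adj) :
    IsIso (xiR adj (inclHom adj (eqR adj θ))) ∧
      ∃ φ, φ ≫ g ◁ inclHom adj (eqR adj θ) = θ ≫ (α_ g f g).hom := by
  obtain ⟨hl⟩ := hA θ h₁ h₂
  have : Mono (g ◁ inclHom adj (eqR adj θ)) := Limits.mono_of_isLimit_fork hl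
  have hφ : Limits.Fork.IsLimit.lift hl _ h₂ ≫ g ◁ inclHom adj (eqR adj θ) = _ :=
    Limits.Fork.IsLimit.lift_ι hl
  exact ⟨isIso_xiR_of_factors adj h₁ _ (eqR_condition adj θ) _ hφ, _, hφ⟩

lemma gammaRHom_surjective (hA : PreservesEqR adj) : Function.Surjective (gammaRHom adj) := by
  intro γ
  have hc : γ.hom ≫ adj.counit = adj.counit := IsComonHom.hom_counit γ.hom
  have h₁ := (homEquiv_counit adj γ.hom).1 hc
  have h₂ := (comul_iff_coactR adj γ.hom).1 (IsComonHom.hom_comul γ.hom)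
  obtain ⟨h, φ, hφ⟩ := isIso_xiR_eqR hA h₁ h₂
  refine ⟨.op ⟨eqR adj _, (isRightGenuine_iff adj _).2 h⟩, Comon.ext ?_⟩
  refine gammaR_eq_of_factors adj (inclHom adj (eqR adj _)) hc φ ?_
  rw [← Category.assoc, hφ, Category.assoc, Iso.hom_inv_id, Category.comp_id]

lemma le_eqR {I : (bimod (adjRing adj)).Sub} {θ : g ⟶ (g ≫ f) ≫ g}
    (h : inclHom adj I ≫ coactR f g θ = inclHom adj I ≫ unitR adj) (b a : A)
    (x : I.toBimod.val b a) : Bimod.ap I.incl b a x ∈ (eqR adj θ).carrier b a :=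
  congrArg (fun t => Bimod.ap (φ := I.toBimod) t b a x) h

lemma eq_eqR (hB : ReflectsSurjR g) (I : (bimod (adjRing adj)).Sub)
    [IsIso (xiR adj (inclHom adj I))]
    (h : IsIso (xiR adj (inclHom adj (eqR adj (thetaR adj (inclHom adj I)))))) :
    I = eqR adj (thetaR adj (inclHom adj I)) := by
  set E := eqR adj (thetaR adj (inclHom adj I))
  have hle := le_eqR (comp_coactR adj (inclHom adj I))
  let p : (I.toBimod : A ⟶ A) ⟶ E.toBimod := E.lift I.incl hle
  have hp : p ≫ inclHom adj E = inclHom adj I := rfl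
  have hp' : g ◁ p ≫ xiR adj (inclHom adj E) = xiR adj (inclHom adj I) := by
    rw [xiR_eq, xiR_eq, ← Category.assoc, ← whiskerLeft_comp, hp]
  have : IsIso (g ◁ p ≫ xiR adj (inclHom adj E)) := by rw [hp']; infer_instance
  have : IsIso (g ◁ p) := IsIso.of_isIso_comp_right _ (xiR adj (inclHom adj E))
  refine Bimod.Sub.ext (funext fun b => funext fun a => le_antisymm (fun x hx => ?_) fun x hx => ?_)
  · exact hle b a ⟨x, hx⟩
  · obtain ⟨y, hy⟩ := hB _ _ p this b a ⟨x, hx⟩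
    have : Bimod.ap I.incl b a y = x := congrArg (Bimod.ap E.incl b a) hy
    exact this ▸ I.mem_incl y

lemma gammaRHom_injective (hA : PreservesEqR adj) (hB : ReflectsSurjR g) :
    Function.Injective (gammaRHom adj) := by
  intro I J h
  have hγ : gammaR adj (inclHom adj I.unop.1) = gammaR adj (inclHom adj J.unop.1) :=
    congrArg (·.hom) h
  have hθ : thetaR adj (inclHom adj I.unop.1) = thetaR adj (inclHom adj J.unop.1) := by
    rw [← homEquiv_gammaR, hγ, homEquiv_gammaR]
  have key (I : rightGenuine adj) :
      IsIso (xiR adj (inclHom adj (eqR adj (thetaR adj (inclHom adj I.1))))) := by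
    rw [← homEquiv_gammaR]
    exact (isIso_xiR_eqR hA ((homEquiv_counit adj _).1 (gammaR_counit adj _))
      ((comul_iff_coactR adj _).1 (gammaR_comul adj _))).1
  exact MulOpposite.unop_injective (Subtype.ext
    ((eq_eqR hB I.unop.1 (key I.unop)).trans (hθ ▸ (eq_eqR hB J.unop.1 (key J.unop)).symm)))

theorem gammaRightIso_of_preserves (hA : PreservesEqR adj) (hB : ReflectsSurjR g) :
    GammaRightIso adj :=
  ⟨rightGenuine adj, fun I => Iff.rfl,
    MulEquiv.ofBijective (gammaRHom adj) ⟨gammaRHom_injective hA hB, gammaRHom_surjective hA⟩,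
    fun I => ⟨inferInstanceAs (IsIso (xiR adj (inclHom adj I.1))), rfl⟩⟩

/-- The unit ψ → ψ⊗f*⊗f is monic and natural, so q vanishes if q⊗f* does. -/
lemma eq_zero_of_whiskerL (h : ∀ k : A ⟶ A, Mono (adj.unit ▷ k)) {φ ψ : Bimod A A} {q : φ ⟶ ψ}
    (hq : Bimod.whiskerL q g = 0) : q = 0 := by
  have := h ψ
  have n (z : φ ⟶ ψ) := (unitTransR adj A).naturality z
  refine (cancel_mono ((unitTransR adj A).app ψ)).1 ((n q).trans (Eq.trans ?_ (n 0).symm))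
  refine congrArg (fun t => (unitTransR adj A).app φ ≫ t) ?_
  exact congrArg (fun t => Bimod.whiskerL t f) (hq.trans (Bimod.whiskerL_zero g).symm)

lemma reflectsSurjR_of_mono (h : ∀ k : A ⟶ A, Mono (adj.unit ▷ k)) : ReflectsSurjR g := by
  intro φ ψ p hp
  refine Bimod.surjective_of_proj_range (eq_zero_of_whiskerL h ?_)
  refine (cancel_epi (g ◁ p)).1 ((Bimod.whiskerL_comp _ _).symm.trans ?_)
  refine (congrArg (fun t => Bimod.whiskerL t g) (Bimod.comp_proj_range _)).trans
    ((Bimod.whiskerL_zero _).trans ?_)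
  exact Limits.comp_zero.symm

lemma reflectsSurjR_of_comonadic (g : B ⟶ A) [ComonadicLeftAdjoint (tensorRight g)] :
    ReflectsSurjR g := by
  intro φ ψ p hp b a
  have := reflectsIsomorphisms_of_comonadic (tensorRight g)
  have h₁ : IsIso ((tensorRight g).map ((rowFunctor A b).map p)) :=
    inferInstanceAs (IsIso ((rowFunctor B b).map (g ◁ p)))
  have h₂ : IsIso ((rowFunctor A b).map p) := isIso_of_reflects_iso _ (tensorRight g)
  intro y
  refine ⟨((inv ((rowFunctor A b).map p)).hom.app a).hom y, ?_⟩
  exact congrArg (fun t => (t.hom.app a).hom y) (IsIso.inv_hom_id ((rowFunctor A b).map p))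

/-- The rows of a fork `e ⊗ g`. -/
def isLimitRowWhiskerL (g : Bimod B A) {φ ψ χ : Bimod A C} {p q : φ ⟶ ψ} {e : χ ⟶ φ}
    (w : e ≫ p = e ≫ q) (c : C)
    (h : Limits.IsLimit (Limits.Fork.ofι ((tensorRight g).map ((rowFunctor A c).map e))
      (by rw [← Functor.map_comp, ← Functor.map_comp, w, Functor.map_comp, Functor.map_comp]) :
        Limits.Fork ((tensorRight g).map ((rowFunctor A c).map p))
          ((tensorRight g).map ((rowFunctor A c).map q)))) :
    Limits.IsLimit (Limits.Fork.ofι ((rowFunctor B c).map (Bimod.whiskerL e g))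
      (by rw [← Functor.map_comp, ← Bimod.whiskerL_comp, w, Bimod.whiskerL_comp,
        Functor.map_comp]) :
        Limits.Fork ((rowFunctor B c).map (Bimod.whiskerL p g))
          ((rowFunctor B c).map (Bimod.whiskerL q g))) := h

/-- The rows of a split pair `p ⊗ g`, `q ⊗ g`. -/
def splitRowWhiskerL (g : Bimod B A) {φ ψ : Bimod A C} {p q : φ ⟶ ψ} {χ : Bimod B C}
    {s : χ ⟶ φ.tens g} (hs : IsSplitEqualizer (Bimod.whiskerL p g) (Bimod.whiskerL q g) s) (c : C) :
    IsSplitEqualizer ((tensorRight g).map ((rowFunctor A c).map p))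
      ((tensorRight g).map ((rowFunctor A c).map q)) ((rowFunctor B c).map s) :=
  hs.map (rowFunctor B c)

/-- If `- ⊗ g` is comonadic, it preserves equalizers of bimodules that it splits. -/
def isLimitWhiskerLEq (g : Bimod B A) [ComonadicLeftAdjoint (tensorRight g)] {φ ψ : Bimod A C}
    (p q : φ ⟶ ψ) {χ : Bimod B C} {s : χ ⟶ φ.tens g}
    (hs : IsSplitEqualizer (Bimod.whiskerL p g) (Bimod.whiskerL q g) s) :
    Limits.IsLimit (Limits.Fork.ofι (Bimod.whiskerL (Bimod.Sub.eq p q).incl g)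
      (by rw [← Bimod.whiskerL_comp, Bimod.Sub.eq_condition, Bimod.whiskerL_comp]) :
        Limits.Fork (Bimod.whiskerL p g) (Bimod.whiskerL q g)) :=
  isLimitOfRow _ fun c => isLimitRowWhiskerL g (Bimod.Sub.eq_condition p q) c
    (isLimitMapOfComonadic (tensorRight g) _ (Bimod.Sub.isLimitRowEq p q c)
      (splitRowWhiskerL g hs c))

lemma preservesEqR_of_comonadic (adj : Bicategory.Adjunction f g)
    [ComonadicLeftAdjoint (tensorRight g)] : PreservesEqR adj := by
  intro θ h₁ h₂
  exact ⟨isLimitWhiskerLEq g (coactR f g θ) (unitR adj) (splitR adj h₁ h₂)⟩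

lemma preservesEqR_of_leftFlat (h : LeftFlat g) : PreservesEqR adj := by
  intro θ h₁ h₂
  have := h A
  exact ⟨Limits.isLimitForkMapOfIsLimit (precomp A g) (eqR_condition adj θ)
    (Bimod.Sub.isLimitEq _ _)⟩

lemma preservesEqR_of_isSplitMono [IsSplitMono adj.unit] : PreservesEqR adj := by
  intro θ h₁ h₂
  -- Here -⊗f is applied to the splitting of `splitR`, and the identity is a retract of -⊗f*⊗f.
  have s := splitOfSplitMap _ (unitTransR adj A) (retrTransR (retraction adj.unit) A)
    (unitTransR_retrTransR adj (IsSplitMono.id _) A) (eqR_condition adj θ)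
    (Bimod.Sub.isLimitEq _ _) ((splitR adj h₁ h₂).map (precomp A f))
  exact ⟨(s.map (precomp A g)).isEqualizer⟩

end Right

end KBim

end

theorem mainTheorem9 {K : Type u} [CommRing K] {A B : KBim.KCat K} {f : A ⟶ B} {g : B ⟶ A}
    (adj : Bicategory.Adjunction f g) :
    (Nonempty (ComonadicLeftAdjoint (KBim.tensorLeft f)) → KBim.GammaLeftIso adj) ∧
    (Nonempty (ComonadicLeftAdjoint (KBim.tensorRight g)) → KBim.GammaRightIso adj) ∧
    (KBim.RightFlat f → KBim.RightPure adj.unit → KBim.GammaLeftIso adj) ∧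
    (KBim.LeftFlat g → KBim.LeftPure adj.unit → KBim.GammaRightIso adj) ∧
    (IsSplitMono adj.unit → KBim.GammaLeftIso adj ∧ KBim.GammaRightIso adj) := by
  refine ⟨fun ⟨h⟩ => ?_, fun ⟨h⟩ => ?_, fun h₁ h₂ => ?_, fun h₁ h₂ => ?_, fun h => ⟨?_, ?_⟩⟩
  · exact KBim.gammaLeftIso_of_preserves (KBim.preservesEqL_of_comonadic adj)
      (KBim.reflectsSurjL_of_comonadic f)
  · exact KBim.gammaRightIso_of_preserves (KBim.preservesEqR_of_comonadic adj)
      (KBim.reflectsSurjR_of_comonadic g)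
  · exact KBim.gammaLeftIso_of_preserves (KBim.preservesEqL_of_rightFlat h₁)
      -- Of purity only this is used: η⊗k is monic for the 1-cells k from A to itself.
      (KBim.reflectsSurjL_of_mono (adj := adj) fun k => have := h₂ A k; inferInstance)
  · exact KBim.gammaRightIso_of_preserves (KBim.preservesEqR_of_leftFlat h₁)
      (KBim.reflectsSurjR_of_mono (adj := adj) fun k => have := h₂ A k; inferInstance)
  · exact KBim.gammaLeftIso_of_preserves KBim.preservesEqL_of_isSplitMono
      (KBim.reflectsSurjL_of_mono (adj := adj) fun k =>
        -- Tensoring with k is a functor, so it keeps η split monic.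
        inferInstanceAs (Mono ((Bicategory.precomp _ k).map adj.unit)))
  · exact KBim.gammaRightIso_of_preserves KBim.preservesEqR_of_isSplitMono
      (KBim.reflectsSurjR_of_mono (adj := adj) fun k =>
        inferInstanceAs (Mono ((Bicategory.postcomp _ k).map adj.unit)))
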